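/- Formal schemes are taken in the sense of EGA I §10: topologically ringed spaces that are locally isomorphic to formal spectra $\operatorname{Spf} A$ of admissible rings $A$ (complete separated linearly topologized rings having an ideal of definition); morphisms are continuous morphisms of topologically ringed spaces inducing local homomorphisms on stalks. A formal scheme is noetherian if it is locally isomorphic to formal spectra of noetherian adic rings and its underlying space is quasi-compact. A morphism $f:\mathfrak X\to\mathfrak Y$ of noetherian formal schemes is of formally finite type if there are defining ideals $\mathcal I\subset\mathcal O_{\mathfrak X}$ and $\mathcal J\subset\mathcal O_{\mathfrak Y}$ with $f^{-1}\mathcal J\cdot\mathcal O_{\mathfrak X}\subset\mathcal I$ such that the induced morphism of schemes $(\mathfrak X,\mathcal O_{\mathfrak X}/\mathcal I)\to(\mathfrak Y,\mathcal O_{\mathfrak Y}/\mathcal J)$ is of finite type. Theorem 1.10. Let $\mathfrak X$, $\mathfrak Y$ and $\mathfrak Y'$ be noetherian formal schemes, let $\mathfrak X\to\mathfrak Y$ be a morphism of formally finite type, and let $\mathfrak Y'\to\mathfrak Y$ be an arbitrary morphism. Then the fibre product $\mathfrak X':=\mathfrak X\times_{\mathfrak Y}\mathfrak Y'$ in the category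 of formal schemes exists, $\mathfrak X'$ is noetherian, and the projection $\mathfrak X'\to\mathfrak Y'$ is of formally finite type. -/

import Mathlib

universe u

set_option linter.unusedSectionVars false

open CategoryTheory TopologicalSpace Opposite AlgebraicGeometry Topology

namespace FormalGeometry

noncomputable section

section Rings

variable (A : Type u) [CommRing A] [TopologicalSpace A]

variable {A} in
/-- An ideal of definition of a topological ring: an open ideal `J` whose powers tend to zero. -/
structure IsIdealOfDefinition (J : Ideal A) : Prop where
  isOpen : IsOpen (J : Set A)
  exists_pow_subset : ∀ V ∈ 𝓝 (0 : A), ∃ n : ℕ, ((J ^ n : Ideal A) : Set A) ⊆ V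

/-- Admissible rings: linearly topologized rings which have an ideal of definition, and which
are separated and complete. -/
class AdmissibleRing : Prop extends IsTopologicalRing A, IsLinearTopology A A where
  exists_isIdealOfDefinition : ∃ J : Ideal A, IsIdealOfDefinition J
  t2Space : T2Space A
  completeSpace : @CompleteSpace A (IsTopologicalAddGroup.rightUniformSpace A)

/-- A noetherian adic ring: a noetherian ring which is separated and complete, and whose topology
is the `J`-adic one for some ideal `J`. -/
structure IsNoetherianAdicRing [AdmissibleRing A] : Prop where
  isNoetherianRing : IsNoetherianRing A
  exists_isAdic : ∃ J : Ideal A, IsAdic J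

/-- The open ideals of `A`. -/
abbrev OpenIdeal : Type u := { I : Ideal A // IsOpen (I : Set A) }

/-- The open prime ideals of `A`, with the topology induced from `Spec A`. This is the underlying
space of the formal spectrum of `A`. -/
abbrev OpenPrime : Type u := { p : PrimeSpectrum A // IsOpen (p.asIdeal : Set A) }

end Rings

section Spf

variable {A : Type u} [CommRing A] [TopologicalSpace A] [AdmissibleRing A]

/-!
### The formal spectrum

The structure sheaf of `Spf A` is the limit, in the category of sheaves of topological rings, of the
sheaves of rings `O_{Spec (A / I)}`, where `I` runs over the open ideals of `A` (the ideals of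
definition are cofinal among these), each of them made a sheaf of topological rings in the
pseudo-discrete way: sections over a quasi-compact open set have the discrete topology.
-/

/-- The embedding of `Spec (A / I)` in the space of open primes, for an open ideal `I`. -/
def specToOpenPrime (I : OpenIdeal A) : C(PrimeSpectrum (A ⧸ I.1), OpenPrime A) where
  toFun p := ⟨PrimeSpectrum.comap (Ideal.Quotient.mk I.1) p, by
    refine AddSubgroup.isOpen_mono (H₁ := I.1.toAddSubgroup)
      (H₂ := (PrimeSpectrum.comap (Ideal.Quotient.mk I.1) p).asIdeal.toAddSubgroup) ?_ I.2
    intro a ha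
    change Ideal.Quotient.mk I.1 a ∈ p.asIdeal
    rw [Ideal.Quotient.eq_zero_iff_mem.mpr ha]
    exact p.asIdeal.zero_mem⟩
  continuous_toFun := by
    refine Continuous.subtype_mk (PrimeSpectrum.continuous_comap _) _

/-- The trace on `Spec (A / I)` of an open set of open primes. -/
abbrev preim (I : OpenIdeal A) (U : Opens (OpenPrime A)) :
    Opens (PrimeSpectrum.Top (A ⧸ I.1)) := Opens.comap (specToOpenPrime I) U

/-- The sections over `U` of `O_{Spec (A / I)}`, considered as a sheaf on the space of open primes. -/
abbrev Sec (I : OpenIdeal A) (U : Opens (OpenPrime A)) : CommRingCat.{u} :=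
  (Spec.structureSheaf (A ⧸ I.1)).1.obj (op (preim I U))

/-- The restriction maps of `O_{Spec (A / I)}`. -/
def res (I : OpenIdeal A) {U V : Opens (OpenPrime A)} (h : V ≤ U) : Sec I U →+* Sec I V :=
  ((Spec.structureSheaf (A ⧸ I.1)).1.map (homOfLE fun _ hp => h hp).op).hom

/-- The transition maps from `O_{Spec (A / I)}` to `O_{Spec (A / J)}`, for open ideals `I ≤ J`. -/
def trans {I J : OpenIdeal A} (h : I.1 ≤ J.1) (U : Opens (OpenPrime A)) :
    Sec I U →+* Sec J U :=
  StructureSheaf.comap (Ideal.Quotient.factor h) (preim I U) (preim J U) fun _ hp => hp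

lemma res_trans {I J : OpenIdeal A} (h : I.1 ≤ J.1) {U V : Opens (OpenPrime A)} (hV : V ≤ U)
    (s : Sec I U) : res J hV (trans h U s) = trans h V (res I hV s) := rfl


lemma res_res (I : OpenIdeal A) {U V W : Opens (OpenPrime A)} (h : V ≤ U) (h' : W ≤ V)
    (s : Sec I U) : res I h' (res I h s) = res I (h'.trans h) s := rfl

variable (A) in
/-- The sections of the structure sheaf of `Spf A` over `U`: the limit over the open ideals `I` of the
sections of `O_{Spec (A / I)}`. -/
def spfSections (U : Opens (OpenPrime A)) : Subring (∀ I : OpenIdeal A, Sec I U) where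
  carrier := { s | ∀ (I J : OpenIdeal A) (h : I.1 ≤ J.1), trans h U (s I) = s J }
  mul_mem' hs ht I J h := by
    simp only [Pi.mul_apply, map_mul]
    rw [hs I J h, ht I J h]
  one_mem' I J h := by simp only [Pi.one_apply, map_one]
  add_mem' hs ht I J h := by
    simp only [Pi.add_apply, map_add]
    rw [hs I J h, ht I J h]
  zero_mem' I J h := by simp only [Pi.zero_apply, map_zero]
  neg_mem' hs I J h := by
    simp only [Pi.neg_apply, map_neg]
    rw [hs I J h]

variable (A) in
/-- The restriction maps of the structure sheaf of `Spf A`. -/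
def spfRes {U V : Opens (OpenPrime A)} (h : V ≤ U) : spfSections A U →+* spfSections A V where
  toFun s := ⟨fun I => res I h (s.1 I), fun I J hIJ => by
    rw [← res_trans, s.2 I J hIJ]⟩
  map_one' := Subtype.ext <| funext fun _ => map_one _
  map_mul' _ _ := Subtype.ext <| funext fun _ => map_mul _ _ _
  map_zero' := Subtype.ext <| funext fun _ => map_zero _
  map_add' _ _ := Subtype.ext <| funext fun _ => map_add _ _ _

variable (A) in
/-- The structure sheaf of `Spf A`, as a presheaf of rings. -/
def spfPresheaf : TopCat.Presheaf CommRingCat.{u} (TopCat.of (OpenPrime A)) where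
  obj U := CommRingCat.of (spfSections A U.unop)
  map i := CommRingCat.ofHom (spfRes A i.unop.le)

variable (A) in
theorem spfPresheaf_isSheaf : (spfPresheaf A).IsSheaf := by
  rw [TopCat.Presheaf.isSheaf_iff_isSheafUniqueGluing]
  intro ι U sf hsf
  let W (I : OpenIdeal A) (i : ι) : Opens (PrimeSpectrum.Top (A ⧸ I.1)) := preim I (U i)
  have key (I : OpenIdeal A) := (Spec.structureSheaf (A ⧸ I.1)).existsUnique_gluing'
    (W I) (preim I (iSup U)) (fun i => homOfLE fun _ hp => (le_iSup U i) hp)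
    (by
      intro p hp
      obtain ⟨i, hi⟩ := Opens.mem_iSup.mp (show specToOpenPrime I p ∈ iSup U from hp)
      exact Opens.mem_iSup.mpr ⟨i, hi⟩)
    (fun i => (show spfSections A (U i) from sf i).1 I)
    (fun i j => congrArg (fun s : spfSections A (U i ⊓ U j) => s.1 I) (hsf i j))
  choose g hg hg' using key
  have hsep (J : OpenIdeal A) (a b : Sec J (iSup U))
      (hab : ∀ i, res J (le_iSup U i) a = res J (le_iSup U i) b) : a = b := by
    refine (Spec.structureSheaf (A ⧸ J.1)).eq_of_locally_eq' (W J) (preim J (iSup U))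
      (fun i => homOfLE fun _ hp => (le_iSup U i) hp) ?_ a b hab
    intro p hp
    obtain ⟨i, hi⟩ := Opens.mem_iSup.mp (show specToOpenPrime J p ∈ iSup U from hp)
    exact Opens.mem_iSup.mpr ⟨i, hi⟩
  refine ⟨(⟨g, fun I J h => ?_⟩ : spfSections A (iSup U)), fun i => ?_, fun t ht => ?_⟩
  · refine hsep J _ _ fun i => ?_
    rw [res_trans]
    refine (congrArg _ (hg I i)).trans (Eq.trans ?_ (hg J i).symm)
    exact (show spfSections A (U i) from sf i).2 I J h
  · exact Subtype.ext (funext fun I => hg I i)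
  · refine Subtype.ext (funext fun I => hg' I _ fun i => ?_)
    exact congrArg (fun s : spfSections A (U i) => s.1 I) (ht i)

variable (A) in
/-- The ringed space underlying `Spf A`. -/
def spfSheafedSpace : SheafedSpace CommRingCat.{u} where
  carrier := TopCat.of (OpenPrime A)
  presheaf := spfPresheaf A
  IsSheaf := spfPresheaf_isSheaf A


lemma isUnit_germ_trans {I K : OpenIdeal A} (h : I.1 ≤ K.1) (U : Opens (OpenPrime A))
    (s : Sec I U) (q : PrimeSpectrum (A ⧸ K.1)) (hq : q ∈ preim K U) :
    IsUnit ((Spec.structureSheaf (A ⧸ K.1)).presheaf.germ (preim K U) q hq (trans h U s)) ↔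
      IsUnit ((Spec.structureSheaf (A ⧸ I.1)).presheaf.germ (preim I U)
        (PrimeSpectrum.comap (Ideal.Quotient.factor h) q) hq s) := by
  let f := Spec.locallyRingedSpaceMap (CommRingCat.ofHom (Ideal.Quotient.factor h))
  have e := LocallyRingedSpace.stalkMap_germ_apply f (preim I U) q hq s
  have hloc : IsLocalHom (f.stalkMap q).hom := LocallyRingedSpace.isLocalHomStalkMap f q
  constructor
  · intro hu
    exact hloc.map_nonunit _ (e ▸ hu)
  · intro hu
    exact e ▸ (f.stalkMap q).hom.isUnit_map hu

lemma specToOpenPrime_injective (I : OpenIdeal A) : Function.Injective (specToOpenPrime I) :=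
  fun _ _ h => PrimeSpectrum.comap_injective_of_surjective _ Ideal.Quotient.mk_surjective
    (congrArg Subtype.val h)

lemma exists_specToOpenPrime_eq (I : OpenIdeal A) (x : OpenPrime A) (h : I.1 ≤ x.1.asIdeal) :
    ∃ q, specToOpenPrime I q = x := by
  have : x.1 ∈ Set.range (PrimeSpectrum.comap (Ideal.Quotient.mk I.1)) := by
    rw [range_comap_of_surjective _ _ Ideal.Quotient.mk_surjective]
    simpa [PrimeSpectrum.mem_zeroLocus] using h
  obtain ⟨q, hq⟩ := this
  exact ⟨q, Subtype.ext hq⟩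

lemma le_asIdeal (I : OpenIdeal A) (q : PrimeSpectrum (A ⧸ I.1)) :
    I.1 ≤ (specToOpenPrime I q).1.asIdeal := by
  intro a ha
  change Ideal.Quotient.mk I.1 a ∈ q.asIdeal
  rw [Ideal.Quotient.eq_zero_iff_mem.mpr ha]
  exact q.asIdeal.zero_mem

lemma isOpen_sup (I J : OpenIdeal A) : IsOpen ((I.1 ⊔ J.1 : Ideal A) : Set A) :=
  AddSubgroup.isOpen_mono (H₁ := I.1.toAddSubgroup) (H₂ := (I.1 ⊔ J.1 : Ideal A).toAddSubgroup)
    (fun _ ha => (le_sup_left : I.1 ≤ I.1 ⊔ J.1) ha) I.2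

lemma isUnit_germ_congr (U : Opens (OpenPrime A)) (s : spfSections A U) (I J : OpenIdeal A)
    (q : PrimeSpectrum (A ⧸ I.1)) (r : PrimeSpectrum (A ⧸ J.1))
    (h : specToOpenPrime I q = specToOpenPrime J r) (hq : q ∈ preim I U) (hr : r ∈ preim J U)
    (hu : IsUnit ((Spec.structureSheaf (A ⧸ J.1)).presheaf.germ (preim J U) r hr (s.1 J))) :
    IsUnit ((Spec.structureSheaf (A ⧸ I.1)).presheaf.germ (preim I U) q hq (s.1 I)) := by
  let K : OpenIdeal A := ⟨I.1 ⊔ J.1, isOpen_sup I J⟩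
  have hI : I.1 ≤ K.1 := le_sup_left
  have hJ : J.1 ≤ K.1 := le_sup_right
  obtain ⟨t, ht⟩ := exists_specToOpenPrime_eq K (specToOpenPrime I q)
    (sup_le (le_asIdeal I q) (h ▸ le_asIdeal J r))
  obtain rfl : PrimeSpectrum.comap (Ideal.Quotient.factor hI) t = q :=
    specToOpenPrime_injective I ht
  obtain rfl : PrimeSpectrum.comap (Ideal.Quotient.factor hJ) t = r :=
    specToOpenPrime_injective J (ht.trans h)
  rw [← isUnit_germ_trans hI U (s.1 I) t hq, s.2 I K hI, ← s.2 J K hJ,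
    isUnit_germ_trans hJ U (s.1 J) t hr]
  exact hu

lemma isUnit_of_forall (U : Opens (OpenPrime A)) (s : spfSections A U)
    (h : ∀ I, IsUnit (s.1 I)) : IsUnit s := by
  choose t ht using fun I => (h I).exists_right_inv
  refine IsUnit.of_mul_eq_one ⟨t, fun I J hIJ => ?_⟩ (Subtype.ext (funext ht))
  have h1 : s.1 J * trans hIJ U (t I) = 1 := by
    rw [← s.2 I J hIJ, ← map_mul, ht I, map_one]
  calc trans hIJ U (t I) = (s.1 J * t J) * trans hIJ U (t I) := by rw [ht J, one_mul]
    _ = (s.1 J * trans hIJ U (t I)) * t J := by ring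
    _ = t J := by rw [h1, one_mul]

variable (A) in
/-- The basic open sets of `Spf A`. -/
def spfBasicOpen (a : A) : Opens (OpenPrime A) :=
  Opens.comap ⟨Subtype.val, continuous_subtype_val⟩ (PrimeSpectrum.basicOpen a)

lemma isUnit_germ_spf (U : Opens (OpenPrime A)) (s : spfSections A U) (J : OpenIdeal A)
    (hJ : ∀ x : OpenPrime A, J.1 ≤ x.1.asIdeal)
    (r : PrimeSpectrum (A ⧸ J.1)) (hr : r ∈ preim J U)
    (hu : IsUnit ((Spec.structureSheaf (A ⧸ J.1)).presheaf.germ (preim J U) r hr (s.1 J))) :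
    IsUnit ((spfPresheaf A).germ U (specToOpenPrime J r) hr s) := by
  obtain ⟨W, i, hrW, hW⟩ := RingedSpace.isUnit_res_of_isUnit_germ
    (X := Spec.sheafedSpaceObj (.of (A ⧸ J.1))) (preim J U) (s.1 J) r hr hu
  obtain ⟨_, ⟨_, ⟨f, rfl⟩, rfl⟩, hrf, hf⟩ :=
    PrimeSpectrum.isBasis_basic_opens.exists_subset_of_mem_open hrW W.2
  obtain ⟨a, rfl⟩ := Ideal.Quotient.mk_surjective f
  let V : Opens (OpenPrime A) := U ⊓ spfBasicOpen A a
  have hVU : V ≤ U := inf_le_left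
  have hrV : specToOpenPrime J r ∈ V := ⟨hr, hrf⟩
  suffices IsUnit (spfRes A hVU s) by
    have h2 := this.map ((spfPresheaf A).germ V (specToOpenPrime J r) hrV).hom
    have h3 := (spfPresheaf A).germ_res_apply (homOfLE hVU) (specToOpenPrime J r) hrV s
    exact h3 ▸ h2
  refine isUnit_of_forall _ _ fun I => ?_
  refine RingedSpace.isUnit_of_isUnit_germ (X := Spec.sheafedSpaceObj (.of (A ⧸ I.1)))
    (preim I V) _ fun q hq => ?_
  obtain ⟨q', hq'⟩ := exists_specToOpenPrime_eq J (specToOpenPrime I q) (hJ _)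
  have hq'V : q' ∈ preim J V := by
    change specToOpenPrime J q' ∈ V
    rw [hq']; exact hq
  refine isUnit_germ_congr V (spfRes A hVU s) I J q q' hq'.symm hq hq'V ?_
  have hVW : preim J V ≤ W := fun p hp => hf hp.2
  exact (hW.map ((Spec.structureSheaf (A ⧸ J.1)).1.map (homOfLE hVW).op).hom).map
    ((Spec.structureSheaf (A ⧸ J.1)).presheaf.germ (preim J V) q' hq'V).hom

variable (A) in
/-- The canonical morphism of ringed spaces from `Spec (A / J)` to `Spf A`, for an open ideal `J`. -/
def specToSpfHom (J : OpenIdeal A) :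
    (Spec.locallyRingedSpaceObj (.of (A ⧸ J.1))).toPresheafedSpace ⟶
      (spfSheafedSpace A).toPresheafedSpace where
  base := TopCat.ofHom (specToOpenPrime J)
  c :=
    { app := fun U => (CommRingCat.ofHom
        ((Pi.evalRingHom (fun I : OpenIdeal A => Sec I U.unop) J).comp
          (spfSections A U.unop).subtype) : CommRingCat.of (spfSections A U.unop) ⟶ Sec J U.unop)
      naturality := fun _ _ _ => rfl }

lemma isLocalHom_stalkMap (J : OpenIdeal A) (hJ : ∀ x : OpenPrime A, J.1 ≤ x.1.asIdeal)
    (r : PrimeSpectrum (A ⧸ J.1)) : IsLocalHom ((specToSpfHom A J).stalkMap r).hom := by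
  constructor
  intro z hz
  obtain ⟨U, hr, s, rfl⟩ := (spfPresheaf A).exists_germ_eq z
  refine isUnit_germ_spf U s J hJ r hr ?_
  have e := PresheafedSpace.stalkMap_germ_apply (specToSpfHom A J) U r hr s
  exact e ▸ hz

lemma IsIdealOfDefinition.le_asIdeal {J : Ideal A} (hJ : IsIdealOfDefinition J)
    (x : OpenPrime A) : J ≤ x.1.asIdeal := by
  obtain ⟨n, hn⟩ := hJ.exists_pow_subset _ (x.2.mem_nhds x.1.asIdeal.zero_mem)
  exact x.1.2.le_of_pow_le hn

variable (A) in
lemma isLocalRing_stalk (x : OpenPrime A) :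
    IsLocalRing ((spfSheafedSpace A).presheaf.stalk x) := by
  obtain ⟨J, hJ⟩ := AdmissibleRing.exists_isIdealOfDefinition (A := A)
  obtain ⟨r, rfl⟩ := exists_specToOpenPrime_eq ⟨J, hJ.isOpen⟩ x (hJ.le_asIdeal x)
  have h1 := isLocalHom_stalkMap ⟨J, hJ.isOpen⟩ hJ.le_asIdeal r
  have h2 := (Spec.locallyRingedSpaceObj (.of (A ⧸ J))).isLocalRing r
  exact @RingHom.domain_isLocalRing _ _ _ _ h2 _ h1


variable (A) in
/-- The topology on the sections of the structure sheaf of `Spf A` over `U`: the coarsest one for which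
all the maps to the discrete rings of sections of `O_{Spec (A / I)}` over `V` are continuous, where `I`
is an open ideal and `V` is a quasi-compact open subset of `U`. -/
@[reducible]
def spfTopology (U : Opens (OpenPrime A)) : TopologicalSpace (spfSections A U) :=
  ⨅ (I : OpenIdeal A) (V : Opens (OpenPrime A)) (h : V ≤ U) (_ : IsCompact (V : Set (OpenPrime A))),
    TopologicalSpace.induced (fun s => res I h (s.1 I)) ⊥

lemma isTopologicalRing_induced {R S : Type*} [CommRing R] [CommRing S] (τ : TopologicalSpace S)
    (h : @IsTopologicalRing S τ _) (f : R →+* S) : @IsTopologicalRing R (τ.induced f) _ :=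
  let _ := τ.induced f
  have : ContinuousMul R := continuousMul_induced f
  have : ContinuousAdd R := continuousAdd_induced f
  have : ContinuousNeg R := Topology.IsInducing.continuousNeg (f := f) ⟨rfl⟩ (map_neg f)
  { }

lemma isTopologicalRing_iInf {R : Type*} {ι : Sort*} [CommRing R] (τ : ι → TopologicalSpace R)
    (h : ∀ i, @IsTopologicalRing R (τ i) _) : @IsTopologicalRing R (⨅ i, τ i) _ :=
  let _ := ⨅ i, τ i
  have : ContinuousMul R := continuousMul_iInf fun i => (h i).toContinuousMul
  have : ContinuousAdd R := continuousAdd_iInf fun i => (h i).toContinuousAdd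
  have : ContinuousNeg R := continuousNeg_iInf fun i => (h i).toContinuousNeg
  { }

variable (A) in
lemma spfTopology_isTopologicalRing (U : Opens (OpenPrime A)) :
    @IsTopologicalRing (spfSections A U) (spfTopology A U) _ := by
  refine isTopologicalRing_iInf _ fun I => isTopologicalRing_iInf _ fun V =>
    isTopologicalRing_iInf _ fun h => isTopologicalRing_iInf _ fun _ => ?_
  let f : spfSections A U →+* Sec I V := ((res I h).comp
    (Pi.evalRingHom (fun I : OpenIdeal A => Sec I U) I)).comp (spfSections A U).subtype
  let _ : TopologicalSpace (Sec I V) := ⊥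
  have : DiscreteTopology (Sec I V) := ⟨rfl⟩
  exact isTopologicalRing_induced ⊥ inferInstance f

lemma sec_ext (I : OpenIdeal A) {ι : Type*} (V : Opens (OpenPrime A)) (W : ι → Opens (OpenPrime A))
    (h : ∀ i, W i ≤ V) (hV : V ≤ iSup W) (a b : Sec I V)
    (hab : ∀ i, res I (h i) a = res I (h i) b) : a = b := by
  refine (Spec.structureSheaf (A ⧸ I.1)).eq_of_locally_eq' (fun i => preim I (W i)) (preim I V)
    (fun i => homOfLE fun _ hp => h i hp) ?_ a b hab
  intro p hp
  obtain ⟨i, hi⟩ := Opens.mem_iSup.mp (hV hp)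
  exact Opens.mem_iSup.mpr ⟨i, hi⟩

lemma isCompact_spfBasicOpen (J : OpenIdeal A) (hJ : ∀ x : OpenPrime A, J.1 ≤ x.1.asIdeal)
    (a : A) : IsCompact (spfBasicOpen A a : Set (OpenPrime A)) := by
  have : (spfBasicOpen A a : Set (OpenPrime A)) = specToOpenPrime J ''
      (PrimeSpectrum.basicOpen (Ideal.Quotient.mk J.1 a) : Set _) := by
    ext x
    constructor
    · intro hx
      obtain ⟨q, rfl⟩ := exists_specToOpenPrime_eq J x (hJ x)
      exact ⟨q, hx, rfl⟩
    · rintro ⟨q, hq, rfl⟩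
      exact hq
  rw [this]
  exact (PrimeSpectrum.isCompact_basicOpen _).image (specToOpenPrime J).continuous

lemma exists_spfBasicOpen (U : Opens (OpenPrime A)) (x : OpenPrime A) (hx : x ∈ U) :
    ∃ a, x ∈ spfBasicOpen A a ∧ spfBasicOpen A a ≤ U := by
  obtain ⟨W, hW, hWU⟩ := isOpen_induced_iff.mp U.2
  have hxW : x.1 ∈ W := by
    have : x ∈ Subtype.val ⁻¹' W := hWU ▸ hx
    exact this
  obtain ⟨_, ⟨_, ⟨a, rfl⟩, rfl⟩, ha, haW⟩ :=
    PrimeSpectrum.isBasis_basic_opens.exists_subset_of_mem_open hxW hW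
  refine ⟨a, ha, fun y hy => ?_⟩
  have : y ∈ Subtype.val ⁻¹' W := haW hy
  rw [hWU] at this
  exact this

variable (A) in
lemma spfTopology_eq {ι : Type*} (U : Opens (OpenPrime A))
    (V : ι → Opens (OpenPrime A)) (h : ∀ i, V i ≤ U) (hU : U ≤ iSup V) :
    spfTopology A U = ⨅ i, (spfTopology A (V i)).induced (spfRes A (h i)) := by
  obtain ⟨J, hJ⟩ := AdmissibleRing.exists_isIdealOfDefinition (A := A)
  apply le_antisymm
  · refine le_iInf fun i => ?_
    simp only [spfTopology, induced_iInf, induced_compose]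
    refine le_iInf fun I => le_iInf fun W => le_iInf fun hW => le_iInf fun hc => ?_
    exact iInf_le_of_le I (iInf_le_of_le W (iInf_le_of_le (hW.trans (h i)) (iInf_le_of_le hc le_rfl)))
  · refine le_iInf fun I => le_iInf fun W => le_iInf fun hW => le_iInf fun hc => ?_
    let τ : TopologicalSpace (spfSections A U) :=
      ⨅ i, (spfTopology A (V i)).induced (spfRes A (h i))
    let _ : TopologicalSpace (Sec I W) := ⊥
    have : DiscreteTopology (Sec I W) := ⟨rfl⟩
    change τ ≤ _
    rw [← continuous_iff_le_induced, continuous_discrete_rng]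
    intro b
    have key : ∀ x ∈ (W : Set (OpenPrime A)), ∃ a : A, ∃ i, x ∈ spfBasicOpen A a ∧
        spfBasicOpen A a ≤ V i ⊓ W := by
      intro x hx
      obtain ⟨i, hi⟩ := Opens.mem_iSup.mp (hU (hW hx))
      obtain ⟨a, ha, ha'⟩ := exists_spfBasicOpen (V i ⊓ W) x ⟨hi, hx⟩
      exact ⟨a, i, ha, ha'⟩
    choose a i ha ha' using key
    obtain ⟨t, ht⟩ := hc.elim_nhds_subcover' (fun x hx => spfBasicOpen A (a x hx))
      (fun x hx => (spfBasicOpen A (a x hx)).2.mem_nhds (ha x hx))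
    have hle (x : (W : Set (OpenPrime A))) : spfBasicOpen A (a x.1 x.2) ≤ W :=
      (ha' x.1 x.2).trans inf_le_right
    have hleV (x : (W : Set (OpenPrime A))) : spfBasicOpen A (a x.1 x.2) ≤ V (i x.1 x.2) :=
      (ha' x.1 x.2).trans inf_le_left
    have e : (fun s : spfSections A U => res I hW (s.1 I)) ⁻¹' {b} =
        ⋂ x ∈ t, { s : spfSections A U | res I ((hle x).trans hW) (s.1 I) = res I (hle x) b } := by
      ext s
      simp only [Set.mem_preimage, Set.mem_singleton_iff, Set.mem_iInter, Set.mem_ofPred_eq]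
      constructor
      · rintro rfl x _
        rfl
      · intro hs
        refine sec_ext I W (fun x : t => spfBasicOpen A (a x.1.1 x.1.2)) (fun x => hle x.1) ?_ _ _
          fun x => hs x.1 x.2
        intro y hy
        obtain ⟨x, hx, hxy⟩ := Set.mem_iUnion₂.mp (ht hy)
        exact Opens.mem_iSup.mpr ⟨⟨x, hx⟩, hxy⟩
    rw [e]
    refine isOpen_biInter_finset fun x _ => ?_
    let _ : TopologicalSpace (Sec I (spfBasicOpen A (a x.1 x.2))) := ⊥
    have : DiscreteTopology (Sec I (spfBasicOpen A (a x.1 x.2))) := ⟨rfl⟩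
    have hcont : Continuous fun s : spfSections A U => res I ((hle x).trans hW) (s.1 I) := by
      rw [continuous_iff_le_induced]
      refine (iInf_le _ (i x.1 x.2)).trans ?_
      simp only [spfTopology, induced_iInf, induced_compose]
      exact iInf_le_of_le I (iInf_le_of_le (spfBasicOpen A (a x.1 x.2))
        (iInf_le_of_le (hleV x)
          (iInf_le_of_le (isCompact_spfBasicOpen ⟨J, hJ.isOpen⟩ hJ.le_asIdeal _) le_rfl)))
    exact (isOpen_discrete {res I (hle x) b}).preimage hcont


end Spf

/-- A topologically ringed space whose stalks are local rings, that is, a locally ringed space whose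
structure sheaf is a sheaf of topological rings. The last field says that the ring of sections over `U`
has the topology induced by the product of the rings of sections over the members of a covering of `U`;
the case of a covering of `U` by `U` and `V` gives the continuity of restriction maps. -/
structure TopLocallyRingedSpace extends LocallyRingedSpace.{u} where
  topology (U : Opens carrier) : TopologicalSpace (presheaf.obj (op U))
  isTopologicalRing (U : Opens carrier) : @IsTopologicalRing (presheaf.obj (op U)) (topology U) _
  topology_eq {ι : Type u} (U : Opens carrier) (V : ι → Opens carrier) (h : ∀ i, V i ≤ U)
    (hU : U ≤ iSup V) :
    topology U = ⨅ i, (topology (V i)).induced (presheaf.map (homOfLE (h i)).op)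

namespace TopLocallyRingedSpace

/-- A morphism of topologically ringed spaces, with local homomorphisms on the stalks. -/
@[ext]
structure Hom (X Y : TopLocallyRingedSpace.{u}) where
  toLRS : X.toLocallyRingedSpace ⟶ Y.toLocallyRingedSpace
  continuous (U : Opens Y.toTopCat) :
    @Continuous _ _ (Y.topology U) (X.topology ((Opens.map toLRS.base).obj U))
      (toLRS.c.app (op U))

instance : Category TopLocallyRingedSpace.{u} where
  Hom := Hom
  id X := ⟨𝟙 X.toLocallyRingedSpace, fun U => @continuous_id _ (X.topology U)⟩
  comp {X Y Z} f g := ⟨f.toLRS ≫ g.toLRS, fun U =>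
    @Continuous.comp _ _ _ (Z.topology U) (Y.topology _) (X.topology _) _ _
      (f.continuous _) (g.continuous U)⟩

/-- The restriction of a topologically locally ringed space to an open subset. -/
def restrict (X : TopLocallyRingedSpace.{u}) (U : Opens X.toTopCat) : TopLocallyRingedSpace.{u} where
  toLocallyRingedSpace := X.toLocallyRingedSpace.restrict U.isOpenEmbedding
  topology V := X.topology (U.isOpenEmbedding.functor.obj V)
  isTopologicalRing V := X.isTopologicalRing _
  topology_eq {ι} V W h hV := by
    refine X.topology_eq (U.isOpenEmbedding.functor.obj V)
      (fun i => U.isOpenEmbedding.functor.obj (W i))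
      (fun i => (U.isOpenEmbedding.functor.map (homOfLE (h i))).le) ?_
    rintro _ ⟨y, hy, rfl⟩
    obtain ⟨i, hi⟩ := Opens.mem_iSup.mp (hV hy)
    exact Opens.mem_iSup.mpr ⟨i, y, hi, rfl⟩

end TopLocallyRingedSpace

/-- The formal spectrum of an admissible ring. -/
def Spf (A : Type u) [CommRing A] [TopologicalSpace A] [AdmissibleRing A] :
    TopLocallyRingedSpace.{u} where
  toSheafedSpace := spfSheafedSpace A
  isLocalRing := isLocalRing_stalk A
  topology := spfTopology A
  isTopologicalRing := spfTopology_isTopologicalRing A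
  topology_eq := spfTopology_eq A

/-- A formal scheme is a topologically ringed space which is locally isomorphic to formal spectra of
admissible rings. -/
def IsFormalScheme : ObjectProperty TopLocallyRingedSpace.{u} := fun X =>
  ∀ x : X.toTopCat, ∃ (U : Opens X.toTopCat) (A : Type u) (_ : CommRing A) (_ : TopologicalSpace A)
    (_ : AdmissibleRing A), x ∈ U ∧ Nonempty (X.restrict U ≅ Spf A)

/-- The category of formal schemes. -/
abbrev FormalScheme : Type (u + 1) := IsFormalScheme.{u}.FullSubcategory

namespace FormalScheme

/-- The open subsets of a formal scheme. -/
abbrev Opens (X : FormalScheme.{u}) : Type u := TopologicalSpace.Opens X.obj.toTopCat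

/-- The sections of the structure sheaf of a formal scheme. -/
abbrev sections (X : FormalScheme.{u}) (U : X.Opens) : CommRingCat.{u} := X.obj.presheaf.obj (op U)

/-- The restriction maps of the structure sheaf of a formal scheme. -/
abbrev res (X : FormalScheme.{u}) {U V : X.Opens} (h : V ≤ U) : X.sections U →+* X.sections V :=
  (X.obj.presheaf.map (homOfLE h).op).hom

variable {X Y : FormalScheme.{u}}

/-- The preimage of an open subset under a morphism of formal schemes. -/
abbrev preimage (f : X ⟶ Y) (U : Y.Opens) : X.Opens :=
  (TopologicalSpace.Opens.map f.hom.toLRS.base).obj U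

/-- The map on sections given by a morphism of formal schemes. -/
abbrev app (f : X ⟶ Y) (U : Y.Opens) : Y.sections U →+* X.sections (preimage f U) :=
  (f.hom.toLRS.c.app (op U)).hom

/-- A formal scheme is noetherian if it is locally isomorphic to formal spectra of noetherian adic
rings, and its underlying space is quasi-compact. -/
structure IsNoetherian (X : FormalScheme.{u}) : Prop where
  exists_isNoetherianAdicRing (x : X.obj.toTopCat) : ∃ (U : X.Opens) (A : Type u) (_ : CommRing A)
    (_ : TopologicalSpace A) (_ : AdmissibleRing A), x ∈ U ∧ IsNoetherianAdicRing A ∧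
      Nonempty (X.obj.restrict U ≅ Spf A)
  compactSpace : CompactSpace X.obj.toTopCat

/-- An ideal of definition (defining ideal) of a formal scheme `X`: a sheaf of ideals of the structure
sheaf which is locally, on open subsets isomorphic to formal spectra `Spf A`, the kernel of the map
from the structure sheaf of `Spf A` to `O_{Spec (A / J)}`, for an ideal of definition `J` of `A`. -/
structure IdealOfDefinition (X : FormalScheme.{u}) where
  ideal (U : X.Opens) : Ideal (X.sections U)
  res_mem {U V : X.Opens} (h : V ≤ U) (s : X.sections U) : s ∈ ideal U → X.res h s ∈ ideal V
  mem_of_locally {U : X.Opens} (s : X.sections U) :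
    (∀ x ∈ U, ∃ (V : X.Opens) (h : V ≤ U), x ∈ V ∧ X.res h s ∈ ideal V) → s ∈ ideal U
  exists_eq (x : X.obj.toTopCat) : ∃ (U : X.Opens) (A : Type u) (_ : CommRing A)
    (_ : TopologicalSpace A) (_ : AdmissibleRing A) (J : Ideal A) (hJ : IsIdealOfDefinition J)
    (e : X.obj.restrict U ≅ Spf A), x ∈ U ∧ ∀ (V : TopologicalSpace.Opens (Spf A).toTopCat)
      (s : (Spf A).presheaf.obj (op V)), (e.hom.toLRS.c.app (op V)).hom s ∈
        ideal (U.isOpenEmbedding.functor.obj ((TopologicalSpace.Opens.map e.hom.toLRS.base).obj V)) ↔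
        ((specToSpfHom A ⟨J, hJ.isOpen⟩).c.app (op V)).hom s = 0

/-- The scheme `X₀`, together with the morphism `i` of locally ringed spaces from `X₀` to `X`, is the
ringed space whose underlying space is that of `X`, and whose structure sheaf is the quotient of that
of `X` by the ideal of definition `I`. -/
structure IsQuotientScheme (I : IdealOfDefinition X) (X₀ : Scheme.{u})
    (i : X₀.toLocallyRingedSpace ⟶ X.obj.toLocallyRingedSpace) : Prop where
  isHomeomorph : IsHomeomorph i.base
  stalkMap_surjective (x : X₀) : Function.Surjective (i.stalkMap x)
  app_eq_zero_iff (U : X.Opens) (s : X.sections U) :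
    (i.c.app (op U)).hom s = 0 ↔ s ∈ I.ideal U

/-- A morphism `f` from `X` to `Y` is formally finite type if for some ideals of definition `I` of `X`
and `J` of `Y`, such that `f` takes `J` into `I`, the induced morphism `f₀` between the schemes defined
by `I` and `J` is of finite type. -/
def IsFormallyFiniteType (f : X ⟶ Y) : Prop :=
  ∃ (I : IdealOfDefinition X) (J : IdealOfDefinition Y) (X₀ Y₀ : Scheme.{u})
    (i : X₀.toLocallyRingedSpace ⟶ X.obj.toLocallyRingedSpace)
    (j : Y₀.toLocallyRingedSpace ⟶ Y.obj.toLocallyRingedSpace) (f₀ : X₀ ⟶ Y₀),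
    (∀ U : Y.Opens, (J.ideal U).map (app f U) ≤ I.ideal (preimage f U)) ∧
    IsQuotientScheme I X₀ i ∧ IsQuotientScheme J Y₀ j ∧
    i ≫ f.hom.toLRS = f₀.toLRSHom ≫ j ∧ LocallyOfFiniteType f₀ ∧ QuasiCompact f₀

end FormalScheme
end

end FormalGeometry

/-!
# Fibre products of noetherian formal schemes

Locally, the fibre product is a completed tensor product. Let `B → A` and `B → B'` be continuous
homomorphisms, where `A` and `B'` are noetherian adic rings and `A` is of finite type over `B` modulo
its largest ideal of definition `openNilradical A`. Let `R = A ⊗ B'` (over `B`), let `𝔞` be the ideal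
of `R` generated by the largest ideals of definition of `A` and of `B'`, and let `C` be the `𝔞`-adic
completion of `R`. Then `R / 𝔞` is of finite type over `B'`, hence noetherian, and `𝔞` is finitely
generated, so that `C` is a noetherian adic ring (`isNoetherianRing_of_isAdicComplete`) with the
universal property of a pushout among admissible rings (`exists_completedPushout`). The ring `R`
need not be noetherian, and `B` need only be admissible.

The functor `Spf` from admissible rings to topologically ringed spaces is fully faithful
(`exists_spfMap_eq`, `spfMap_injective`): a morphism `Spf B ⟶ Spf A` is determined by the homomorphism
`A → B` of global sections, because continuous homomorphisms from the sections over a basic open set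
are determined on `A`. Therefore `Spf C` is the fibre product as far as maps from formal spectra are
concerned. Maps from an arbitrary formal scheme are glued from maps from formal spectra
(`isPullbackOver_of_spf`), so that charts of the given formal schemes have fibre products over open
subsets, in the sense of `IsPullbackOver` (`exists_isPullbackOver_chart`). Charts can be chosen
arbitrarily small by completed localization (`IsTopLocalization`, `LocRing`), which preserves noetherian
adic rings.

Since noetherian formal schemes are covered by finitely many charts, and so are their open subsets,
finitely many of these local fibre products suffice. They are glued along the open subsets over which
two of them have the same universal property (`exists_isPullbackOver_glued`,
`FormalScheme.exists_isPullbackOver`). The result is covered by finitely many noetherian charts, so it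
is noetherian.

Finiteness is transported through reductions. Every locally ringed space `X` has a reduction `redLRS X`,
whose sections are functions with values in the residue fields that are locally given by sections of `X`.
The reduction of `Spf A` is `Spec (A / openNilradical A)`, and the reduction of a formal scheme is a
closed subscheme of its quotient by any ideal of definition. Hence a morphism of formally finite type
induces on charts homomorphisms `B → A` which are of finite type modulo `openNilradical A`
(`FormalScheme.IsFormallyFiniteType.finiteType`); this is the hypothesis on `A` above, and the local
construction gives the same condition for `C` over `B'`. Conversely, the kernels of the reductions are
the largest ideals of definition (`FormalScheme.maxIdeal`), and with this choice the condition on charts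
says that the induced morphism of schemes is of finite type
(`FormalScheme.isFormallyFiniteType_of_chart`).
-/

namespace FormalGeometry

noncomputable section

/-! ### Complete rings -/

section Algebra

variable {R : Type u} [CommRing R]

/-- Successive approximation: in a ring which is complete and separated for a filtration `F`, a family
`g` spans `Y 0` as soon as elements of `Y m` can be written, modulo `Y (m + 1)`, as combinations
of `g` with coefficients in `F m`. -/
lemma mem_span_of_approx (F : ℕ → Ideal R) (hsep : ∀ x, (∀ m, x ∈ F m) → x = 0)
    (hcomp : ∀ f : ℕ → R, (∀ m, f (m + 1) - f m ∈ F m) → ∃ L, ∀ m, L - f m ∈ F m)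
    {κ : Type*} [Fintype κ] (g : κ → R) (Y : ℕ → Set R) (hY : ∀ m, ∀ y ∈ Y m, y ∈ F m)
    (h : ∀ m, ∀ y ∈ Y m, ∃ c : κ → R, (∀ j, c j ∈ F m) ∧ y - ∑ j, c j * g j ∈ Y (m + 1))
    (y : R) (hy : y ∈ Y 0) : y ∈ Ideal.span (Set.range g) := by
  choose c hc hc' using h
  let z : ∀ m, Y m := fun m => Nat.rec (⟨y, hy⟩ : Y 0) (fun m w => ⟨_, hc' m w.1 w.2⟩) m
  let d : ℕ → κ → R := fun m => c m (z m).1 (z m).2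
  have hz (m : ℕ) : (z (m + 1)).1 = (z m).1 - ∑ j, d m j * g j := rfl
  have hlim (j : κ) := hcomp (fun m => ∑ i ∈ Finset.range m, d i j) fun m => by
    simpa [Finset.sum_range_succ] using hc m (z m).1 (z m).2 j
  choose L hL using hlim
  have key (m : ℕ) : (z m).1 = y - ∑ j, (∑ i ∈ Finset.range m, d i j) * g j := by
    induction m with
    | zero => simp [z]
    | succ m ih =>
      rw [hz, ih]
      simp only [Finset.sum_range_succ, add_mul, Finset.sum_add_distrib]
      ring
  have : y - ∑ j, L j * g j = 0 := by
    refine hsep _ fun m => ?_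
    have e : y - ∑ j, L j * g j =
        (z m).1 - ∑ j, (L j - ∑ i ∈ Finset.range m, d i j) * g j := by
      rw [key]
      simp only [sub_mul, Finset.sum_sub_distrib]
      ring
    rw [e]
    exact (F m).sub_mem (hY m _ (z m).2)
      ((F m).sum_mem fun j _ => (F m).mul_mem_right _ (hL j m))
  rw [sub_eq_zero.mp this]
  exact Ideal.sum_mem _ fun j _ => Ideal.mul_mem_left _ _ (Ideal.subset_span ⟨j, rfl⟩)

lemma exists_limit_of_isAdicComplete (I : Ideal R) [IsAdicComplete I R] (f : ℕ → R)
    (hf : ∀ m, f (m + 1) - f m ∈ I ^ m) : ∃ L, ∀ m, L - f m ∈ I ^ m := by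
  obtain ⟨L, hL⟩ := (isPrecomplete_iff (I := I) (M := R)).mp inferInstance f (by
    intro m n hmn
    rw [SModEq.comm, SModEq.sub_mem, smul_eq_mul, Ideal.mul_top]
    induction n, hmn using Nat.le_induction with
    | base => simp
    | succ n hmn ih =>
      have := (I ^ m).add_mem (Ideal.pow_le_pow_right hmn (hf n)) ih
      rwa [sub_add_sub_cancel] at this)
  refine ⟨L, fun m => ?_⟩
  have := (hL m).symm
  rwa [SModEq.sub_mem, smul_eq_mul, Ideal.mul_top] at this

lemma eq_zero_of_forall_mem_pow (I : Ideal R) [IsHausdorff I R] (x : R) (hx : ∀ m, x ∈ I ^ m) :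
    x = 0 :=
  IsHausdorff.haus (I := I) inferInstance x fun m => by
    rw [SModEq.zero, smul_eq_mul, Ideal.mul_top]; exact hx m

/-- A ring which is complete with respect to a finitely generated ideal `I` is noetherian if its
quotient by `I` is. An ideal `P` maximal among those not finitely generated would be prime. It cannot
contain `I`; for `x ∈ I \ P`, it follows from `P ⊔ (x)` being finitely generated that
`P = P₀ + x P` for some finitely generated `P₀`, and then `P = P₀` by completeness. -/
theorem isNoetherianRing_of_isAdicComplete (I : Ideal R) [IsAdicComplete I R] (hI : I.FG)
    [IsNoetherianRing (R ⧸ I)] : IsNoetherianRing R := by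
  rw [isNoetherianRing_iff_ideal_fg]
  by_contra! ⟨N, hN⟩
  obtain ⟨P, _, hP⟩ : ∃ M, N ≤ M ∧ Maximal (fun J : Ideal R => ¬ J.FG) M := by
    refine zorn_le_nonempty₀ {J : Ideal R | ¬ J.FG}
      (fun C hC₁ hC₂ J hJ => ⟨sSup C, ?_, fun _ => le_sSup⟩) N hN
    rintro ⟨G, hG⟩
    obtain ⟨K, hKC, hGK⟩ : ∃ K ∈ C, (G : Set R) ⊆ K := by
      refine hC₂.directedOn.exists_mem_subset_of_finset_subset_biUnion ⟨J, hJ⟩ (fun _ hx => ?_)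
      simp only [Set.mem_iUnion, SetLike.mem_coe, exists_prop]
      exact (Submodule.mem_sSup_of_directed ⟨J, hJ⟩ hC₂.directedOn).1 <|
        hG ▸ Ideal.subset_span hx
    have : K = sSup C := le_antisymm (le_sSup hKC) (hG ▸ Ideal.span_le.2 hGK)
    exact hC₁ hKC ⟨G, hG.trans this.symm⟩
  have hprime := Ideal.isOka_fg.isPrime_of_maximal_not hP
  -- otherwise `P` would be finitely generated, as an extension of an ideal of `R / I` by `I`
  have hIP : ¬ I ≤ P := by
    intro h
    refine hP.prop (Submodule.fg_of_fg_map_of_fg_inf_ker ((Ideal.Quotient.mkₐ R I).toLinearMap) ?_ ?_)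
    · convert! (IsNoetherian.noetherian (P.map (Ideal.Quotient.mk I))).restrictScalars_of_surjective
        (R := R) Ideal.Quotient.mk_surjective
      ext y
      simp [Ideal.mem_map_iff_of_surjective _ Ideal.Quotient.mk_surjective]
    · have : P ⊓ LinearMap.ker (Ideal.Quotient.mkₐ R I).toLinearMap = I := by
        ext x
        simp only [Submodule.mem_inf, LinearMap.mem_ker, AlgHom.toLinearMap_apply,
          Ideal.Quotient.mkₐ_eq_mk, Ideal.Quotient.eq_zero_iff_mem]
        exact ⟨fun hx => hx.2, fun hx => ⟨h hx, hx⟩⟩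
      rw [this]
      exact hI
  obtain ⟨x, hxI, hxP⟩ := SetLike.not_le_iff_exists.mp hIP
  have hfg : (P ⊔ Ideal.span {x}).FG :=
    of_not_not <| hP.not_prop_of_gt (Submodule.lt_sup_iff_notMem.2 hxP)
  obtain ⟨P₀, hP₀, hP₀fg, hsup⟩ : ∃ P₀ ≤ P, P₀.FG ∧ P ≤ P₀ ⊔ Ideal.span {x} := by
    obtain ⟨n, s, hs⟩ := Submodule.fg_iff_exists_fin_generating_family.1 hfg
    have hs' (i : Fin n) : ∃ p ∈ P, ∃ r, s i = p + r * x := by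
      have : s i ∈ P ⊔ Ideal.span {x} := hs ▸ Submodule.subset_span ⟨i, rfl⟩
      obtain ⟨p, hp, q, hq, e⟩ := Submodule.mem_sup.mp this
      obtain ⟨r, rfl⟩ := Ideal.mem_span_singleton'.mp hq
      exact ⟨p, hp, r, e.symm⟩
    choose p hp r hr using hs'
    refine ⟨Ideal.span (Set.range p), Ideal.span_le.mpr (by rintro _ ⟨i, rfl⟩; exact hp i),
      ⟨(Set.finite_range p).toFinset, by simp⟩, le_sup_left.trans (hs.symm.le.trans ?_)⟩
    refine Submodule.span_le.mpr ?_
    rintro _ ⟨i, rfl⟩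
    rw [hr i]
    exact Ideal.add_mem _ (Ideal.mem_sup_left (Ideal.subset_span ⟨i, rfl⟩))
      (Ideal.mem_sup_right (Ideal.mul_mem_left _ _ (Ideal.mem_span_singleton_self x)))
  obtain ⟨n, g, hg⟩ := Submodule.fg_iff_exists_fin_generating_family.1 hP₀fg
  refine hP.prop ?_
  have : P = P₀ := by
    refine le_antisymm (fun y hy => ?_) hP₀
    rw [← hg]
    refine mem_span_of_approx (fun m => I ^ m) (eq_zero_of_forall_mem_pow I)
      (exists_limit_of_isAdicComplete I) g (fun m => {z | ∃ p ∈ P, z = x ^ m * p}) ?_ ?_ y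
      ⟨y, hy, by simp⟩
    · rintro m _ ⟨p, -, rfl⟩
      exact Ideal.mul_mem_right _ _ (Ideal.pow_mem_pow hxI m)
    · rintro m _ ⟨p, hp, rfl⟩
      obtain ⟨p₀, hp₀, q, hq, rfl⟩ := Submodule.mem_sup.mp (hsup hp)
      obtain ⟨r, rfl⟩ := Ideal.mem_span_singleton'.mp hq
      rw [← hg] at hp₀
      obtain ⟨c, hc⟩ := (Submodule.mem_span_range_iff_exists_fun R).mp hp₀
      refine ⟨fun j => x ^ m * c j, fun j => Ideal.mul_mem_right _ _ (Ideal.pow_mem_pow hxI m),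
        r, ?_, ?_⟩
      · have hrx : r * x ∈ P := (P.add_mem_iff_right (hP₀ (hg ▸ hp₀))).mp hp
        exact (hprime.mem_or_mem hrx).resolve_right hxP
      · simp only [smul_eq_mul] at hc
        rw [← hc]
        simp only [mul_assoc, ← Finset.mul_sum]
        ring
  rw [this]
  exact hP₀fg

end Algebra

/-! ### Admissible rings -/

section Admissible

variable {A : Type u} [CommRing A] [TopologicalSpace A]

lemma isOpen_of_le [IsTopologicalRing A] {I J : Ideal A} (hI : IsOpen (I : Set A)) (h : I ≤ J) :
    IsOpen (J : Set A) :=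
  AddSubgroup.isOpen_mono (H₁ := I.toAddSubgroup) (H₂ := J.toAddSubgroup) h hI

lemma exists_openIdeal_subset [AdmissibleRing A] {V : Set A} (hV : V ∈ 𝓝 0) :
    ∃ I : OpenIdeal A, (I.1 : Set A) ⊆ V := by
  obtain ⟨I, hI, hIV⟩ := (IsLinearTopology.hasBasis_open_ideal (R := A)).mem_iff.mp hV
  exact ⟨⟨I, hI⟩, hIV⟩

lemma eq_zero_of_forall_mem_openIdeal [AdmissibleRing A] (x : A) (hx : ∀ I : OpenIdeal A, x ∈ I.1) :
    x = 0 := by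
  have := AdmissibleRing.t2Space (A := A)
  by_contra hne
  obtain ⟨I, hI⟩ := exists_openIdeal_subset (isOpen_ne.mem_nhds (Ne.symm hne) : {y | y ≠ x} ∈ 𝓝 0)
  exact hI (hx I) rfl

/-- An admissible ring is the limit of its quotients by the open ideals. -/
lemma exists_of_compatible [AdmissibleRing A] (a : OpenIdeal A → A)
    (ha : ∀ I J : OpenIdeal A, I.1 ≤ J.1 → a I - a J ∈ J.1) :
    ∃ x, ∀ I : OpenIdeal A, x - a I ∈ I.1 := by
  let _ := IsTopologicalAddGroup.rightUniformSpace A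
  have := AdmissibleRing.completeSpace (A := A)
  let S (I : OpenIdeal A) : Set A := {x | x - a I ∈ I.1}
  have hS : ∀ I J : OpenIdeal A, I.1 ≤ J.1 → S I ⊆ S J := fun I J h x hx => by
    have := J.1.add_mem (h hx) (ha I J h)
    rwa [sub_add_sub_cancel] at this
  let F : Filter A := ⨅ I, Filter.principal (S I)
  have hne : Nonempty (OpenIdeal A) := ⟨⟨⊤, by simp⟩⟩
  have hdir : Directed (· ≥ ·) S := fun I J =>
    ⟨⟨I.1 ⊓ J.1, I.2.inter J.2⟩, hS _ _ inf_le_left, hS _ _ inf_le_right⟩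
  have hd : Directed (· ≥ ·) fun I => Filter.principal (S I) :=
    hdir.mono_comp _ Filter.monotone_principal.dual
  have hF (V : Set A) : V ∈ F ↔ ∃ I, S I ⊆ V := by
    simp only [F, Filter.mem_iInf_of_directed hd, Filter.mem_principal]
  have hneBot : F.NeBot := (Filter.iInf_neBot_iff_of_directed' hd).mpr fun I =>
    Filter.principal_neBot_iff.mpr ⟨a I, by simp [S]⟩
  have hcauchy : Cauchy F := by
    refine ⟨hneBot, ?_⟩
    rw [uniformity_eq_comap_nhds_zero' A]
    rintro V ⟨W, hW, hWV⟩
    obtain ⟨I, hI⟩ := exists_openIdeal_subset hW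
    refine Filter.mem_of_superset (Filter.prod_mem_prod ((hF (S I)).mpr ⟨I, subset_rfl⟩)
      ((hF (S I)).mpr ⟨I, subset_rfl⟩)) ?_
    rintro ⟨x, y⟩ ⟨hx, hy⟩
    refine hWV (hI ?_)
    have := I.1.sub_mem hy hx
    rwa [sub_sub_sub_cancel_right, sub_eq_add_neg] at this
  obtain ⟨x, hx⟩ := CompleteSpace.complete hcauchy
  refine ⟨x, fun I => ?_⟩
  have h1 : {y | y - x ∈ I.1} ∈ F := by
    refine hx ?_
    have : Filter.Tendsto (fun y => y - x) (𝓝 x) (𝓝 0) := by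
      have := (continuous_id.sub continuous_const).tendsto (f := fun y => y - x) x
      simpa using this
    exact this (I.2.mem_nhds I.1.zero_mem)
  obtain ⟨y, hy, hy'⟩ := hneBot.nonempty_of_mem
    (Filter.inter_mem h1 ((hF (S I)).mpr ⟨I, subset_rfl⟩))
  have := I.1.sub_mem hy' hy
  rwa [sub_sub_sub_cancel_left] at this

/-- A criterion for a topological ring to be admissible, in terms of a fundamental system `K` of open
ideals. -/
lemma admissibleRing_of_basis [IsTopologicalRing A] {ι : Type*} (K : ι → Ideal A)
    (hopen : ∀ i, IsOpen (K i : Set A)) (hbasis : ∀ V ∈ 𝓝 (0 : A), ∃ i, (K i : Set A) ⊆ V)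
    (hdef : ∃ J : Ideal A, IsIdealOfDefinition J) (hsep : ∀ x, (∀ i, x ∈ K i) → x = 0)
    (hcomp : ∀ a : ι → A, (∀ i j, K i ≤ K j → a i - a j ∈ K j) → ∃ x, ∀ i, x - a i ∈ K i) :
    AdmissibleRing A := by
  have hnhds (i : ι) : (K i : Set A) ∈ 𝓝 0 := (hopen i).mem_nhds (K i).zero_mem
  have hlin : IsLinearTopology A A :=
    IsLinearTopology.mk_of_hasBasis A (ι := ι) (S := Ideal A) (p := fun _ => True) (s := K)
      ⟨fun V => ⟨fun hV => by simpa using hbasis V hV,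
        fun ⟨i, _, hi⟩ => Filter.mem_of_superset (hnhds i) hi⟩⟩
  refine { hlin with exists_isIdealOfDefinition := hdef, t2Space := ?_, completeSpace := ?_ }
  · refine IsTopologicalAddGroup.t2Space_of_zero_sep fun x hx => ?_
    by_contra! h
    exact hx (hsep x fun i => h _ (hnhds i))
  · let _ := IsTopologicalAddGroup.rightUniformSpace A
    refine ⟨fun {F} hF => ?_⟩
    have := hF.1
    have h1 (i : ι) : ∃ a : A, {y | y - a ∈ K i} ∈ F := by
      have : {p : A × A | p.2 - p.1 ∈ K i} ∈ uniformity A := by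
        rw [uniformity_eq_comap_nhds_zero' A]
        exact ⟨K i, hnhds i, fun p hp => by simpa [sub_eq_add_neg] using hp⟩
      obtain ⟨s, hs, t, ht, hst⟩ := Filter.mem_prod_iff.mp (hF.2 this)
      obtain ⟨a, ha⟩ := hF.1.nonempty_of_mem hs
      exact ⟨a, Filter.mem_of_superset ht fun y hy => hst (Set.mk_mem_prod ha hy)⟩
    choose a ha using h1
    obtain ⟨x, hx⟩ := hcomp a fun i j hij => by
      obtain ⟨y, hy, hy'⟩ := hF.1.nonempty_of_mem (Filter.inter_mem (ha i) (ha j))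
      have := (K j).sub_mem hy' (hij hy)
      rwa [sub_sub_sub_cancel_left] at this
    refine ⟨x, fun V hV => ?_⟩
    obtain ⟨i, hi⟩ := hbasis ((fun y => y + x) ⁻¹' V) (by
      refine (continuous_id.add continuous_const).continuousAt.preimage_mem_nhds ?_
      simpa using hV)
    refine Filter.mem_of_superset (ha i) fun y hy => ?_
    have := (K i).sub_mem hy (hx i)
    rw [sub_sub_sub_cancel_right] at this
    simpa using hi this

lemma IsAdic.isIdealOfDefinition [IsTopologicalRing A] {J : Ideal A} (hJ : IsAdic J) :
    IsIdealOfDefinition J := by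
  rw [isAdic_iff] at hJ
  exact ⟨by simpa using hJ.1 1, hJ.2⟩

lemma admissibleRing_of_isAdic [IsTopologicalRing A] {J : Ideal A} (hJ : IsAdic J)
    [IsAdicComplete J A] : AdmissibleRing A := by
  have h := isAdic_iff.mp hJ
  refine admissibleRing_of_basis (fun n : ℕ => J ^ n) h.1 h.2 ⟨J, IsAdic.isIdealOfDefinition hJ⟩
    (eq_zero_of_forall_mem_pow J) fun a ha => ?_
  exact exists_limit_of_isAdicComplete J a fun m => ha _ _ (Ideal.pow_le_pow_right m.le_succ)

lemma isAdicComplete_of_isAdic [AdmissibleRing A] {J : Ideal A} (hJ : IsAdic J) :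
    IsAdicComplete J A := by
  let _ := IsTopologicalAddGroup.rightUniformSpace A
  have : IsUniformAddGroup A := isUniformAddGroup_of_addCommGroup
  exact (IsAdic.isAdicComplete_iff hJ).mpr ⟨AdmissibleRing.completeSpace, AdmissibleRing.t2Space⟩

lemma isOpen_pow_of_isAdic [IsTopologicalRing A] {J I : Ideal A} (hJ : IsAdic J)
    (hI : IsOpen (I : Set A)) (n : ℕ) : IsOpen ((I ^ n : Ideal A) : Set A) := by
  rw [isAdic_iff] at hJ
  obtain ⟨m, hm⟩ := hJ.2 _ (hI.mem_nhds I.zero_mem)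
  refine isOpen_of_le (hJ.1 (m * n)) ?_
  rw [pow_mul]
  exact Ideal.pow_right_mono hm n

lemma IsNoetherianAdicRing.isAdic [AdmissibleRing A] (hA : IsNoetherianAdicRing A) {I : Ideal A}
    (hI : IsIdealOfDefinition I) : IsAdic I := by
  obtain ⟨J, hJ⟩ := hA.exists_isAdic
  exact isAdic_iff.mpr ⟨isOpen_pow_of_isAdic hJ hI.isOpen, hI.exists_pow_subset⟩

variable (A) in
/-- The intersection of the open primes of `A`. If `A` is a noetherian adic ring, this is the largest
ideal of definition. -/
def openNilradical : Ideal A := ⨅ x : OpenPrime A, x.1.asIdeal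

lemma mem_openNilradical {a : A} : a ∈ openNilradical A ↔ ∀ x : OpenPrime A, a ∈ x.1.asIdeal := by
  simp [openNilradical]

lemma openNilradical_isRadical : (openNilradical A).IsRadical :=
  Ideal.isRadical_iInf _ fun x => x.1.2.isRadical

lemma openNilradical_eq_radical [AdmissibleRing A] {J : Ideal A} (hJ : IsIdealOfDefinition J) :
    openNilradical A = J.radical := by
  refine le_antisymm ?_ ?_
  · rw [Ideal.radical_eq_sInf]
    refine le_sInf fun p ⟨hp, hp'⟩ => ?_
    exact iInf_le (fun x : OpenPrime A => x.1.asIdeal) ⟨⟨p, hp'⟩, isOpen_of_le hJ.isOpen hp⟩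
  · exact openNilradical_isRadical.radical_le_iff.mpr (le_iInf hJ.le_asIdeal)

lemma IsNoetherianAdicRing.isIdealOfDefinition_openNilradical [AdmissibleRing A]
    (hA : IsNoetherianAdicRing A) : IsIdealOfDefinition (openNilradical A) := by
  obtain ⟨J, hJ⟩ := AdmissibleRing.exists_isIdealOfDefinition (A := A)
  have := hA.isNoetherianRing
  have e := openNilradical_eq_radical hJ
  obtain ⟨n, hn⟩ := Ideal.exists_radical_pow_le_of_fg J (IsNoetherian.noetherian _)
  refine ⟨isOpen_of_le hJ.isOpen (e ▸ Ideal.le_radical), fun V hV => ?_⟩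
  obtain ⟨m, hm⟩ := hJ.exists_pow_subset V hV
  refine ⟨n * m, subset_trans ?_ hm⟩
  rw [e, pow_mul]
  exact Ideal.pow_right_mono hn m

/-- Let `φ : R → S` be a ring homomorphism to an admissible ring which identifies `R / 𝔞 ^ n` with
`S / K n`, for a fundamental system of open ideals `K n`, and a finitely generated ideal `𝔞`.
Then `K n` is generated by the image of `𝔞 ^ n`, so that `S` has the `𝔞 S`-adic topology. -/
lemma eq_map_pow_of_approx {R : Type*} [CommRing R] [AdmissibleRing A] (φ : R →+* A) (𝔞 : Ideal R)
    (h𝔞 : 𝔞.FG) (K : ℕ → Ideal A) (hanti : Antitone K) (hopen : ∀ n, IsOpen (K n : Set A))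
    (hbasis : ∀ V ∈ 𝓝 (0 : A), ∃ n, (K n : Set A) ⊆ V)
    (hmem : ∀ n r, φ r ∈ K n ↔ r ∈ 𝔞 ^ n) (hsurj : ∀ n a, ∃ r, a - φ r ∈ K n) (n : ℕ) :
    K n = (𝔞.map φ) ^ n := by
  have hle (m : ℕ) : (𝔞 ^ m).map φ ≤ K m := Ideal.map_le_iff_le_comap.mpr fun r hr => (hmem m r).mpr hr
  rw [← Ideal.map_pow]
  refine le_antisymm (fun y hy => ?_) (hle n)
  obtain ⟨k, g, hg⟩ := Submodule.fg_iff_exists_fin_generating_family.1 (h𝔞.pow (n := n))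
  have hbasis' (I : OpenIdeal A) : ∃ n, K n ≤ I.1 := hbasis _ (I.2.mem_nhds I.1.zero_mem)
  have : y ∈ Ideal.span (Set.range fun j => φ (g j)) := by
    refine mem_span_of_approx K (fun x hx => eq_zero_of_forall_mem_openIdeal x fun I => ?_) ?_ _
      (fun m => K (n + m)) (fun m z hz => hanti (Nat.le_add_left m n) hz) ?_ y hy
    · obtain ⟨m, hm⟩ := hbasis' I
      exact hm (hx m)
    · intro f hf
      have hf' (m k : ℕ) (hmk : m ≤ k) : f k - f m ∈ K m := by
        induction k, hmk using Nat.le_induction with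
        | base => simp
        | succ k hmk ih =>
          have := (K m).add_mem (hanti hmk (hf k)) ih
          rwa [sub_add_sub_cancel] at this
      choose N hN using hbasis'
      obtain ⟨L, hL⟩ := exists_of_compatible (fun I => f (N I)) fun I J hIJ => by
        have h1 := hf' (min (N I) (N J)) (N I) (min_le_left _ _)
        have h2 := hf' (min (N I) (N J)) (N J) (min_le_right _ _)
        have := (K _).sub_mem h1 h2
        rw [sub_sub_sub_cancel_right] at this
        rcases le_total (N I) (N J) with h | h
        · rw [min_eq_left h] at this
          exact hIJ (hN I this)
        · rw [min_eq_right h] at this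
          exact hN J this
      refine ⟨L, fun m => ?_⟩
      let I : OpenIdeal A := ⟨K m, hopen m⟩
      have h1 := hL I
      have h2 : f (N I) - f m ∈ K m := by
        rcases le_total m (N I) with h | h
        · exact hf' _ _ h
        · have := hN I (hf' _ _ h)
          rw [← neg_sub]
          exact (K m).neg_mem this
      have := (K m).add_mem h1 h2
      rwa [sub_add_sub_cancel] at this
    · intro m z hz
      obtain ⟨r, hr⟩ := hsurj (n + (m + 1)) z
      have hr' : r ∈ 𝔞 ^ (m + n) := by
        rw [add_comm, ← hmem]
        have := (K (n + m)).sub_mem hz (hanti (by lia) hr)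
        rwa [sub_sub_cancel] at this
      rw [pow_add, ← hg, ← smul_eq_mul (𝔞 ^ m), Ideal.submodule_span_eq, smul_eq_mul,
        ← Ideal.submodule_span_eq, ← smul_eq_mul, Submodule.mem_ideal_smul_span_iff_exists_sum] at hr'
      obtain ⟨c, hc, hcr⟩ := hr'
      refine ⟨fun j => φ (c j), fun j => (hmem m _).mpr (hc j), ?_⟩
      have e : ∑ j, φ (c j) * φ (g j) = φ r := by
        rw [← hcr, Finsupp.sum_fintype _ _ (by simp), map_sum]
        simp
      rw [e]
      exact hr
  refine Ideal.span_le.mpr ?_ this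
  rintro _ ⟨j, rfl⟩
  exact Ideal.mem_map_of_mem _ (hg ▸ Submodule.subset_span ⟨j, rfl⟩)

lemma isAdic_map_of_approx {R : Type*} [CommRing R] [AdmissibleRing A] (φ : R →+* A) (𝔞 : Ideal R)
    (h𝔞 : 𝔞.FG) (K : ℕ → Ideal A) (hanti : Antitone K) (hopen : ∀ n, IsOpen (K n : Set A))
    (hbasis : ∀ V ∈ 𝓝 (0 : A), ∃ n, (K n : Set A) ⊆ V)
    (hmem : ∀ n r, φ r ∈ K n ↔ r ∈ 𝔞 ^ n) (hsurj : ∀ n a, ∃ r, a - φ r ∈ K n) :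
    IsAdic (𝔞.map φ) := by
  have h := eq_map_pow_of_approx φ 𝔞 h𝔞 K hanti hopen hbasis hmem hsurj
  rw [isAdic_iff]
  simp only [← h]
  exact ⟨hopen, hbasis⟩

/-- An adic ring, with an ideal of definition that is finitely generated and has a noetherian quotient,
is a noetherian adic ring. -/
lemma isNoetherianAdicRing_of_isAdic [AdmissibleRing A] {J : Ideal A} (hJ : IsAdic J) (hfg : J.FG)
    [IsNoetherianRing (A ⧸ J)] : IsNoetherianAdicRing A := by
  have := isAdicComplete_of_isAdic hJ
  exact ⟨isNoetherianRing_of_isAdicComplete J hfg, J, hJ⟩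

end Admissible

/-! ### Morphisms of locally ringed spaces in terms of sections -/

section LRS

variable {X Y Z : LocallyRingedSpace.{u}}

/-- The restriction maps of the structure sheaf of a locally ringed space. -/
def secRes (X : LocallyRingedSpace.{u}) {U V : Opens X.toTopCat} (h : V ≤ U) :
    X.presheaf.obj (op U) →+* X.presheaf.obj (op V) :=
  (X.presheaf.map (homOfLE h).op).hom

/-- The map from sections over `U` to sections over `V` given by a morphism of locally ringed spaces
which maps `V` to `U`. -/
def appLE (f : X ⟶ Y) (U : Opens Y.toTopCat) (V : Opens X.toTopCat)
    (h : V ≤ (Opens.map f.base).obj U) : Y.presheaf.obj (op U) →+* X.presheaf.obj (op V) :=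
  (secRes X h).comp (f.c.app (op U)).hom

lemma le_map_of_forall (f : X ⟶ Y) {U : Opens Y.toTopCat} {V : Opens X.toTopCat}
    (h : ∀ x ∈ V, f.base x ∈ U) : V ≤ (Opens.map f.base).obj U := h

lemma le_map_of_le (f : X ⟶ Y) {U U' : Opens Y.toTopCat} {V : Opens X.toTopCat} (hU : U' ≤ U)
    (h : V ≤ (Opens.map f.base).obj U') : V ≤ (Opens.map f.base).obj U := fun _ hx => hU (h hx)

lemma map_mono (f : X ⟶ Y) {U U' : Opens Y.toTopCat} (hU : U' ≤ U) :
    (Opens.map f.base).obj U' ≤ (Opens.map f.base).obj U := fun _ hx => hU hx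

lemma comap_mono (f : C(X, Y)) {U U' : Opens Y.toTopCat} (hU : U' ≤ U) :
    Opens.comap f U' ≤ Opens.comap f U := fun _ hx => hU hx

lemma le_map_comp (f : X ⟶ Y) (g : Y ⟶ Z) {U : Opens Z.toTopCat} {V : Opens Y.toTopCat}
    {W : Opens X.toTopCat} (hU : V ≤ (Opens.map g.base).obj U) (hV : W ≤ (Opens.map f.base).obj V) :
    W ≤ (Opens.map (f ≫ g).base).obj U := fun _ hx => hU (hV hx)

lemma le_map_congr {f g : X ⟶ Y} (e : f = g) {U : Opens Y.toTopCat} {V : Opens X.toTopCat}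
    (h : V ≤ (Opens.map f.base).obj U) : V ≤ (Opens.map g.base).obj U := e ▸ h

lemma secRes_secRes {U V W : Opens X.toTopCat} (h : V ≤ U) (h' : W ≤ V)
    (s : X.presheaf.obj (op U)) : secRes X h' (secRes X h s) = secRes X (h'.trans h) s := by
  simp only [secRes]
  rw [← CommRingCat.comp_apply, ← Functor.map_comp]
  rfl

lemma secRes_self {U : Opens X.toTopCat} (h : U ≤ U) (s : X.presheaf.obj (op U)) :
    secRes X h s = s := by
  have : (homOfLE h).op = 𝟙 (op U) := rfl
  simp only [secRes, this, CategoryTheory.Functor.map_id]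
  rfl

lemma secRes_appLE (f : X ⟶ Y) {U : Opens Y.toTopCat} {V W : Opens X.toTopCat}
    (h : V ≤ (Opens.map f.base).obj U) (h' : W ≤ V) (s : Y.presheaf.obj (op U)) :
    secRes X h' (appLE f U V h s) = appLE f U W (h'.trans h) s :=
  secRes_secRes _ _ _

lemma appLE_secRes (f : X ⟶ Y) {U U' : Opens Y.toTopCat} {V : Opens X.toTopCat} (hU : U' ≤ U)
    (h : V ≤ (Opens.map f.base).obj U') (s : Y.presheaf.obj (op U)) :
    appLE f U' V h (secRes Y hU s) = appLE f U V (le_map_of_le f hU h) s := by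
  have := congrArg (fun φ => φ.hom s) (f.c.naturality (homOfLE hU).op)
  exact (congrArg (secRes X h) this).trans (secRes_secRes (V := (Opens.map f.base).obj U')
    (map_mono f hU) h ((f.c.app (op U)).hom s))

lemma appLE_comp (f : X ⟶ Y) (g : Y ⟶ Z) {U : Opens Z.toTopCat} {V : Opens Y.toTopCat}
    {W : Opens X.toTopCat} (hU : V ≤ (Opens.map g.base).obj U) (hV : W ≤ (Opens.map f.base).obj V)
    (s : Z.presheaf.obj (op U)) :
    appLE f V W hV (appLE g U V hU s) = appLE (f ≫ g) U W (le_map_comp f g hU hV) s := by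
  simp only [appLE, RingHom.comp_apply]
  exact appLE_secRes f hU hV ((g.c.app (op U)).hom s)

lemma appLE_congr {f g : X ⟶ Y} (e : f = g) {U : Opens Y.toTopCat} {V : Opens X.toTopCat}
    (h : V ≤ (Opens.map f.base).obj U) (s : Y.presheaf.obj (op U)) :
    appLE f U V h s = appLE g U V (le_map_congr e h) s := by
  subst e; rfl

/-- Sections which agree locally are equal. -/
lemma sec_eq_of_locally {U : Opens X.toTopCat} (s t : X.presheaf.obj (op U))
    (h : ∀ x ∈ U, ∃ (V : Opens X.toTopCat) (hV : V ≤ U), x ∈ V ∧ secRes X hV s = secRes X hV t) :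
    s = t := by
  choose V hV hx e using h
  refine TopCat.Sheaf.eq_of_locally_eq' X.sheaf (fun x : U => V x.1 x.2) U
    (fun x => homOfLE (hV x.1 x.2)) (fun x hxU => ?_) s t fun x => e x.1 x.2
  exact Opens.mem_iSup.mpr ⟨⟨x, hxU⟩, hx x hxU⟩

lemma germ_secRes {U V : Opens X.toTopCat} (h : V ≤ U) (x : X) (hx : x ∈ V)
    (s : X.presheaf.obj (op U)) :
    (X.presheaf.germ V x hx).hom (secRes X h s) = (X.presheaf.germ U x (h hx)).hom s :=
  X.presheaf.germ_res_apply (homOfLE h) x hx s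

lemma stalkMap_germ_appLE (f : X ⟶ Y) (U : Opens Y.toTopCat) (V : Opens X.toTopCat)
    (h : V ≤ (Opens.map f.base).obj U) (x : X) (hx : x ∈ V) (s : Y.presheaf.obj (op U)) :
    (f.stalkMap x).hom ((Y.presheaf.germ U (f.base x) (h hx)).hom s) =
      (X.presheaf.germ V x hx).hom (appLE f U V h s) := by
  refine (LocallyRingedSpace.stalkMap_germ_apply f U x (h hx) s).trans ?_
  exact (germ_secRes h x hx _).symm

lemma isUnit_germ_appLE (f : X ⟶ Y) (U : Opens Y.toTopCat) (V : Opens X.toTopCat)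
    (h : V ≤ (Opens.map f.base).obj U) (x : X) (hx : x ∈ V) (s : Y.presheaf.obj (op U)) :
    IsUnit ((X.presheaf.germ V x hx).hom (appLE f U V h s)) ↔
      IsUnit ((Y.presheaf.germ U (f.base x) (h hx)).hom s) := by
  rw [← stalkMap_germ_appLE]
  exact isUnit_map_iff (f.stalkMap x).hom _

lemma lrsHom_ext (f g : X ⟶ Y) (hb : ∀ x : X, f.base x = g.base x)
    (h : ∀ (U : Opens Y.toTopCat) (x : X) (_ : f.base x ∈ U) (s : Y.presheaf.obj (op U)),
      ∃ (V : Opens X.toTopCat) (_ : x ∈ V) (hV : V ≤ (Opens.map f.base).obj U)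
        (hV' : V ≤ (Opens.map g.base).obj U), appLE f U V hV s = appLE g U V hV' s) : f = g := by
  obtain ⟨⟨fb, fc⟩, fp⟩ := f
  obtain ⟨⟨gb, gc⟩, gp⟩ := g
  obtain rfl : fb = gb := by ext x; exact hb x
  obtain rfl : fc = gc := by
    ext U s
    refine sec_eq_of_locally (X := X) _ _ fun x hx => ?_
    obtain ⟨V, hxV, hV, hV', e⟩ := h U x hx s
    exact ⟨V, hV, hxV, e⟩
  rfl

/-- Constructor for morphisms of ringed spaces, in terms of maps on sections. -/
def ringedHomMk (b : C(X, Y))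
    (φ : ∀ U : Opens Y.toTopCat, Y.presheaf.obj (op U) →+* X.presheaf.obj (op (Opens.comap b U)))
    (hres : ∀ (U V : Opens Y.toTopCat) (h : V ≤ U) (s : Y.presheaf.obj (op U)),
      φ V (secRes Y h s) = secRes X (comap_mono b h) (φ U s)) :
    X.toPresheafedSpace ⟶ Y.toPresheafedSpace where
  base := TopCat.ofHom b
  c :=
    { app := fun U => CommRingCat.ofHom (φ U.unop)
      naturality := fun U V i => by
        ext s
        exact hres U.unop V.unop i.unop.le s }

/-- Constructor for morphisms of locally ringed spaces, in terms of maps on sections. -/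
def lrsHomMk (b : C(X, Y))
    (φ : ∀ U : Opens Y.toTopCat, Y.presheaf.obj (op U) →+* X.presheaf.obj (op (Opens.comap b U)))
    (hres : ∀ (U V : Opens Y.toTopCat) (h : V ≤ U) (s : Y.presheaf.obj (op U)),
      φ V (secRes Y h s) = secRes X (comap_mono b h) (φ U s))
    (hloc : ∀ (U : Opens Y.toTopCat) (x : X) (hx : b x ∈ U) (s : Y.presheaf.obj (op U)),
      IsUnit ((X.presheaf.germ (Opens.comap b U) x hx).hom (φ U s)) →
        IsUnit ((Y.presheaf.germ U (b x) hx).hom s)) : X ⟶ Y where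
  toHom := ringedHomMk b φ hres
  prop x := by
    constructor
    intro z hz
    obtain ⟨U, hx, s, rfl⟩ := Y.presheaf.exists_germ_eq z
    refine hloc U x hx s ?_
    have e := PresheafedSpace.stalkMap_germ_apply (ringedHomMk b φ hres) U x hx s
    exact e ▸ hz

lemma isOpenEmbedding_base (j : X ⟶ Y) [LocallyRingedSpace.IsOpenImmersion j] :
    IsOpenEmbedding j.base :=
  PresheafedSpace.IsOpenImmersion.base_open (f := j.1)

/-- The range of an open immersion. -/
def opensRange (j : X ⟶ Y) [LocallyRingedSpace.IsOpenImmersion j] : Opens Y.toTopCat :=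
  ⟨Set.range j.base, (isOpenEmbedding_base j).isOpen_range⟩

/-- The image of an open subset under an open immersion. -/
def opensImage (j : X ⟶ Y) [LocallyRingedSpace.IsOpenImmersion j] (V : Opens X.toTopCat) :
    Opens Y.toTopCat :=
  (isOpenEmbedding_base j).functor.obj V

lemma mem_opensImage (j : X ⟶ Y) [LocallyRingedSpace.IsOpenImmersion j] {V : Opens X.toTopCat}
    {x : X} : j.base x ∈ opensImage j V ↔ x ∈ V :=
  (isOpenEmbedding_base j).injective.mem_set_image (s := (V : Set X))

lemma opensImage_le (j : X ⟶ Y) [LocallyRingedSpace.IsOpenImmersion j] (V : Opens X.toTopCat) :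
    opensImage j V ≤ opensRange j := by
  rintro _ ⟨x, _, rfl⟩
  exact ⟨x, rfl⟩

lemma appLE_bijective (j : X ⟶ Y) [LocallyRingedSpace.IsOpenImmersion j] (U : Opens Y.toTopCat)
    (V : Opens X.toTopCat) (hU : U ≤ opensRange j) (h : ∀ x, x ∈ V ↔ j.base x ∈ U) :
    Function.Bijective (appLE j U V (le_map_of_forall j fun x => (h x).mp)) := by
  obtain rfl : V = (Opens.map j.base).obj U := by ext x; exact h x
  have hU' : U = (isOpenEmbedding_base j).functor.obj ((Opens.map j.base).obj U) := by
    ext y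
    constructor
    · intro hy
      obtain ⟨x, rfl⟩ := hU hy
      exact ⟨x, hy, rfl⟩
    · rintro ⟨x, hx, rfl⟩
      exact hx
  have : IsIso (j.c.app (op U)) := PresheafedSpace.IsOpenImmersion.c_iso' j.1 _ hU'
  have e : appLE j U ((Opens.map j.base).obj U) le_rfl = (j.c.app (op U)).hom := by
    ext s
    exact secRes_self _ _
  change Function.Bijective (appLE j U ((Opens.map j.base).obj U) le_rfl)
  rw [e]
  exact ConcreteCategory.bijective_of_isIso (j.c.app (op U))

lemma isOpenImmersion_of_bijective (j : X ⟶ Y) (hb : IsOpenEmbedding j.base)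
    (h : ∀ (U : Opens Y.toTopCat) (V : Opens X.toTopCat), (U : Set Y) ⊆ Set.range j.base →
      ∀ hV : (∀ x, x ∈ V ↔ j.base x ∈ U), Function.Bijective (appLE j U V (le_map_of_forall j fun x => (hV x).mp))) :
    LocallyRingedSpace.IsOpenImmersion j where
  base_open := hb
  c_iso U := by
    have := h (hb.functor.obj U) ((Opens.map j.base).obj (hb.functor.obj U))
      (by rintro _ ⟨x, _, rfl⟩; exact ⟨x, rfl⟩) fun x => Iff.rfl
    have e : appLE j (hb.functor.obj U) ((Opens.map j.base).obj (hb.functor.obj U)) le_rfl =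
        (j.c.app (op (hb.functor.obj U))).hom := by
      ext s
      exact secRes_self _ _
    change Function.Bijective (appLE j (hb.functor.obj U)
      ((Opens.map j.base).obj (hb.functor.obj U)) le_rfl) at this
    rw [e] at this
    exact (ConcreteCategory.isIso_iff_bijective _).mpr this

lemma exists_lrsLift (j : X ⟶ Y) [LocallyRingedSpace.IsOpenImmersion j] (g : Z ⟶ Y)
    (h : ∀ z, g.base z ∈ opensRange j) : ∃ l : Z ⟶ X, l ≫ j = g :=
  ⟨LocallyRingedSpace.IsOpenImmersion.lift j g (by rintro _ ⟨z, rfl⟩; exact h z),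
    LocallyRingedSpace.IsOpenImmersion.lift_fac _ _ _⟩

lemma isUnit_germ_congr_point {U : Opens X.toTopCat} (s : X.presheaf.obj (op U)) {x y : X}
    (e : x = y) (hx : x ∈ U) (hy : y ∈ U) : IsUnit ((X.presheaf.germ U x hx).hom s) ↔
      IsUnit ((X.presheaf.germ U y hy).hom s) := by
  subst e; rfl

/-- Morphisms of locally ringed spaces can be glued along open coverings. The condition that they agree
on overlaps only has to be checked after restriction to members of a covering of each overlap. -/
theorem exists_lrsGlue {T L : LocallyRingedSpace.{u}} {κ : Type*} (S : κ → LocallyRingedSpace.{u})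
    (j : ∀ k, S k ⟶ T) [∀ k, LocallyRingedSpace.IsOpenImmersion (j k)]
    (hcov : ∀ t, ∃ k, t ∈ opensRange (j k)) (m : ∀ k, S k ⟶ L)
    (H : ∀ k l t, t ∈ opensRange (j k) → t ∈ opensRange (j l) →
      ∃ (W : LocallyRingedSpace.{u}) (a : W ⟶ S k) (b : W ⟶ S l),
        LocallyRingedSpace.IsOpenImmersion (a ≫ j k) ∧ t ∈ Set.range (a ≫ j k).base ∧
          a ≫ j k = b ≫ j l ∧ a ≫ m k = b ≫ m l) :
    ∃ h : T ⟶ L, ∀ k, j k ≫ h = m k := by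
  choose k z hz using hcov
  let b (t : T) : L := (m (k t)).base (z t)
  have hb (l) (y : S l) : b ((j l).base y) = (m l).base y := by
    obtain ⟨W, u, v, -, ⟨w, hw⟩, e, e'⟩ := H (k ((j l).base y)) l ((j l).base y) ⟨_, hz _⟩ ⟨y, rfl⟩
    have h1 : u.base w = z ((j l).base y) :=
      (isOpenEmbedding_base (j (k ((j l).base y)))).injective (hw.trans (hz _).symm)
    have h2 : v.base w = y := by
      refine (isOpenEmbedding_base (j l)).injective (Eq.trans ?_ hw)
      exact congrArg (fun f : W ⟶ T => f.base w) e.symm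
    have h3 : (m _).base (u.base w) = (m l).base (v.base w) :=
      congrArg (fun f : W ⟶ L => f.base w) e'
    rw [h1, h2] at h3
    exact h3
  have hcont : Continuous b := by
    rw [continuous_iff_continuousAt]
    intro t
    rw [← hz t, ← (isOpenEmbedding_base (j (k t))).continuousAt_iff]
    have : (fun y => b ((j (k t)).base y)) = (m (k t)).base := funext fun y => hb _ y
    change ContinuousAt (fun y => b ((j (k t)).base y)) _
    rw [this]
    exact (m (k t)).base.hom.continuous.continuousAt
  let β : C(T, L) := ⟨b, hcont⟩
  let N (U : Opens L.toTopCat) (l : κ) : Opens (S l).toTopCat := (Opens.map (m l).base).obj U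
  have hN (U l) : N U l ≤ (Opens.map (j l).base).obj (Opens.comap β U) := fun y hy => by
    change b ((j l).base y) ∈ U
    rw [hb]; exact hy
  have key (U : Opens L.toTopCat) (s : L.presheaf.obj (op U)) :
      ∃! t : T.presheaf.obj (op (Opens.comap β U)),
        ∀ l, appLE (j l) _ (N U l) (hN U l) t = appLE (m l) U (N U l) le_rfl s := by
    have h1 (l) := (appLE_bijective (j l) (opensImage (j l) (N U l)) (N U l) (opensImage_le _ _)
      fun y => (mem_opensImage (j l)).symm).2 (appLE (m l) U (N U l) le_rfl s)
    choose t ht using h1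
    have hle (l) : opensImage (j l) (N U l) ≤ Opens.comap β U := by
      rintro _ ⟨y, hy, rfl⟩
      exact hN U l hy
    have hcov : Opens.comap β U ≤ iSup fun l => opensImage (j l) (N U l) := by
      intro y hy
      exact Opens.mem_iSup.mpr ⟨k y, z y, hy, hz y⟩
    obtain ⟨r, hr, hr'⟩ := TopCat.Sheaf.existsUnique_gluing' T.sheaf
      (fun l => opensImage (j l) (N U l)) (Opens.comap β U) (fun l => homOfLE (hle l)) hcov t (by
        intro l l'
        refine sec_eq_of_locally (X := T) _ _ fun y hy => ?_
        obtain ⟨W, u, v, hopen, hw, e, e'⟩ := H l l' y (opensImage_le _ _ hy.1)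
          (opensImage_le _ _ hy.2)
        let N' : Opens W.toTopCat := (Opens.map (u ≫ j l).base).obj
          (opensImage (j l) (N U l) ⊓ opensImage (j l') (N U l'))
        have hM : opensImage (u ≫ j l) N' ≤
            opensImage (j l) (N U l) ⊓ opensImage (j l') (N U l') := by
          rintro _ ⟨w, hw, rfl⟩
          exact hw
        refine ⟨opensImage (u ≫ j l) N', hM, ?_, ?_⟩
        · obtain ⟨w, rfl⟩ := hw
          exact (mem_opensImage _).mpr hy
        · refine (appLE_bijective (u ≫ j l) _ N' (opensImage_le _ _)
            fun w => (mem_opensImage _).symm).1 ?_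
          have hu : N' ≤ (Opens.map u.base).obj (N U l) := fun w hw =>
            (mem_opensImage (j l)).mp hw.1
          have hv : N' ≤ (Opens.map v.base).obj (N U l') := fun w hw => by
            have h2 := hw.2
            rw [e] at h2
            exact (mem_opensImage (j l')).mp h2
          change appLE _ _ _ _ (secRes T hM (secRes T inf_le_left (t l))) =
            appLE _ _ _ _ (secRes T hM (secRes T inf_le_right (t l')))
          have hi (l) : N U l ≤ (Opens.map (j l).base).obj (opensImage (j l) (N U l)) :=
            fun _ hx => (mem_opensImage (j l)).mpr hx
          rw [appLE_secRes, appLE_secRes, appLE_secRes, appLE_secRes, appLE_congr e _ (t l'),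
            ← appLE_comp u (j l) (hi l) hu, ← appLE_comp v (j l') (hi l') hv, ht, ht, appLE_comp, appLE_comp, appLE_congr e'])
    refine ⟨r, fun l => ?_, fun r₁ h₁ => hr' r₁ fun l => ?_⟩
    · rw [← ht l, ← hr l]
      exact (appLE_secRes (j l) (hle l) _ r).symm
    · refine (appLE_bijective (j l) _ (N U l) (opensImage_le _ _)
        fun y => (mem_opensImage (j l)).symm).1 ?_
      rw [ht, ← h₁ l]
      exact appLE_secRes (j l) (hle l) _ r₁
  choose φ hφ hφ' using key
  let Φ (U : Opens L.toTopCat) : L.presheaf.obj (op U) →+* T.presheaf.obj (op (Opens.comap β U)) :=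
    { toFun := φ U
      map_one' := (hφ' U 1 1 fun l => by rw [map_one, map_one]).symm
      map_mul' := fun s t => (hφ' U _ _ fun l => by rw [map_mul, map_mul, hφ, hφ]).symm
      map_zero' := (hφ' U 0 0 fun l => by rw [map_zero, map_zero]).symm
      map_add' := fun s t => (hφ' U _ _ fun l => by rw [map_add, map_add, hφ, hφ]).symm }
  let h : T ⟶ L := lrsHomMk β Φ (fun U V hV s => by
      refine (hφ' V _ _ fun l => ?_).symm
      have hNV : N V l ≤ N U l := fun y hy => hV hy
      change appLE _ _ _ _ (secRes T _ (φ U s)) = _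
      rw [appLE_secRes, ← secRes_appLE (j l) (hN U l) hNV, appLE_secRes]
      exact (congrArg (secRes (S l) hNV) (hφ U s l)).trans (secRes_appLE _ _ _ _)) (by
    intro U y hy s hs
    have hy' : (j (k y)).base (z y) ∈ Opens.comap β U := by rw [hz y]; exact hy
    rw [isUnit_germ_congr_point _ (hz y).symm hy hy'] at hs
    have h1 : z y ∈ N U (k y) := hy
    rw [← isUnit_germ_appLE (j (k y)) _ (N U (k y)) (hN U _) (z y) h1] at hs
    exact (isUnit_germ_appLE (m (k y)) U (N U (k y)) le_rfl (z y) h1 s).mp ((hφ U s (k y)) ▸ hs))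
  refine ⟨h, fun l => lrsHom_ext _ _ (hb l) fun U y hy s => ?_⟩
  have hy' : y ∈ N U l := by
    change (m l).base y ∈ U
    rw [← hb]; exact hy
  refine ⟨N U l, hy', hN U l, le_rfl, ?_⟩
  rw [← hφ U s l, ← appLE_comp (j l) h (V := Opens.comap β U) le_rfl (hN U l)]
  exact congrArg _ (secRes_self (X := T) (U := Opens.comap β U) le_rfl _)

end LRS

/-! ### Open immersions of topologically ringed spaces -/

namespace TopLocallyRingedSpace

variable {X Y Z : TopLocallyRingedSpace.{u}}

@[simp] lemma comp_toLRS (f : X ⟶ Y) (g : Y ⟶ Z) : (f ≫ g).toLRS = f.toLRS ≫ g.toLRS := rfl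

@[ext] lemma hom_ext {f g : X ⟶ Y} (h : f.toLRS = g.toLRS) : f = g := Hom.ext h

lemma continuous_secRes (X : TopLocallyRingedSpace.{u}) {U V : Opens X.toTopCat} (h : V ≤ U) :
    @Continuous _ _ (X.topology U) (X.topology V) (secRes X.toLocallyRingedSpace h) := by
  have := X.topology_eq U (fun b : ULift.{u} Bool => if b.down then U else V)
    (by rintro ⟨_ | _⟩ <;> simp [h]) (le_iSup_of_le ⟨true⟩ (by simp))
  rw [continuous_iff_le_induced, this]
  exact iInf_le_of_le ⟨false⟩ le_rfl

lemma continuous_appLE (f : X ⟶ Y) (U : Opens Y.toTopCat) (V : Opens X.toTopCat)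
    (h : V ≤ (Opens.map f.toLRS.base).obj U) :
    @Continuous _ _ (Y.topology U) (X.topology V) (appLE f.toLRS U V h) :=
  @Continuous.comp _ _ _ (Y.topology U) (X.topology _) (X.topology V) _ _
    (X.continuous_secRes h) (f.continuous U)

/-- Open immersions of topologically ringed spaces: open immersions of locally ringed spaces such that
the rings of sections over subsets of the image carry the same topologies. -/
class IsOpenImm (j : X ⟶ Y) : Prop where
  lrs : LocallyRingedSpace.IsOpenImmersion j.toLRS
  topology_eq (U : Opens Y.toTopCat) (V : Opens X.toTopCat) (hU : U ≤ opensRange j.toLRS)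
    (h : ∀ x, x ∈ V ↔ j.toLRS.base x ∈ U) : Y.topology U =
      (X.topology V).induced (appLE j.toLRS U V (le_map_of_forall j.toLRS fun x => (h x).mp))

attribute [instance] IsOpenImm.lrs

lemma eq_induced_of_leftInverse {R S : Type*} {τ : TopologicalSpace R} {σ : TopologicalSpace S}
    {f : R → S} {g : S → R} (hf : Continuous f) (hg : Continuous g) (h : Function.LeftInverse g f) :
    τ = σ.induced f := by
  refine le_antisymm (continuous_iff_le_induced.mp hf) ?_
  refine (induced_mono (continuous_iff_le_induced.mp hg)).trans ?_
  rw [induced_compose, h.comp_eq_id, induced_id]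

instance {j : X ⟶ Y} [IsIso j] : IsOpenImm j := by
  have h1 : j.toLRS ≫ (inv j).toLRS = 𝟙 _ := congrArg Hom.toLRS (IsIso.hom_inv_id j)
  have h2 : (inv j).toLRS ≫ j.toLRS = 𝟙 _ := congrArg Hom.toLRS (IsIso.inv_hom_id j)
  have : IsIso j.toLRS := ⟨(inv j).toLRS, h1, h2⟩
  refine ⟨inferInstance, fun U V hU h => ?_⟩
  have hV : U ≤ (Opens.map (inv j).toLRS.base).obj V := fun y hy => by
    have h3 : j.toLRS.base ((inv j).toLRS.base y) = y :=
      congrArg (fun f : Y.toLocallyRingedSpace ⟶ Y.toLocallyRingedSpace => f.base y) h2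
    exact (h _).mpr (h3.symm ▸ hy)
  refine @eq_induced_of_leftInverse _ _ (Y.topology U) (X.topology V) _
    (appLE (inv j).toLRS V U hV) (continuous_appLE j _ _ _) (continuous_appLE (inv j) _ _ _) fun s => ?_
  rw [appLE_comp, appLE_congr h2]
  exact secRes_self _ _

instance (j : X ⟶ Y) (k : Y ⟶ Z) [hj : IsOpenImm j] [hk : IsOpenImm k] : IsOpenImm (j ≫ k) where
  lrs := by rw [comp_toLRS]; infer_instance
  topology_eq U V hU h := by
    have hV : ∀ x, x ∈ V ↔ j.toLRS.base x ∈ (Opens.map k.toLRS.base).obj U := h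
    have hU' : U ≤ opensRange k.toLRS := fun z hz => by
      obtain ⟨x, rfl⟩ := hU hz
      exact ⟨j.toLRS.base x, rfl⟩
    have hU'' : (Opens.map k.toLRS.base).obj U ≤ opensRange j.toLRS := fun y hy => by
      obtain ⟨x, hx⟩ := hU hy
      exact ⟨x, (isOpenEmbedding_base k.toLRS).injective hx⟩
    rw [hk.topology_eq U ((Opens.map k.toLRS.base).obj U) hU' fun y => Iff.rfl, hj.topology_eq _ V hU'' hV, induced_compose]
    congr 1
    ext s
    exact appLE_comp j.toLRS k.toLRS _ _ s

lemma IsOpenImm.mono (j : X ⟶ Y) [IsOpenImm j] {f g : Z ⟶ X} (h : f ≫ j = g ≫ j) : f = g := by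
  ext1
  rw [← cancel_mono j.toLRS]
  exact congrArg Hom.toLRS h

/-- The underlying open subset of an open immersion. -/
abbrev range (j : X ⟶ Y) [IsOpenImm j] : Opens Y.toTopCat := opensRange j.toLRS

/-- Morphisms with image in an open subset factor through it; the factorization is continuous since the
topologies of the open subspace are those of the ambient space. -/
lemma exists_lift (j : X ⟶ Y) [hj : IsOpenImm j] (g : Z ⟶ Y) (h : ∀ z, g.toLRS.base z ∈ range j) :
    ∃ l : Z ⟶ X, l ≫ j = g := by
  obtain ⟨l, hl⟩ := exists_lrsLift j.toLRS g.toLRS h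
  refine ⟨⟨l, fun V => ?_⟩, hom_ext hl⟩
  let U := opensImage j.toLRS V
  have hU : ∀ x, x ∈ V ↔ j.toLRS.base x ∈ U := fun x => (mem_opensImage j.toLRS).symm
  have hV : V ≤ (Opens.map j.toLRS.base).obj U := le_map_of_forall _ fun x => (hU x).mp
  have hb := appLE_bijective j.toLRS U V (opensImage_le _ _) hU
  let φ := (Equiv.ofBijective _ hb).symm
  have hφ : @Continuous _ _ (X.topology V) (Y.topology U) φ := by
    rw [hj.topology_eq U V (opensImage_le _ _) hU, continuous_induced_rng]
    have : (appLE j.toLRS U V (le_map_of_forall j.toLRS fun x => (hU x).mp)) ∘ φ = id :=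
      funext fun s => (Equiv.ofBijective _ hb).apply_symm_apply s
    rw [this]
    exact @continuous_id _ (X.topology V)
  have hW : (Opens.map l.base).obj V ≤ (Opens.map g.toLRS.base).obj U := by
    rw [← hl]
    exact le_map_comp l j.toLRS hV le_rfl
  have := @Continuous.comp _ _ _ (X.topology V) (Y.topology U) (Z.topology _) _ _
    (continuous_appLE g U ((Opens.map l.base).obj V) hW) hφ
  convert! this using 1
  ext s
  obtain ⟨t, rfl⟩ := hb.2 s
  have e : φ (appLE j.toLRS U V (le_map_of_forall j.toLRS fun x => (hU x).mp) t) = t :=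
    (Equiv.ofBijective _ hb).symm_apply_apply t
  simp only [Function.comp_apply]
  erw [e]
  refine Eq.trans ?_ ((appLE_comp l j.toLRS hV le_rfl t).trans (appLE_congr hl _ t))
  exact (secRes_self le_rfl _).symm

/-- Morphisms of topologically ringed spaces can be glued along open coverings. -/
theorem exists_glue {T L : TopLocallyRingedSpace.{u}} {κ : Type u} (S : κ → TopLocallyRingedSpace.{u})
    (j : ∀ k, S k ⟶ T) [hj : ∀ k, IsOpenImm (j k)] (hcov : ∀ t, ∃ k, t ∈ range (j k))
    (m : ∀ k, S k ⟶ L)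
    (H : ∀ k l t, t ∈ range (j k) → t ∈ range (j l) →
      ∃ (W : TopLocallyRingedSpace.{u}) (a : W ⟶ S k) (b : W ⟶ S l),
        IsOpenImm (a ≫ j k) ∧ t ∈ Set.range (a ≫ j k).toLRS.base ∧
          a ≫ j k = b ≫ j l ∧ a ≫ m k = b ≫ m l) :
    ∃ h : T ⟶ L, ∀ k, j k ≫ h = m k := by
  obtain ⟨h, hh⟩ := exists_lrsGlue (fun k => (S k).toLocallyRingedSpace) (fun k => (j k).toLRS) hcov
    (fun k => (m k).toLRS) fun k l t ht ht' => by
      obtain ⟨W, a, b, h1, h2, h3, h4⟩ := H k l t ht ht'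
      exact ⟨W.toLocallyRingedSpace, a.toLRS, b.toLRS, h1.lrs, h2, congrArg Hom.toLRS h3,
        congrArg Hom.toLRS h4⟩
  refine ⟨⟨h, fun U => ?_⟩, fun k => hom_ext (hh k)⟩
  let N (k) : Opens (S k).toTopCat := (Opens.map (m k).toLRS.base).obj U
  have hN (k) : N k ≤ (Opens.map (j k).toLRS.base).obj (opensImage (j k).toLRS (N k)) :=
    fun x hx => (mem_opensImage (j k).toLRS).mpr hx
  have hle (k) : opensImage (j k).toLRS (N k) ≤ (Opens.map h.base).obj U := by
    rintro _ ⟨x, hx, rfl⟩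
    have : (m k).toLRS.base x ∈ U := hx
    rw [← hh k] at this
    exact this
  have hcov' : (Opens.map h.base).obj U ≤ iSup fun k => opensImage (j k).toLRS (N k) := by
    intro t ht
    obtain ⟨k, x, rfl⟩ := hcov t
    refine Opens.mem_iSup.mpr ⟨k, (mem_opensImage (j k).toLRS).mpr ?_⟩
    change (m k).toLRS.base x ∈ U
    rw [← hh k]
    exact ht
  rw [T.topology_eq _ _ hle hcov']
  refine continuous_iInf_rng.mpr fun k => continuous_induced_rng.mpr ?_
  rw [(hj k).topology_eq _ (N k) (opensImage_le _ _) fun x => (mem_opensImage (j k).toLRS).symm]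
  refine continuous_induced_rng.mpr ?_
  convert! continuous_appLE (m k) U (N k) le_rfl using 1
  ext s
  have h1 := (appLE_comp (j k).toLRS h (hle k) (hN k) s).trans (appLE_congr (hh k) _ s)
  exact h1

/-- The inclusion of an open subspace. -/
def restrictι (X : TopLocallyRingedSpace.{u}) (U : Opens X.toTopCat) : X.restrict U ⟶ X where
  toLRS := X.toLocallyRingedSpace.ofRestrict U.isOpenEmbedding
  continuous _ := X.continuous_secRes _

lemma topology_eq_induced_of_eq (X : TopLocallyRingedSpace.{u}) {U V : Opens X.toTopCat}
    (h : V ≤ U) (h' : U ≤ V) : X.topology U = (X.topology V).induced (secRes X.toLocallyRingedSpace h) :=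
  @eq_induced_of_leftInverse _ _ (X.topology U) (X.topology V) _ (secRes X.toLocallyRingedSpace h')
    (X.continuous_secRes h) (X.continuous_secRes h') fun s =>
      (secRes_secRes _ _ s).trans (secRes_self _ s)

instance (X : TopLocallyRingedSpace.{u}) (U : Opens X.toTopCat) : IsOpenImm (X.restrictι U) where
  lrs := inferInstanceAs (LocallyRingedSpace.IsOpenImmersion
    (X.toLocallyRingedSpace.ofRestrict U.isOpenEmbedding))
  topology_eq V V' hV h := by
    have h1 : U.isOpenEmbedding.functor.obj V' ≤ V := by
      rintro _ ⟨x, hx, rfl⟩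
      exact (h x).mp hx
    have h2 : V ≤ U.isOpenEmbedding.functor.obj V' := fun x hx => by
      obtain ⟨y, rfl⟩ := hV hx
      exact ⟨y, (h y).mpr hx, rfl⟩
    refine (X.topology_eq_induced_of_eq h1 h2).trans ?_
    congr 1
    ext s
    have h3 : U.isOpenEmbedding.functor.obj ((Opens.map (X.restrictι U).toLRS.base).obj V) ≤ V := by
      rintro _ ⟨x, hx, rfl⟩
      exact hx
    have h4 : U.isOpenEmbedding.functor.obj V' ≤
        U.isOpenEmbedding.functor.obj ((Opens.map (X.restrictι U).toLRS.base).obj V) := by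
      rintro _ ⟨x, hx, rfl⟩
      exact ⟨x, (h x).mp hx, rfl⟩
    exact (secRes_secRes (X := X.toLocallyRingedSpace) h3 h4 s).symm

lemma mem_range_restrictι (X : TopLocallyRingedSpace.{u}) (U : Opens X.toTopCat) {x : X.toTopCat} :
    x ∈ range (X.restrictι U) ↔ x ∈ U :=
  ⟨fun ⟨y, hy⟩ => hy ▸ y.2, fun hx => ⟨⟨x, hx⟩, rfl⟩⟩

/-- The source of an open immersion is isomorphic to the open subspace on its image. -/
lemma nonempty_iso_restrict (j : X ⟶ Y) [IsOpenImm j] : Nonempty (Y.restrict (range j) ≅ X) := by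
  obtain ⟨a, ha⟩ := exists_lift j (Y.restrictι (range j)) fun z =>
    (mem_range_restrictι Y _).mp ⟨z, rfl⟩
  obtain ⟨b, hb⟩ := exists_lift (Y.restrictι (range j)) j fun z =>
    (mem_range_restrictι Y _).mpr ⟨z, rfl⟩
  refine ⟨⟨a, b, IsOpenImm.mono (Y.restrictι (range j)) ?_, IsOpenImm.mono j ?_⟩⟩
  · rw [Category.assoc, hb, ha, Category.id_comp]
  · rw [Category.assoc, ha, hb, Category.id_comp]

lemma mem_range_iso_restrict {U : Opens Y.toTopCat} (e : Y.restrict U ≅ X) {y : Y.toTopCat} :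
    y ∈ range (e.inv ≫ Y.restrictι U) ↔ y ∈ U := by
  constructor
  · rintro ⟨x, rfl⟩
    exact (mem_range_restrictι Y U).mp ⟨e.inv.toLRS.base x, rfl⟩
  · intro hy
    have h : (e.hom ≫ e.inv ≫ Y.restrictι U).toLRS.base ⟨y, hy⟩ = y := by
      rw [e.hom_inv_id_assoc]; rfl
    exact ⟨e.hom.toLRS.base ⟨y, hy⟩, h⟩

end TopLocallyRingedSpace

/-! ### Sections of the structure sheaf of a formal spectrum -/

section SpecSections

variable {R S T : Type u} [CommRing R] [CommRing S] [CommRing T]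

/-- The spectrum of a ring as a locally ringed space. -/
abbrev SpecL (R : Type u) [CommRing R] : LocallyRingedSpace.{u} := Spec.locallyRingedSpaceObj (.of R)

/-- The morphism of spectra given by a ring homomorphism. -/
abbrev SpecL.map (φ : R →+* S) : SpecL S ⟶ SpecL R := Spec.locallyRingedSpaceMap (CommRingCat.ofHom φ)

/-- Sections of the structure sheaf of `Spec R`. -/
abbrev SSec (R : Type u) [CommRing R] (U : Opens (PrimeSpectrum.Top R)) : CommRingCat.{u} :=
  (Spec.structureSheaf R).1.obj (op U)

lemma isUnit_germ_comap (φ : R →+* S) (U : Opens (PrimeSpectrum.Top R))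
    (V : Opens (PrimeSpectrum.Top S)) (h : V.1 ⊆ PrimeSpectrum.comap φ ⁻¹' U.1) (s : SSec R U)
    (q : PrimeSpectrum S) (hq : q ∈ V) :
    IsUnit ((Spec.structureSheaf S).presheaf.germ V q hq (StructureSheaf.comap φ U V h s)) ↔
      IsUnit ((Spec.structureSheaf R).presheaf.germ U (PrimeSpectrum.comap φ q) (h hq) s) :=
  isUnit_germ_appLE (SpecL.map φ) U V h q hq s

lemma comap_comap (φ : R →+* S) (ψ : S →+* T) (U : Opens (PrimeSpectrum.Top R))
    (V : Opens (PrimeSpectrum.Top S)) (W : Opens (PrimeSpectrum.Top T))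
    (h : V.1 ⊆ PrimeSpectrum.comap φ ⁻¹' U.1) (h' : W.1 ⊆ PrimeSpectrum.comap ψ ⁻¹' V.1)
    (h'' : W.1 ⊆ PrimeSpectrum.comap (ψ.comp φ) ⁻¹' U.1) (s : SSec R U) :
    StructureSheaf.comap ψ V W h' (StructureSheaf.comap φ U V h s) =
      StructureSheaf.comap (ψ.comp φ) U W h'' s := by
  rw [StructureSheaf.comap_comp φ ψ U V W h h']
  rfl

lemma comap_congr {φ ψ : R →+* S} (e : φ = ψ) (U : Opens (PrimeSpectrum.Top R))
    (V : Opens (PrimeSpectrum.Top S)) (h : V.1 ⊆ PrimeSpectrum.comap φ ⁻¹' U.1)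
    (h' : V.1 ⊆ PrimeSpectrum.comap ψ ⁻¹' U.1) (s : SSec R U) :
    StructureSheaf.comap φ U V h s = StructureSheaf.comap ψ U V h' s := by
  subst e; rfl

/-- The elements of `R`, considered as sections of the structure sheaf of `Spec R`. -/
def toSSec (U : Opens (PrimeSpectrum.Top R)) : R →+* SSec R U :=
  (StructureSheaf.openAlgebra R (op U)).algebraMap

lemma comap_toSSec (φ : R →+* S) (U : Opens (PrimeSpectrum.Top R))
    (V : Opens (PrimeSpectrum.Top S)) (h : V.1 ⊆ PrimeSpectrum.comap φ ⁻¹' U.1) (r : R) :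
    StructureSheaf.comap φ U V h (toSSec U r) = toSSec V (φ r) := by
  have := congrArg (fun f => f.hom r) (StructureSheaf.toOpen_comp_comap φ U)
  have e := congrArg ((Spec.structureSheaf S).1.map (homOfLE (show V ≤
    Opens.comap ⟨_, PrimeSpectrum.continuous_comap φ⟩ U from h)).op).hom this
  exact e

lemma isUnit_germ_toSSec (U : Opens (PrimeSpectrum.Top R)) (x : PrimeSpectrum R) (hx : x ∈ U)
    (r : R) : IsUnit ((Spec.structureSheaf R).presheaf.germ U x hx (toSSec U r)) ↔
      r ∉ x.asIdeal := by
  have h := IsLocalization.AtPrime.isUnit_to_map_iff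
    ((Spec.structureSheaf R).presheaf.stalk x) x.asIdeal r
  have e : (Spec.structureSheaf R).presheaf.germ U x hx (toSSec U r) =
      algebraMap R ((Spec.structureSheaf R).presheaf.stalk x) r :=
    StructureSheaf.algebraMap_germ_apply U x hx r
  rw [e, h]
  rfl

lemma toSSec_top_bijective : Function.Bijective (toSSec (R := R) ⊤) :=
  StructureSheaf.algebraMap_obj_top_bijective

lemma isUnit_toSSec (f : R) (U : Opens (PrimeSpectrum.Top R)) (hU : ∀ x ∈ U, f ∉ x.asIdeal) :
    IsUnit (toSSec U f) :=
  (SpecL R).toRingedSpace.isUnit_of_isUnit_germ U _ fun x hx =>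
    (isUnit_germ_toSSec U x hx f).mpr (hU x hx)

lemma exists_toSSec_eq (f : R) (U : Opens (PrimeSpectrum.Top R))
    (hU : ∀ x, x ∈ U ↔ f ∉ x.asIdeal) (s : SSec R U) :
    ∃ (n : ℕ) (r : R), toSSec U (f ^ n) * s = toSSec U r := by
  obtain rfl : U = PrimeSpectrum.basicOpen f := by ext x; exact hU x
  obtain ⟨⟨r, ⟨_, n, rfl⟩⟩, h⟩ :=
    @IsLocalization.surj R _ (Submonoid.powers f) _ _
    (StructureSheaf.openAlgebra R (op (PrimeSpectrum.basicOpen f))) (StructureSheaf.IsLocalization.to_basicOpen R f) s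
  exact ⟨n, r, (mul_comm _ _).trans h⟩

lemma exists_pow_mul_eq_zero (f : R) (U : Opens (PrimeSpectrum.Top R))
    (hU : ∀ x, x ∈ U ↔ f ∉ x.asIdeal) (r : R) (h : toSSec U r = 0) : ∃ n : ℕ, f ^ n * r = 0 := by
  obtain rfl : U = PrimeSpectrum.basicOpen f := by ext x; exact hU x
  obtain ⟨⟨_, n, rfl⟩, e⟩ := @IsLocalization.exists_of_eq R _ (Submonoid.powers f) _ _
    (StructureSheaf.openAlgebra R (op (PrimeSpectrum.basicOpen f))) (StructureSheaf.IsLocalization.to_basicOpen R f) r 0 (h.trans (map_zero (toSSec _)).symm)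
  exact ⟨n, e.trans (mul_zero _)⟩

end SpecSections

section Spf

variable {A B C : Type u} [CommRing A] [TopologicalSpace A] [AdmissibleRing A]
  [CommRing B] [TopologicalSpace B] [AdmissibleRing B]
  [CommRing C] [TopologicalSpace C] [AdmissibleRing C]

/-- Invertibility of the germ of a section of `Spf A` can be tested modulo any one open ideal. This makes `Spf A`
a locally ringed space and the morphisms `Spec (A / J) ⟶ Spf A` local. -/
lemma isUnit_germ_spf_iff (U : Opens (OpenPrime A)) (s : spfSections A U) (J : OpenIdeal A)
    (r : PrimeSpectrum (A ⧸ J.1)) (hr : r ∈ preim J U) :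
    IsUnit ((spfPresheaf A).germ U (specToOpenPrime J r) hr s) ↔
      IsUnit ((Spec.structureSheaf (A ⧸ J.1)).presheaf.germ (preim J U) r hr (s.1 J)) := by
  constructor
  · intro h
    have e := PresheafedSpace.stalkMap_germ_apply (specToSpfHom A J) U r hr s
    have h' := h.map ((specToSpfHom A J).stalkMap r).hom
    exact (show IsUnit _ from e ▸ h')
  · intro h
    obtain ⟨J₀, hJ₀⟩ := AdmissibleRing.exists_isIdealOfDefinition (A := A)
    obtain ⟨q, hq⟩ := exists_specToOpenPrime_eq ⟨J₀, hJ₀.isOpen⟩ (specToOpenPrime J r)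
      (hJ₀.le_asIdeal _)
    have hq' : q ∈ preim ⟨J₀, hJ₀.isOpen⟩ U := by
      change specToOpenPrime _ q ∈ U
      rw [hq]; exact hr
    have := isUnit_germ_spf U s ⟨J₀, hJ₀.isOpen⟩ hJ₀.le_asIdeal q hq'
      (isUnit_germ_congr U s _ J q r hq hq' hr h)
    exact (isUnit_germ_congr_point (X := (Spf A).toLocallyRingedSpace) s hq hq' hr).mp this

/-- The canonical morphism from `Spec (A / J)` to `Spf A`, for an open ideal `J`. -/
def specToSpf (J : OpenIdeal A) : SpecL (A ⧸ J.1) ⟶ (Spf A).toLocallyRingedSpace where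
  toHom := specToSpfHom A J
  prop r := by
    constructor
    intro z hz
    obtain ⟨U, hr, s, rfl⟩ := (spfPresheaf A).exists_germ_eq z
    refine (isUnit_germ_spf_iff U s J r hr).mpr ?_
    have e := PresheafedSpace.stalkMap_germ_apply (specToSpfHom A J) U r hr s
    exact e ▸ hz

/-- The elements of `A`, considered as sections of the structure sheaf of `Spf A`. -/
def toSec (U : Opens (OpenPrime A)) : A →+* spfSections A U where
  toFun a := ⟨fun I => toSSec (preim I U) (Ideal.Quotient.mk I.1 a),
    fun I J h => comap_toSSec _ _ _ _ _⟩
  map_one' := Subtype.ext (funext fun I => by simp)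
  map_mul' a b := Subtype.ext (funext fun I => by simp)
  map_zero' := Subtype.ext (funext fun I => by simp)
  map_add' a b := Subtype.ext (funext fun I => by simp)

lemma toSec_apply (U : Opens (OpenPrime A)) (a : A) (I : OpenIdeal A) :
    (toSec U a).1 I = toSSec (preim I U) (Ideal.Quotient.mk I.1 a) := rfl

/-- The value of a section at an open ideal. -/
def evalSec (U : Opens (OpenPrime A)) (I : OpenIdeal A) : spfSections A U →+* Sec I U :=
  (Pi.evalRingHom (fun I : OpenIdeal A => Sec I U) I).comp (spfSections A U).subtype

lemma continuous_res_eval (U : Opens (OpenPrime A)) (I : OpenIdeal A) {V : Opens (OpenPrime A)}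
    (h : V ≤ U) (hV : IsCompact (V : Set (OpenPrime A))) :
    @Continuous _ _ (spfTopology A U) ⊥ (fun s : spfSections A U => res I h (s.1 I)) :=
  continuous_iff_le_induced.mpr
    (iInf_le_of_le I (iInf_le_of_le V (iInf_le_of_le h (iInf_le_of_le hV le_rfl))))

lemma exists_isCompact_between {X : Type*} [TopologicalSpace X] (f : C(X, OpenPrime A)) {V : Opens X}
    (hV : IsCompact (V : Set X)) {U : Opens (OpenPrime A)} (h : V ≤ Opens.comap f U) :
    ∃ W : Opens (OpenPrime A), W ≤ U ∧ IsCompact (W : Set (OpenPrime A)) ∧ V ≤ Opens.comap f W := by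
  obtain ⟨J, hJ⟩ := AdmissibleRing.exists_isIdealOfDefinition (A := A)
  have key : ∀ x ∈ f '' V, ∃ a : A, x ∈ spfBasicOpen A a ∧ spfBasicOpen A a ≤ U := by
    rintro _ ⟨x, hx, rfl⟩
    exact exists_spfBasicOpen U (f x) (h hx)
  choose a ha ha' using key
  obtain ⟨t, ht⟩ := (hV.image f.continuous).elim_nhds_subcover' (fun x hx => spfBasicOpen A (a x hx))
    (fun x hx => (spfBasicOpen A (a x hx)).2.mem_nhds (ha x hx))
  refine ⟨⨆ x ∈ t, spfBasicOpen A (a x.1 x.2), iSup₂_le fun x _ => ha' x.1 x.2, ?_, ?_⟩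
  · simp only [Opens.coe_iSup]
    exact t.isCompact_biUnion fun x _ => isCompact_spfBasicOpen ⟨J, hJ.isOpen⟩ hJ.le_asIdeal _
  · intro x hx
    have := ht ⟨x, hx, rfl⟩
    change f x ∈ (↑(⨆ x ∈ t, spfBasicOpen A (a x.1 x.2)) : Set _)
    simpa only [Opens.coe_iSup] using this

lemma isCompact_top : IsCompact ((⊤ : Opens (OpenPrime A)) : Set (OpenPrime A)) := by
  obtain ⟨J, hJ⟩ := AdmissibleRing.exists_isIdealOfDefinition (A := A)
  have := isCompact_spfBasicOpen ⟨J, hJ.isOpen⟩ hJ.le_asIdeal (1 : A)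
  have e : spfBasicOpen A 1 = ⊤ := by
    ext x
    simp [spfBasicOpen]
  rwa [e] at this

/-- Every neighbourhood of zero contains the sections which vanish modulo `I`, for some `I`. -/
lemma exists_eval_subset {U : Opens (OpenPrime A)} {N : Set (spfSections A U)} (hN : N ∈ @nhds _ (spfTopology A U) 0) :
    ∃ I : OpenIdeal A, ∀ s : spfSections A U, s.1 I = 0 → s ∈ N := by
  let F (I : OpenIdeal A) : Filter (spfSections A U) := Filter.principal {s | s.1 I = 0}
  have hF : Directed (· ≥ ·) F := fun I J => ⟨⟨I.1 ⊓ J.1, I.2.inter J.2⟩, by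
    refine ⟨Filter.principal_mono.mpr fun s hs => ?_, Filter.principal_mono.mpr fun s hs => ?_⟩
    · have := s.2 ⟨I.1 ⊓ J.1, I.2.inter J.2⟩ I inf_le_left
      rw [hs, map_zero] at this
      exact this.symm
    · have := s.2 ⟨I.1 ⊓ J.1, I.2.inter J.2⟩ J inf_le_right
      rw [hs, map_zero] at this
      exact this.symm⟩
  have hne : Nonempty (OpenIdeal A) := ⟨⟨⊤, by simp⟩⟩
  have h : ⨅ I, F I ≤ @nhds _ (spfTopology A U) 0 := by
    simp only [nhds_iInf]
    refine le_iInf fun I => le_iInf fun V => le_iInf fun hV => le_iInf fun _ => ?_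
    refine iInf_le_of_le I ?_
    let _ : TopologicalSpace (Sec I V) := ⊥
    have : DiscreteTopology (Sec I V) := ⟨rfl⟩
    rw [nhds_induced, nhds_discrete, Filter.comap_pure]
    refine Filter.principal_mono.mpr fun s hs => ?_
    have hs : s.1 I = 0 := hs
    exact (congrArg (res I hV) hs)
  have := h hN
  rw [Filter.mem_iInf_of_directed hF] at this
  obtain ⟨I, hI⟩ := this
  exact ⟨I, fun s hs => hI hs⟩

lemma isOpen_eval_eq_zero {U : Opens (OpenPrime A)} (hU : IsCompact (U : Set (OpenPrime A)))
    (I : OpenIdeal A) : @IsOpen _ (spfTopology A U) {s : spfSections A U | s.1 I = 0} := by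
  let _ : TopologicalSpace (Sec I U) := ⊥
  have : DiscreteTopology (Sec I U) := ⟨rfl⟩
  let _ := spfTopology A U
  exact (isOpen_discrete ({0} : Set (Sec I U))).preimage (continuous_res_eval U I le_rfl hU)

lemma isUnit_germ_toSec (U : Opens (OpenPrime A)) (x : OpenPrime A) (hx : x ∈ U) (a : A) :
    IsUnit ((spfPresheaf A).germ U x hx (toSec U a)) ↔ a ∉ x.1.asIdeal := by
  obtain ⟨J, hJ⟩ := AdmissibleRing.exists_isIdealOfDefinition (A := A)
  obtain ⟨r, rfl⟩ := exists_specToOpenPrime_eq ⟨J, hJ.isOpen⟩ x (hJ.le_asIdeal x)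
  exact (isUnit_germ_spf_iff U _ _ r hx).trans (isUnit_germ_toSSec _ r hx _)

lemma isUnit_toSec (a : A) (U : Opens (OpenPrime A)) (hU : U ≤ spfBasicOpen A a) :
    IsUnit (toSec U a) :=
  isUnit_of_forall _ _ fun _ => isUnit_toSSec _ _ fun _ hx => hU hx

/-- The inverse image of an open ideal. -/
def comapIdeal (φ : A →+* B) (hφ : Continuous φ) (K : OpenIdeal B) : OpenIdeal A :=
  ⟨K.1.comap φ, K.2.preimage hφ⟩

lemma comapIdeal_mono (φ : A →+* B) (hφ : Continuous φ) {K L : OpenIdeal B} (h : K.1 ≤ L.1) :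
    (comapIdeal φ hφ K).1 ≤ (comapIdeal φ hφ L).1 :=
  Ideal.comap_mono h

/-- The map on open primes given by a continuous ring homomorphism. -/
def spfBase (φ : A →+* B) (hφ : Continuous φ) : C(OpenPrime B, OpenPrime A) where
  toFun p := ⟨PrimeSpectrum.comap φ p.1, p.2.preimage hφ⟩
  continuous_toFun :=
    Continuous.subtype_mk ((PrimeSpectrum.continuous_comap φ).comp continuous_subtype_val) _

/-- The homomorphism between quotients by open ideals given by a continuous ring homomorphism. -/
abbrev quotMap (φ : A →+* B) (hφ : Continuous φ) (K : OpenIdeal B) :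
    A ⧸ (comapIdeal φ hφ K).1 →+* B ⧸ K.1 :=
  Ideal.quotientMap K.1 φ le_rfl

lemma specToOpenPrime_comap (φ : A →+* B) (hφ : Continuous φ) (K : OpenIdeal B)
    (q : PrimeSpectrum (B ⧸ K.1)) :
    specToOpenPrime (comapIdeal φ hφ K) (PrimeSpectrum.comap (quotMap φ hφ K) q) =
      spfBase φ hφ (specToOpenPrime K q) := rfl

lemma preim_comap_le (φ : A →+* B) (hφ : Continuous φ) (K : OpenIdeal B)
    {U : Opens (OpenPrime A)} {V : Opens (OpenPrime B)} (h : V ≤ Opens.comap (spfBase φ hφ) U) :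
    (preim K V).1 ⊆ PrimeSpectrum.comap (quotMap φ hφ K) ⁻¹' (preim (comapIdeal φ hφ K) U).1 :=
  fun _ hq => h hq

/-- The map on sections given by a continuous ring homomorphism, at the level of an open ideal. -/
def quotSec (φ : A →+* B) (hφ : Continuous φ) (K : OpenIdeal B) (U : Opens (OpenPrime A))
    (V : Opens (OpenPrime B)) (h : V ≤ Opens.comap (spfBase φ hφ) U) :
    Sec (comapIdeal φ hφ K) U →+* Sec K V :=
  StructureSheaf.comap (quotMap φ hφ K) (preim (comapIdeal φ hφ K) U) (preim K V)
    (preim_comap_le φ hφ K h)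

lemma res_quotSec (φ : A →+* B) (hφ : Continuous φ) (K : OpenIdeal B) {U U' : Opens (OpenPrime A)}
    {V V' : Opens (OpenPrime B)} (h : V ≤ Opens.comap (spfBase φ hφ) U)
    (h' : V' ≤ Opens.comap (spfBase φ hφ) U') (hU : U' ≤ U) (hV : V' ≤ V)
    (s : Sec (comapIdeal φ hφ K) U) :
    res K hV (quotSec φ hφ K U V h s) = quotSec φ hφ K U' V' h' (res _ hU s) := rfl

lemma trans_quotSec (φ : A →+* B) (hφ : Continuous φ) {K L : OpenIdeal B} (hKL : K.1 ≤ L.1)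
    {U : Opens (OpenPrime A)} {V : Opens (OpenPrime B)} (h : V ≤ Opens.comap (spfBase φ hφ) U)
    (s : Sec (comapIdeal φ hφ K) U) :
    trans hKL V (quotSec φ hφ K U V h s) = quotSec φ hφ L U V h
      (trans (comapIdeal_mono φ hφ hKL) U s) := by
  have e : (Ideal.Quotient.factor hKL).comp (quotMap φ hφ K) = (quotMap φ hφ L).comp
      (Ideal.Quotient.factor (comapIdeal_mono φ hφ hKL)) := by
    ext; rfl
  refine (comap_comap _ _ _ _ _ _ _ (fun _ hq => h hq) s).trans
    ((comap_congr e _ _ _ (fun _ hq => h hq) s).trans ?_)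
  exact (comap_comap _ _ _ _ _ _ _ _ s).symm

/-- The map on sections of formal spectra given by a continuous ring homomorphism. -/
def spfMapSec (φ : A →+* B) (hφ : Continuous φ) (U : Opens (OpenPrime A))
    (V : Opens (OpenPrime B)) (h : V ≤ Opens.comap (spfBase φ hφ) U) :
    spfSections A U →+* spfSections B V where
  toFun s := ⟨fun K => quotSec φ hφ K U V h (s.1 (comapIdeal φ hφ K)), fun K L hKL => by
    exact (trans_quotSec φ hφ hKL h _).trans (congrArg _ (s.2 _ _ _))⟩
  map_one' := Subtype.ext (funext fun K => map_one (quotSec φ hφ K U V h))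
  map_mul' _ _ := Subtype.ext (funext fun K => map_mul (quotSec φ hφ K U V h) _ _)
  map_zero' := Subtype.ext (funext fun K => map_zero (quotSec φ hφ K U V h))
  map_add' _ _ := Subtype.ext (funext fun K => map_add (quotSec φ hφ K U V h) _ _)

lemma spfMapSec_spfRes (φ : A →+* B) (hφ : Continuous φ) {U U' : Opens (OpenPrime A)}
    {V V' : Opens (OpenPrime B)} (h : V ≤ Opens.comap (spfBase φ hφ) U)
    (h' : V' ≤ Opens.comap (spfBase φ hφ) U') (hU : U' ≤ U) (hV : V' ≤ V)
    (s : spfSections A U) : spfMapSec φ hφ U' V' h' (spfRes A hU s) =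
      spfRes B hV (spfMapSec φ hφ U V h s) :=
  Subtype.ext (funext fun K => (res_quotSec φ hφ K h h' hU hV _).symm)

lemma isUnit_germ_of_spfMapSec (φ : A →+* B) (hφ : Continuous φ) (U : Opens (OpenPrime A))
    (x : OpenPrime B) (hx : spfBase φ hφ x ∈ U) (s : spfSections A U)
    (hs : IsUnit ((spfPresheaf B).germ (Opens.comap (spfBase φ hφ) U) x hx
      (spfMapSec φ hφ U _ le_rfl s))) :
    IsUnit ((spfPresheaf A).germ U (spfBase φ hφ x) hx s) := by
  obtain ⟨J, hJ⟩ := AdmissibleRing.exists_isIdealOfDefinition (A := B)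
  obtain ⟨r, rfl⟩ := exists_specToOpenPrime_eq ⟨J, hJ.isOpen⟩ x (hJ.le_asIdeal x)
  have h1 := (isUnit_germ_spf_iff (Opens.comap (spfBase φ hφ) U) (spfMapSec φ hφ U _ le_rfl s)
    ⟨J, hJ.isOpen⟩ r hx).mp hs
  let K := comapIdeal φ hφ ⟨J, hJ.isOpen⟩
  let r' : PrimeSpectrum (A ⧸ K.1) := PrimeSpectrum.comap (quotMap φ hφ ⟨J, hJ.isOpen⟩) r
  have hr' : r' ∈ preim K U := hx
  have h2 : IsUnit ((Spec.structureSheaf (A ⧸ K.1)).presheaf.germ (preim K U) r' hr' (s.1 K)) :=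
    (isUnit_germ_comap (quotMap φ hφ ⟨J, hJ.isOpen⟩) (preim K U)
    (preim ⟨J, hJ.isOpen⟩ (Opens.comap (spfBase φ hφ) U)) (preim_comap_le φ hφ _ le_rfl) (s.1 K) r hx).mp h1
  have h3 := (isUnit_germ_spf_iff U s K r' hr').mpr h2
  exact (isUnit_germ_congr_point (X := (Spf A).toLocallyRingedSpace) s
    (specToOpenPrime_comap φ hφ ⟨J, hJ.isOpen⟩ r) hr' hx).mp h3

/-- The morphism of formal spectra given by a continuous ring homomorphism. -/
def Spf.map (φ : A →+* B) (hφ : Continuous φ) : Spf B ⟶ Spf A where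
  toLRS := lrsHomMk (X := (Spf B).toLocallyRingedSpace) (Y := (Spf A).toLocallyRingedSpace)
    (spfBase φ hφ) (fun U => spfMapSec φ hφ U _ le_rfl)
    (fun _ _ h s => spfMapSec_spfRes φ hφ _ _ h _ s)
    (fun U x hx s hs => isUnit_germ_of_spfMapSec φ hφ U x hx s hs)
  continuous U := by
    refine continuous_iInf_rng.mpr fun K => continuous_iInf_rng.mpr fun V =>
      continuous_iInf_rng.mpr fun hV => continuous_iInf_rng.mpr fun hc => continuous_induced_rng.mpr ?_
    obtain ⟨W, hWU, hW, hVW⟩ := exists_isCompact_between (spfBase φ hφ) hc hV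
    let _ : TopologicalSpace (Sec (comapIdeal φ hφ K) W) := ⊥
    have : DiscreteTopology (Sec (comapIdeal φ hφ K) W) := ⟨rfl⟩
    let _ : TopologicalSpace (Sec K V) := ⊥
    let _ := spfTopology A U
    have h1 := continuous_res_eval U (comapIdeal φ hφ K) hWU hW
    exact (continuous_of_discreteTopology (f := quotSec φ hφ K W V hVW)).comp h1

lemma spfMapSec_toSec (φ : A →+* B) (hφ : Continuous φ) (U : Opens (OpenPrime A))
    (V : Opens (OpenPrime B)) (h : V ≤ Opens.comap (spfBase φ hφ) U) (a : A) :
    spfMapSec φ hφ U V h (toSec U a) = toSec V (φ a) :=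
  Subtype.ext (funext fun _ => comap_toSSec _ _ _ _ _)

end Spf

/-! ### Morphisms of formal spectra and continuous homomorphisms -/

section Affine

variable {A B C : Type u} [CommRing A] [TopologicalSpace A] [AdmissibleRing A]
  [CommRing B] [TopologicalSpace B] [AdmissibleRing B]
  [CommRing C] [TopologicalSpace C] [AdmissibleRing C]

lemma toSSec_top_injective (I : OpenIdeal A) :
    Function.Injective (toSSec (R := A ⧸ I.1) (preim I ⊤)) := toSSec_top_bijective.1

lemma toSec_top_eval_eq_zero (a : A) (I : OpenIdeal A) :
    (toSec ⊤ a).1 I = 0 ↔ a ∈ I.1 := by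
  rw [← Ideal.Quotient.eq_zero_iff_mem, ← map_eq_zero_iff _ (toSSec_top_injective I)]
  rfl

/-- The ring of global sections of `Spf A` is `A`. -/
lemma toSec_top_bijective : Function.Bijective (toSec (A := A) ⊤) := by
  constructor
  · rw [injective_iff_map_eq_zero]
    intro a ha
    refine eq_zero_of_forall_mem_openIdeal a fun I => ?_
    rw [← toSec_top_eval_eq_zero, ha]
    rfl
  · intro s
    have h (I : OpenIdeal A) : ∃ a : A, toSSec (preim I ⊤) (Ideal.Quotient.mk I.1 a) = s.1 I := by
      obtain ⟨b, hb⟩ := toSSec_top_bijective.2 (s.1 I)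
      obtain ⟨a, rfl⟩ := Ideal.Quotient.mk_surjective b
      exact ⟨a, hb⟩
    choose a ha using h
    obtain ⟨x, hx⟩ := exists_of_compatible a fun I J hIJ => by
      rw [← Ideal.Quotient.eq_zero_iff_mem, map_sub, sub_eq_zero]
      refine toSSec_top_injective J (Eq.trans ?_ (ha J).symm)
      rw [← s.2 I J hIJ, ← ha I]
      exact (comap_toSSec (Ideal.Quotient.factor hIJ) (preim I ⊤) (preim J ⊤) (fun _ hp => hp)
        (Ideal.Quotient.mk I.1 (a I))).symm
    refine ⟨x, Subtype.ext (funext fun I => Eq.trans ?_ (ha I))⟩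
    refine congrArg (toSSec (R := A ⧸ I.1) (preim I ⊤)) ?_
    rw [← sub_eq_zero, ← map_sub, Ideal.Quotient.eq_zero_iff_mem]
    exact hx I

lemma continuous_toSec (U : Opens (OpenPrime A)) :
    @Continuous _ _ _ (spfTopology A U) (toSec (A := A) U) := by
  let _ := spfTopology A U
  have := spfTopology_isTopologicalRing A U
  refine continuous_of_continuousAt_zero (toSec U) ?_
  rw [ContinuousAt, map_zero]
  intro N hN
  obtain ⟨I, hI⟩ := exists_eval_subset hN
  refine Filter.mem_map.mpr (Filter.mem_of_superset (I.2.mem_nhds I.1.zero_mem) fun a ha => hI _ ?_)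
  rw [toSec_apply, Ideal.Quotient.eq_zero_iff_mem.mpr ha, map_zero]

/-- Together with `continuous_toSec`, this says that the topology of `A` is induced from the topology of the
global sections of `Spf A`. -/
lemma continuous_of_comp_toSec {R : Type*} [CommRing R] [TopologicalSpace R] [IsTopologicalRing R]
    (φ : R →+* A)
    (h : @Continuous _ _ _ (spfTopology A ⊤) fun r => toSec (⊤ : Opens (OpenPrime A)) (φ r)) :
    Continuous φ := by
  refine continuous_of_continuousAt_zero φ ?_
  rw [ContinuousAt, map_zero]
  intro N hN
  obtain ⟨I, hI⟩ := exists_openIdeal_subset hN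
  let _ := spfTopology A ⊤
  refine Filter.mem_map.mpr (Filter.mem_of_superset
    (((isOpen_eval_eq_zero isCompact_top I).preimage h).mem_nhds ?_) fun r hr => hI ?_)
  · simp only [Set.mem_preimage, map_zero]
    rfl
  · exact (toSec_top_eval_eq_zero _ I).mp hr

/-- Continuous homomorphisms from sections over a basic open set to a discrete ring are determined by
the images of the elements of `A`. -/
lemma ringHom_ext_of_continuous {S : Type*} [CommRing S] [TopologicalSpace S] [DiscreteTopology S]
    (a : A) (F G : spfSections A (spfBasicOpen A a) →+* S)
    (hF : @Continuous _ _ (spfTopology A _) _ F) (hG : @Continuous _ _ (spfTopology A _) _ G)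
    (h : ∀ r, F (toSec _ r) = G (toSec _ r)) : F = G := by
  let _ := spfTopology A (spfBasicOpen A a)
  have h0 (H : spfSections A (spfBasicOpen A a) →+* S) (hH : Continuous H) : H ⁻¹' {0} ∈ 𝓝 0 :=
    ((isOpen_discrete {0}).preimage hH).mem_nhds (map_zero H)
  obtain ⟨I, hI⟩ := exists_eval_subset (Filter.inter_mem (h0 F hF) (h0 G hG))
  ext s
  obtain ⟨n, r, hr⟩ := exists_toSSec_eq (Ideal.Quotient.mk I.1 a) (preim I (spfBasicOpen A a))
    (fun x => Iff.rfl) (s.1 I)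
  obtain ⟨r, rfl⟩ := Ideal.Quotient.mk_surjective r
  have h1 := hI (toSec _ (a ^ n) * s - toSec _ r) (by
    refine (sub_eq_zero (a := toSSec _ _ * s.1 I) (b := toSSec _ _)).mpr (Eq.trans ?_ hr)
    rw [map_pow])
  have hFs : F (toSec _ (a ^ n)) * F s = F (toSec _ r) := by
    rw [← map_mul, ← sub_eq_zero, ← map_sub]; exact h1.1
  have hGs : G (toSec _ (a ^ n)) * G s = G (toSec _ r) := by
    rw [← map_mul, ← sub_eq_zero, ← map_sub]; exact h1.2
  have hu : IsUnit (F (toSec (spfBasicOpen A a) (a ^ n))) := by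
    rw [map_pow]
    exact ((isUnit_toSec a _ le_rfl).pow n).map F
  refine hu.mul_left_cancel ?_
  rw [hFs, h r, h (a ^ n), hGs]

lemma continuous_eval_appLE (f : Spf B ⟶ Spf A) (U : Opens (OpenPrime A)) (V : Opens (OpenPrime B))
    (h : V ≤ (Opens.map f.toLRS.base).obj U) (hV : IsCompact (V : Set (OpenPrime B)))
    (K : OpenIdeal B) : @Continuous _ _ (spfTopology A U) ⊥
      ((evalSec V K).comp (appLE f.toLRS U V h)) :=
  @Continuous.comp _ _ _ (spfTopology A U) (spfTopology B V) ⊥ _ _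
    (continuous_res_eval V K le_rfl hV) (TopLocallyRingedSpace.continuous_appLE f U V h)

/-- Morphisms of formal spectra are determined by their effect on global sections. -/
theorem spfHom_ext (f g : Spf B ⟶ Spf A)
    (h : ∀ a : A, appLE f.toLRS ⊤ ⊤ le_top (toSec ⊤ a) = appLE g.toLRS ⊤ ⊤ le_top (toSec ⊤ a)) :
    f = g := by
  obtain ⟨J, hJ⟩ := AdmissibleRing.exists_isIdealOfDefinition (A := B)
  have hsec (U : Opens (OpenPrime A)) (V : Opens (OpenPrime B))
      (hf : V ≤ (Opens.map f.toLRS.base).obj U) (hg : V ≤ (Opens.map g.toLRS.base).obj U) (a : A) :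
      appLE f.toLRS U V hf (toSec U a) = appLE g.toLRS U V hg (toSec U a) := by
    have h1 := congrArg (secRes (Spf B).toLocallyRingedSpace (le_top : V ≤ ⊤)) (h a)
    refine (appLE_secRes f.toLRS (U := ⊤) le_top hf (toSec ⊤ a)).trans (Eq.trans ?_
      (appLE_secRes g.toLRS (U := ⊤) le_top hg (toSec ⊤ a)).symm)
    refine (secRes_appLE f.toLRS (U := ⊤) (V := ⊤) le_top le_top _).symm.trans (h1.trans ?_)
    exact secRes_appLE g.toLRS (U := ⊤) (V := ⊤) le_top le_top _
  have hmem (f : Spf B ⟶ Spf A) (x : OpenPrime B) (a : A) :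
      a ∉ (show OpenPrime A from f.toLRS.base x).1.asIdeal ↔
        IsUnit (((Spf B).presheaf.germ ⊤ x trivial).hom (appLE f.toLRS ⊤ ⊤ le_top (toSec ⊤ a))) :=
    ((isUnit_germ_appLE f.toLRS ⊤ ⊤ le_top x trivial (toSec ⊤ a)).trans
      (isUnit_germ_toSec ⊤ _ trivial a)).symm
  -- the point `f x` is recovered from the elements of `A` which become invertible at `x`
  have hb (x : OpenPrime B) : f.toLRS.base x = g.toLRS.base x := by
    refine Subtype.ext (PrimeSpectrum.ext (Ideal.ext fun a => not_iff_not.mp ?_))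
    exact (hmem f x a).trans ((h a) ▸ (hmem g x a).symm)
  refine TopLocallyRingedSpace.hom_ext (lrsHom_ext _ _ hb fun U x hx s => ?_)
  obtain ⟨a, ha, haU⟩ := exists_spfBasicOpen U (f.toLRS.base x) hx
  obtain ⟨b, hb1, hb2⟩ := exists_spfBasicOpen ((Opens.map f.toLRS.base).obj (spfBasicOpen A a)) x ha
  have hf : spfBasicOpen B b ≤ (Opens.map f.toLRS.base).obj (spfBasicOpen A a) := hb2
  have hg : spfBasicOpen B b ≤ (Opens.map g.toLRS.base).obj (spfBasicOpen A a) := fun y hy =>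
    Eq.mp (congrArg (fun z => z ∈ (spfBasicOpen A a : Opens (Spf A).toTopCat)) (hb y)) (hb2 hy)
  refine ⟨spfBasicOpen B b, hb1, le_map_of_le _ haU hf, le_map_of_le _ haU hg, ?_⟩
  refine (appLE_secRes f.toLRS haU hf s).symm.trans (Eq.trans ?_ (appLE_secRes g.toLRS haU hg s))
  refine Subtype.ext (funext fun K => ?_)
  have hc := isCompact_spfBasicOpen ⟨J, hJ.isOpen⟩ hJ.le_asIdeal b
  let _ : TopologicalSpace (Sec K (spfBasicOpen B b)) := ⊥
  have : DiscreteTopology (Sec K (spfBasicOpen B b)) := ⟨rfl⟩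
  exact congrArg (fun F : _ →+* _ => F (secRes (Spf A).toLocallyRingedSpace haU s))
    (ringHom_ext_of_continuous a ((evalSec _ K).comp (appLE f.toLRS _ _ hf))
      ((evalSec _ K).comp (appLE g.toLRS _ _ hg)) (continuous_eval_appLE f _ _ hf hc K)
      (continuous_eval_appLE g _ _ hg hc K)
      fun r => congrArg (evalSec _ K) (hsec _ _ hf hg r))

lemma spfMap_ext {φ ψ : A →+* B} (h : φ = ψ) (hφ : Continuous φ) (hψ : Continuous ψ) :
    Spf.map φ hφ = Spf.map ψ hψ := by
  subst h; rfl

lemma spfMap_comp (φ : A →+* B) (hφ : Continuous φ) (ψ : B →+* C) (hψ : Continuous ψ) :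
    Spf.map ψ hψ ≫ Spf.map φ hφ = Spf.map (ψ.comp φ) (hψ.comp hφ) := by
  refine spfHom_ext _ _ fun a => ?_
  refine (appLE_comp (Spf.map ψ hψ).toLRS (Spf.map φ hφ).toLRS (V := ⊤) le_top le_top _).symm.trans ?_
  exact (congrArg (spfMapSec ψ hψ ⊤ ⊤ le_top) (spfMapSec_toSec φ hφ ⊤ ⊤ le_top a)).trans
    ((spfMapSec_toSec ψ hψ ⊤ ⊤ le_top (φ a)).trans
      (spfMapSec_toSec (ψ.comp φ) (hψ.comp hφ) ⊤ ⊤ le_top a).symm)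

/-- Every morphism of formal spectra is given by a continuous ring homomorphism. -/
theorem exists_spfMap_eq (f : Spf B ⟶ Spf A) : ∃ (φ : A →+* B) (hφ : Continuous φ), Spf.map φ hφ = f := by
  let e := RingEquiv.ofBijective (toSec (A := B) ⊤) toSec_top_bijective
  let φ : A →+* B := e.symm.toRingHom.comp ((appLE f.toLRS ⊤ ⊤ le_top).comp (toSec ⊤))
  have h (a : A) : toSec ⊤ (φ a) = appLE f.toLRS ⊤ ⊤ le_top (toSec ⊤ a) := e.apply_symm_apply _
  have hφ : Continuous φ := by
    refine continuous_of_comp_toSec φ ?_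
    simp only [h]
    exact @Continuous.comp _ _ _ _ (spfTopology A ⊤) (spfTopology B ⊤) _ _
      (TopLocallyRingedSpace.continuous_appLE f ⊤ ⊤ le_top) (continuous_toSec ⊤)
  exact ⟨φ, hφ, spfHom_ext _ _ fun a => (spfMapSec_toSec φ hφ ⊤ ⊤ le_top a).trans (h a)⟩

lemma spfMap_injective {φ ψ : A →+* B} (hφ : Continuous φ) (hψ : Continuous ψ)
    (h : Spf.map φ hφ = Spf.map ψ hψ) : φ = ψ := by
  ext a
  refine toSec_top_bijective.1 ?_
  refine (spfMapSec_toSec φ hφ ⊤ ⊤ le_top a).symm.trans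
    (Eq.trans ?_ (spfMapSec_toSec ψ hψ ⊤ ⊤ le_top a))
  exact appLE_congr (congrArg TopLocallyRingedSpace.Hom.toLRS h) (U := ⊤) (V := ⊤) le_top (toSec ⊤ a)

end Affine

/-! ### Localization of admissible rings -/

section SpecLocalization

variable {R S : Type u} [CommRing R] [CommRing S]

lemma isOpenImmersion_specMap (ψ : R →+* S) (f : R)
    (h : letI := ψ.toAlgebra; IsLocalization.Away f S) :
    LocallyRingedSpace.IsOpenImmersion (SpecL.map ψ) := by
  let _ := ψ.toAlgebra
  exact IsOpenImmersion.of_isLocalization (R := R) (S := S) f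

lemma range_comap_of_away (ψ : R →+* S) (f : R)
    (h : letI := ψ.toAlgebra; IsLocalization.Away f S) (x : PrimeSpectrum R) (hx : f ∉ x.asIdeal) :
    ∃ y, PrimeSpectrum.comap ψ y = x := by
  let _ := ψ.toAlgebra
  have : x ∈ Set.range (PrimeSpectrum.comap (algebraMap R S)) := by
    rw [PrimeSpectrum.localization_away_comap_range S f]
    exact hx
  exact this

lemma comap_bijective_of_away (ψ : R →+* S) (f : R)
    (h : letI := ψ.toAlgebra; IsLocalization.Away f S) (U : Opens (PrimeSpectrum.Top R))
    (V : Opens (PrimeSpectrum.Top S)) (hU : ∀ x ∈ U, f ∉ x.asIdeal)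
    (hV : ∀ y, y ∈ V ↔ PrimeSpectrum.comap ψ y ∈ U) :
    Function.Bijective (StructureSheaf.comap ψ U V fun y => (hV y).mp) := by
  have := isOpenImmersion_specMap ψ f h
  exact appLE_bijective (SpecL.map ψ) U V (fun x hx => range_comap_of_away ψ f h x (hU x hx)) hV

end SpecLocalization

section Localization

variable {A B : Type u} [CommRing A] [TopologicalSpace A] [AdmissibleRing A]
  [CommRing B] [TopologicalSpace B] [AdmissibleRing B]

/-- The homomorphism `φ` exhibits `B` as the completed localization of `A` away from `a`: for every
open ideal `I` of `A`, there is an open ideal `K` of `B` for which `φ` identifies the localization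
of `A / I` away from `a` with `B / K`, and these ideals `K` are cofinal. -/
structure IsTopLocalization (a : A) (φ : A →+* B) : Prop where
  continuous : Continuous φ
  isUnit : IsUnit (φ a)
  exists_approx (K : OpenIdeal B) (b : B) : ∃ (n : ℕ) (r : A), φ (a ^ n) * b - φ r ∈ K.1
  exists_openIdeal (I : OpenIdeal A) : ∃ K : OpenIdeal B, ∀ r, φ r ∈ K.1 ↔ ∃ n : ℕ, a ^ n * r ∈ I.1

namespace IsTopLocalization

variable {a : A} {φ : A →+* B} (h : IsTopLocalization a φ)

include h

lemma mul_mem_iff (K : Ideal B) (n : ℕ) (b : B) : φ (a ^ n) * b ∈ K ↔ b ∈ K := by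
  rw [map_pow]
  exact Ideal.unit_mul_mem_iff_mem K (h.isUnit.pow n)

/-- Open ideals of `B` are determined by their inverse images in `A`. -/
lemma le_of_forall {K L : Ideal B} (hK : IsOpen (K : Set B)) (hL : IsOpen (L : Set B))
    (hKL : ∀ r, φ r ∈ K → φ r ∈ L) : K ≤ L := by
  intro b hb
  obtain ⟨n, r, hr⟩ := h.exists_approx ⟨K ⊓ L, hK.inter hL⟩ b
  have h1 : φ r ∈ L := hKL r (by
    have := K.sub_mem (K.mul_mem_left (φ (a ^ n)) hb) hr.1
    rwa [sub_sub_cancel] at this)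
  have := L.add_mem hr.2 h1
  rw [sub_add_cancel] at this
  exact (h.mul_mem_iff L n b).mp this

/-- The open ideal of `B` corresponding to the localization of `A / I`. -/
def extend (I : OpenIdeal A) : OpenIdeal B := (h.exists_openIdeal I).choose

lemma map_mem_extend (I : OpenIdeal A) (r : A) :
    φ r ∈ (h.extend I).1 ↔ ∃ n : ℕ, a ^ n * r ∈ I.1 := (h.exists_openIdeal I).choose_spec r

lemma extend_mono {I J : OpenIdeal A} (hIJ : I.1 ≤ J.1) : (h.extend I).1 ≤ (h.extend J).1 := by
  refine h.le_of_forall (h.extend I).2 (h.extend J).2 fun r hr => ?_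
  rw [map_mem_extend] at hr ⊢
  obtain ⟨n, hn⟩ := hr
  exact ⟨n, hIJ hn⟩

lemma le_comap_extend (I : OpenIdeal A) : I.1 ≤ (h.extend I).1.comap φ := fun r hr =>
  (h.map_mem_extend I r).mpr ⟨0, by simpa using hr⟩

lemma extend_le (K : OpenIdeal B) : (h.extend (comapIdeal φ h.continuous K)).1 ≤ K.1 := by
  refine h.le_of_forall (h.extend _).2 K.2 fun r hr => ?_
  obtain ⟨n, hn⟩ := (h.map_mem_extend _ r).mp hr
  have : φ (a ^ n * r) ∈ K.1 := hn
  rwa [map_mul, h.mul_mem_iff] at this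

lemma exists_extend_subset {V : Set B} (hV : V ∈ 𝓝 0) : ∃ I, ((h.extend I).1 : Set B) ⊆ V := by
  obtain ⟨K, hK⟩ := exists_openIdeal_subset hV
  exact ⟨_, fun _ hb => hK (h.extend_le K hb)⟩

/-- The map from `A / I` to the quotient of `B` which is its localization away from `a`. -/
abbrev quot (I : OpenIdeal A) : A ⧸ I.1 →+* B ⧸ (h.extend I).1 :=
  Ideal.quotientMap _ φ (h.le_comap_extend I)

lemma away_quot (I : OpenIdeal A) : letI := (h.quot I).toAlgebra
    IsLocalization.Away (Ideal.Quotient.mk I.1 a) (B ⧸ (h.extend I).1) := by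
  let _ := (h.quot I).toAlgebra
  refine ⟨?_, fun z => ?_, fun {x y} hxy => ?_⟩
  · rintro ⟨_, n, rfl⟩
    change IsUnit (h.quot I (Ideal.Quotient.mk I.1 a ^ n))
    rw [map_pow]
    exact (h.isUnit.map (Ideal.Quotient.mk _)).pow n
  · obtain ⟨b, rfl⟩ := Ideal.Quotient.mk_surjective z
    obtain ⟨n, r, hr⟩ := h.exists_approx (h.extend I) b
    refine ⟨⟨Ideal.Quotient.mk I.1 r, ⟨_, n, rfl⟩⟩, ?_⟩
    rw [mul_comm]
    exact (Ideal.Quotient.mk_eq_mk_iff_sub_mem (φ (a ^ n) * b) (φ r)).mpr hr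
  · obtain ⟨x, rfl⟩ := Ideal.Quotient.mk_surjective x
    obtain ⟨y, rfl⟩ := Ideal.Quotient.mk_surjective y
    have h1 : φ (x - y) ∈ (h.extend I).1 := by
      rw [map_sub]
      exact (Ideal.Quotient.mk_eq_mk_iff_sub_mem (φ x) (φ y)).mp hxy
    obtain ⟨n, hn⟩ := (h.map_mem_extend I _).mp h1
    refine ⟨⟨_, n, rfl⟩, (Ideal.Quotient.mk_eq_mk_iff_sub_mem (a ^ n * x) (a ^ n * y)).mpr ?_⟩
    rwa [← mul_sub]

lemma mem_spfBase_iff (x : OpenPrime B) (r : A) :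
    r ∈ (spfBase φ h.continuous x).1.asIdeal ↔ φ r ∈ x.1.asIdeal := Iff.rfl

lemma spfBase_injective : Function.Injective (spfBase φ h.continuous) := by
  have key (x y : OpenPrime B) (hxy : spfBase φ h.continuous x = spfBase φ h.continuous y) :
      x.1.asIdeal ≤ y.1.asIdeal :=
    h.le_of_forall x.2 y.2 fun r hr => by
      rw [← h.mem_spfBase_iff] at hr ⊢
      rwa [← hxy]
  exact fun x y hxy => Subtype.ext (PrimeSpectrum.ext (le_antisymm (key x y hxy) (key y x hxy.symm)))

/-- A prime `p` of `A` not containing `a` is the inverse image of the ideal extending it, which is prime since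
all elements of `B` are fractions up to elements of this ideal. -/
lemma mem_range_spfBase (x : OpenPrime A) :
    x ∈ Set.range (spfBase φ h.continuous) ↔ x ∈ spfBasicOpen A a := by
  constructor
  · rintro ⟨y, rfl⟩ (hy : φ a ∈ y.1.asIdeal)
    exact y.1.2.ne_top (Ideal.eq_top_of_isUnit_mem _ hy h.isUnit)
  · intro (hx : a ∉ x.1.asIdeal)
    let K := h.extend ⟨x.1.asIdeal, x.2⟩
    have hK (r : A) : φ r ∈ K.1 ↔ r ∈ x.1.asIdeal := by
      rw [h.map_mem_extend]
      refine ⟨fun ⟨n, hn⟩ => (x.1.2.mem_or_mem hn).resolve_left fun h' => hx (x.1.2.mem_of_pow_mem n h'),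
        fun hr => ⟨0, by simpa using hr⟩⟩
    have hmem (b : B) (n : ℕ) (r : A) (hr : φ (a ^ n) * b - φ r ∈ K.1) :
        b ∈ K.1 ↔ r ∈ x.1.asIdeal := by
      rw [← hK, ← h.mul_mem_iff K.1 n b]
      exact ⟨fun hb => by simpa using K.1.sub_mem hb hr, fun hb => by simpa using K.1.add_mem hr hb⟩
    have hprime : K.1.IsPrime := by
      refine ⟨fun htop => x.1.2.ne_top ((Ideal.eq_top_iff_one _).mpr ((hK 1).mp ?_)), fun {b c} hbc => ?_⟩
      · rw [htop]; trivial
      · obtain ⟨n, r, hr⟩ := h.exists_approx K b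
        obtain ⟨m, s, hs⟩ := h.exists_approx K c
        rw [hmem b n r hr, hmem c m s hs]
        refine x.1.2.mem_or_mem ((hmem (b * c) (n + m) (r * s) ?_).mp hbc)
        have e : φ (a ^ (n + m)) * (b * c) - φ (r * s) =
            (φ (a ^ n) * b - φ r) * (φ (a ^ m) * c) + φ r * (φ (a ^ m) * c - φ s) := by
          rw [pow_add, map_mul, map_mul]; ring
        rw [e]
        exact K.1.add_mem (K.1.mul_mem_right _ hr) (K.1.mul_mem_left _ hs)
    exact ⟨⟨⟨K.1, hprime⟩, K.2⟩, Subtype.ext (PrimeSpectrum.ext (Ideal.ext hK))⟩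

lemma isOpenEmbedding_spfBase : IsOpenEmbedding (spfBase φ h.continuous) := by
  obtain ⟨J, hJ⟩ := AdmissibleRing.exists_isIdealOfDefinition (A := B)
  refine ⟨⟨⟨le_antisymm (spfBase φ h.continuous).continuous.le_induced fun U hU => ?_⟩,
    h.spfBase_injective⟩, ?_⟩
  · refine (@isOpen_iff_forall_mem_open _ (_) U).mpr fun x hx => ?_
    obtain ⟨b, hb, hbU⟩ := exists_spfBasicOpen ⟨U, hU⟩ x hx
    obtain ⟨n, r, hr⟩ := h.exists_approx ⟨J, hJ.isOpen⟩ b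
    have e (y : OpenPrime B) : b ∈ y.1.asIdeal ↔ φ r ∈ y.1.asIdeal := by
      have hr' := hJ.le_asIdeal y hr
      rw [← h.mul_mem_iff y.1.asIdeal n b]
      exact ⟨fun hb => by simpa using y.1.asIdeal.sub_mem hb hr',
        fun hb => by simpa using y.1.asIdeal.add_mem hr' hb⟩
    refine ⟨spfBase φ h.continuous ⁻¹' spfBasicOpen A r, fun y hy => hbU ?_,
      ⟨_, (spfBasicOpen A r).2, rfl⟩, ?_⟩
    · exact fun hy' => hy ((e y).mp hy')
    · exact fun hx' => hb ((e x).mpr hx')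
  · have : Set.range (spfBase φ h.continuous) = spfBasicOpen A a := Set.ext h.mem_range_spfBase
    rw [this]
    exact (spfBasicOpen A a).2

section Sections

variable {U : Opens (OpenPrime A)} {V : Opens (OpenPrime B)}
  (hV : ∀ x, x ∈ V ↔ spfBase φ h.continuous x ∈ U)

/-- The isomorphism between sections of the structure sheaves of the spectra of `A / I` and its
localization. -/
def locSec (hV : ∀ x, x ∈ V ↔ spfBase φ h.continuous x ∈ U) (I : OpenIdeal A) :
    Sec I U →+* Sec (h.extend I) V :=
  StructureSheaf.comap (h.quot I) (preim I U) (preim (h.extend I) V) fun _ hq => (hV _).mp hq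

lemma locSec_bijective (hU : U ≤ spfBasicOpen A a) (I : OpenIdeal A) :
    Function.Bijective (h.locSec hV I) :=
  comap_bijective_of_away (h.quot I) _ (h.away_quot I) _ _ (fun _ hx => hU hx) fun _ => hV _

lemma trans_locSec {I J : OpenIdeal A} (hIJ : I.1 ≤ J.1) (s : Sec I U) :
    trans (h.extend_mono hIJ) V (h.locSec hV I s) = h.locSec hV J (trans hIJ U s) := by
  have e : (Ideal.Quotient.factor (h.extend_mono hIJ)).comp (h.quot I) =
      (h.quot J).comp (Ideal.Quotient.factor hIJ) := by
    ext; rfl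
  refine (comap_comap _ _ _ _ _ _ _ (fun _ hq => (hV _).mp hq) s).trans
    ((comap_congr e _ _ _ (fun _ hq => (hV _).mp hq) s).trans ?_)
  exact (comap_comap _ _ _ _ _ _ _ _ s).symm

lemma spfMapSec_extend (s : spfSections A U) (I : OpenIdeal A) :
    (spfMapSec φ h.continuous U V (fun x => (hV x).mp) s).1 (h.extend I) =
      h.locSec hV I (s.1 I) := by
  have e : (quotMap φ h.continuous (h.extend I)).comp
      (Ideal.Quotient.factor (h.le_comap_extend I)) = h.quot I := by
    ext; rfl
  have hs := s.2 I (comapIdeal φ h.continuous (h.extend I)) (h.le_comap_extend I)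
  refine (congrArg (quotSec φ h.continuous (h.extend I) U V fun x => (hV x).mp) hs).symm.trans ?_
  refine (comap_comap _ _ _ _ _ _ _ (fun _ hq => (hV _).mp hq) _).trans ?_
  exact comap_congr e _ _ _ (fun _ hq => (hV _).mp hq) _

lemma spfMapSec_bijective (hU : U ≤ spfBasicOpen A a) :
    Function.Bijective (spfMapSec φ h.continuous U V fun x => (hV x).mp) := by
  constructor
  · intro s t hst
    refine Subtype.ext (funext fun I => (h.locSec_bijective hV hU I).1 ?_)
    rw [← h.spfMapSec_extend, ← h.spfMapSec_extend, hst]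
  · intro t
    choose s hs using fun I => (h.locSec_bijective hV hU I).2 (t.1 (h.extend I))
    refine ⟨⟨s, fun I J hIJ => (h.locSec_bijective hV hU J).1 ?_⟩, Subtype.ext (funext fun K => ?_)⟩
    · rw [← h.trans_locSec, hs, hs, t.2]
    · rw [← t.2 _ K (h.extend_le K), ← hs]
      refine ((spfMapSec φ h.continuous U V _ _).2 _ K (h.extend_le K)).symm.trans ?_
      exact congrArg _ (h.spfMapSec_extend hV _ _)

lemma spfTopology_eq_induced (hU : U ≤ spfBasicOpen A a) : spfTopology A U =
    (spfTopology B V).induced (spfMapSec φ h.continuous U V fun x => (hV x).mp) := by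
  refine le_antisymm (continuous_iff_le_induced.mp
    (TopLocallyRingedSpace.continuous_appLE (Spf.map φ h.continuous) U V fun x => (hV x).mp)) ?_
  refine le_iInf fun I => le_iInf fun W => le_iInf fun hW => le_iInf fun hc => ?_
  rw [← continuous_iff_le_induced]
  let W' : Opens (OpenPrime B) := Opens.comap (spfBase φ h.continuous) W
  have hW' : W' ≤ V := fun x hx => (hV x).mpr (hW hx)
  have hWW (x) : x ∈ W' ↔ spfBase φ h.continuous x ∈ W := Iff.rfl
  have hc' : IsCompact (W' : Set (OpenPrime B)) := by
    rw [h.isOpenEmbedding_spfBase.isInducing.isCompact_iff]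
    have e : spfBase φ h.continuous '' (W' : Set (OpenPrime B)) = W := by
      refine Set.image_preimage_eq_of_subset fun x hx => ?_
      exact (h.mem_range_spfBase x).mpr (hU (hW hx))
    rw [e]; exact hc
  let _ : TopologicalSpace (Sec (h.extend I) W') := ⊥
  have : DiscreteTopology (Sec (h.extend I) W') := ⟨rfl⟩
  let _ : TopologicalSpace (Sec I W) := ⊥
  let _ := spfTopology B V
  let _ : TopologicalSpace (spfSections A U) :=
    (spfTopology B V).induced (spfMapSec φ h.continuous U V fun x => (hV x).mp)
  let e := Equiv.ofBijective _ (h.locSec_bijective hWW (hW.trans hU) I)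
  have h1 : Continuous fun s : spfSections A U =>
      e.symm (res (h.extend I) hW' ((spfMapSec φ h.continuous U V (fun x => (hV x).mp) s).1 (h.extend I))) :=
    (continuous_of_discreteTopology (f := e.symm)).comp
      ((continuous_res_eval V (h.extend I) hW' hc').comp continuous_induced_dom)
  convert! h1 using 1
  ext1 s
  rw [Equiv.eq_symm_apply, h.spfMapSec_extend hV]
  rfl

end Sections

/-- The morphism of formal spectra corresponding to a completed localization is an open immersion. -/
theorem isOpenImm : TopLocallyRingedSpace.IsOpenImm (Spf.map φ h.continuous) where
  lrs := isOpenImmersion_of_bijective _ h.isOpenEmbedding_spfBase fun _ _ hU hV =>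
    h.spfMapSec_bijective hV fun x hx => (h.mem_range_spfBase x).mp (hU hx)
  topology_eq _ _ hU hV :=
    h.spfTopology_eq_induced hV fun x hx => (h.mem_range_spfBase x).mp (hU hx)

/-- Completed localizations of noetherian adic rings are noetherian adic rings. -/
theorem isNoetherianAdicRing (hA : IsNoetherianAdicRing A) : IsNoetherianAdicRing B := by
  have := hA.isNoetherianRing
  obtain ⟨J, hJ⟩ := hA.exists_isAdic
  have hJ' := isAdic_iff.mp hJ
  let R := Localization.Away a
  let ψ : R →+* B := IsLocalization.Away.lift a h.isUnit
  have hψ (r : A) : ψ (algebraMap A R r) = φ r := IsLocalization.Away.lift_eq a h.isUnit r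
  let K (n : ℕ) : OpenIdeal B := h.extend ⟨J ^ n, hJ'.1 n⟩
  have hKmono : Antitone fun n => (K n).1 := fun m n hmn => h.extend_mono (Ideal.pow_le_pow_right hmn)
  have hKbasis : ∀ V ∈ 𝓝 (0 : B), ∃ n, ((K n).1 : Set B) ⊆ V := fun V hV => by
    obtain ⟨I, hI⟩ := h.exists_extend_subset hV
    obtain ⟨n, hn⟩ := hJ'.2 I.1 (I.2.mem_nhds I.1.zero_mem)
    exact ⟨n, fun _ hb => hI (h.extend_mono (I := ⟨J ^ n, hJ'.1 n⟩) (J := I) hn hb)⟩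
  have hmem (n : ℕ) (z : R) : ψ z ∈ (K n).1 ↔ z ∈ (J.map (algebraMap A R)) ^ n := by
    obtain ⟨⟨r, ⟨_, m, rfl⟩⟩, hr⟩ := IsLocalization.surj (Submonoid.powers a) z
    have hu : IsUnit (algebraMap A R (a ^ m)) :=
      IsLocalization.map_units R (⟨a ^ m, m, rfl⟩ : Submonoid.powers a)
    have e : φ (a ^ m) * ψ z = φ r := by
      rw [← hψ, ← hψ, ← map_mul, mul_comm, hr]
    rw [← h.mul_mem_iff _ m, e, h.map_mem_extend, ← Ideal.map_pow,
      ← Ideal.unit_mul_mem_iff_mem _ hu, mul_comm, hr,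
      IsLocalization.algebraMap_mem_map_algebraMap_iff (Submonoid.powers a)]
    constructor
    · rintro ⟨k, hk⟩
      exact ⟨_, ⟨k, rfl⟩, hk⟩
    · rintro ⟨_, ⟨k, rfl⟩, hk⟩
      exact ⟨k, hk⟩
  have hsurj (n : ℕ) (b : B) : ∃ z, b - ψ z ∈ (K n).1 := by
    obtain ⟨m, r, hr⟩ := h.exists_approx (K n) b
    refine ⟨IsLocalization.mk' R r (⟨a ^ m, m, rfl⟩ : Submonoid.powers a), ?_⟩
    rw [← h.mul_mem_iff _ m, mul_sub]
    convert! hr using 2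
    rw [← hψ, ← hψ, ← map_mul]
    congr 1
    exact IsLocalization.mk'_spec' R r (⟨a ^ m, m, rfl⟩ : Submonoid.powers a)
  have hfg : (J.map (algebraMap A R)).FG := Ideal.FG.map (IsNoetherian.noetherian J) _
  have hadic := isAdic_map_of_approx ψ (J.map (algebraMap A R)) hfg (fun n => (K n).1) hKmono
    (fun n => (K n).2) hKbasis hmem hsurj
  have h1 := eq_map_pow_of_approx ψ (J.map (algebraMap A R)) hfg (fun n => (K n).1) hKmono
    (fun n => (K n).2) hKbasis hmem hsurj 1
  rw [pow_one] at h1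
  have : IsNoetherianRing R := IsLocalization.isNoetherianRing (Submonoid.powers a) R inferInstance
  have : IsNoetherianRing (B ⧸ (J.map (algebraMap A R)).map ψ) := by
    refine isNoetherianRing_of_surjective R _ ((Ideal.Quotient.mk _).comp ψ) fun z => ?_
    obtain ⟨b, rfl⟩ := Ideal.Quotient.mk_surjective z
    obtain ⟨r, hr⟩ := hsurj 1 b
    refine ⟨r, ((Ideal.Quotient.mk_eq_mk_iff_sub_mem _ _).mpr ?_).symm⟩
    rw [← h1]; exact hr
  exact isNoetherianAdicRing_of_isAdic hadic (hfg.map ψ)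

end IsTopLocalization

end Localization

section LocRing

variable {A : Type u} [CommRing A] [TopologicalSpace A] [AdmissibleRing A]

/-- The completed localization of `A` away from `a`, constructed as the ring of sections of the
structure sheaf of `Spf A` over the basic open set of `a`. -/
def LocRing (a : A) : Type u := spfSections A (spfBasicOpen A a)

namespace LocRing

variable (a : A)

instance : CommRing (LocRing a) := inferInstanceAs (CommRing (spfSections A (spfBasicOpen A a)))

instance : TopologicalSpace (LocRing a) := spfTopology A (spfBasicOpen A a)

instance : IsTopologicalRing (LocRing a) := spfTopology_isTopologicalRing A (spfBasicOpen A a)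

/-- The canonical map to the completed localization. -/
def of : A →+* LocRing a := toSec (spfBasicOpen A a)

/-- The projection from the completed localization to the localization of `A / I`. -/
def eval (I : OpenIdeal A) : LocRing a →+* Sec I (spfBasicOpen A a) := evalSec (spfBasicOpen A a) I

lemma eval_of (I : OpenIdeal A) (r : A) :
    eval a I (of a r) = toSSec (preim I (spfBasicOpen A a)) (Ideal.Quotient.mk I.1 r) := rfl

lemma trans_eval {I J : OpenIdeal A} (hIJ : I.1 ≤ J.1) (s : LocRing a) :
    trans hIJ _ (eval a I s) = eval a J s := s.2 I J hIJ

lemma eq_of_eval (s t : LocRing a) (h : ∀ I, eval a I s = eval a I t) : s = t :=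
  Subtype.ext (funext h)

lemma isOpen_ker_eval (I : OpenIdeal A) : IsOpen (RingHom.ker (eval a I) : Set (LocRing a)) := by
  obtain ⟨J, hJ⟩ := AdmissibleRing.exists_isIdealOfDefinition (A := A)
  exact isOpen_eval_eq_zero (isCompact_spfBasicOpen ⟨J, hJ.isOpen⟩ hJ.le_asIdeal a) I

lemma exists_ker_eval_subset {V : Set (LocRing a)} (hV : V ∈ 𝓝 0) :
    ∃ I, (RingHom.ker (eval a I) : Set (LocRing a)) ⊆ V := by
  obtain ⟨I, hI⟩ := exists_eval_subset hV
  exact ⟨I, fun s hs => hI s hs⟩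

lemma isUnit_of : IsUnit (of a a) := isUnit_toSec a _ le_rfl

lemma eval_of_eq_zero_iff (I : OpenIdeal A) (r : A) :
    eval a I (of a r) = 0 ↔ ∃ n : ℕ, a ^ n * r ∈ I.1 := by
  constructor
  · intro h
    obtain ⟨n, hn⟩ := exists_pow_mul_eq_zero (Ideal.Quotient.mk I.1 a) (preim I (spfBasicOpen A a))
      (fun x => Iff.rfl) (Ideal.Quotient.mk I.1 r) h
    refine ⟨n, ?_⟩
    rw [← Ideal.Quotient.eq_zero_iff_mem, map_mul, map_pow]
    exact hn
  · rintro ⟨n, hn⟩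
    have h1 : eval a I (of a (a ^ n * r)) = 0 := by
      rw [eval_of, Ideal.Quotient.eq_zero_iff_mem.mpr hn, map_zero]
    rw [map_mul, map_mul, map_pow, map_pow] at h1
    exact (((isUnit_of a).map (eval a I)).pow n).mul_right_eq_zero.mp h1

lemma exists_eval_eq (I : OpenIdeal A) (s : LocRing a) :
    ∃ (n : ℕ) (r : A), eval a I (of a (a ^ n) * s - of a r) = 0 := by
  obtain ⟨n, r, hr⟩ := exists_toSSec_eq (Ideal.Quotient.mk I.1 a) (preim I (spfBasicOpen A a))
    (fun x => Iff.rfl) (eval a I s)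
  obtain ⟨r, rfl⟩ := Ideal.Quotient.mk_surjective r
  refine ⟨n, r, ?_⟩
  rw [map_sub, map_mul, sub_eq_zero, eval_of, eval_of, map_pow]
  exact hr

/-- Sections vanishing modulo an ideal of definition `J` are topologically nilpotent: modulo any open ideal `I`
they lie in the ideal generated by `J`, some power of which is zero. -/
lemma isIdealOfDefinition_ker_eval {J : Ideal A} (hJ : IsIdealOfDefinition J) :
    IsIdealOfDefinition (RingHom.ker (eval a ⟨J, hJ.isOpen⟩)) where
  isOpen := isOpen_ker_eval a _
  exists_pow_subset V hV := by
    obtain ⟨I, hI⟩ := exists_ker_eval_subset a hV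
    obtain ⟨n, hn⟩ := hJ.exists_pow_subset I.1 (I.2.mem_nhds I.1.zero_mem)
    refine ⟨n, fun s hs => hI ?_⟩
    let L : OpenIdeal A := ⟨I.1 ⊓ J, I.2.inter hJ.isOpen⟩
    have h1 : RingHom.ker (eval a ⟨J, hJ.isOpen⟩) ≤
        (J.map ((eval a I).comp (of a))).comap (eval a I) := by
      intro s hs
      obtain ⟨m, r, hr⟩ := exists_eval_eq a L s
      have hr' (K : OpenIdeal A) (hK : L.1 ≤ K.1) : eval a K (of a (a ^ m) * s - of a r) = 0 := by
        rw [← trans_eval a hK, hr, map_zero]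
      have h2 : eval a ⟨J, hJ.isOpen⟩ (of a r) = 0 := by
        have := hr' ⟨J, hJ.isOpen⟩ inf_le_right
        rw [map_sub, map_mul, (RingHom.mem_ker.mp hs), mul_zero, zero_sub, neg_eq_zero] at this
        exact this
      obtain ⟨k, hk⟩ := (eval_of_eq_zero_iff a _ r).mp h2
      have h3 := hr' I inf_le_left
      rw [map_sub, map_mul, sub_eq_zero] at h3
      have hu := (((isUnit_of a).map (eval a I)).pow (k + m))
      rw [Ideal.mem_comap, ← Ideal.unit_mul_mem_iff_mem _ hu]
      have e : eval a I (of a a) ^ (k + m) * eval a I s = ((eval a I).comp (of a)) (a ^ k * r) := by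
        rw [RingHom.comp_apply, map_mul, map_mul, ← h3, map_pow, map_pow, map_pow, map_pow, pow_add,
          mul_assoc]
      rw [e]
      exact Ideal.mem_map_of_mem _ hk
    have h2 : s ∈ (J.map ((eval a I).comp (of a)) ^ n).comap (eval a I) :=
      (Ideal.pow_right_mono h1 n).trans (Ideal.le_comap_pow _ n) hs
    rw [← Ideal.map_pow] at h2
    have h3 : (J ^ n).map ((eval a I).comp (of a)) ≤ ⊥ := by
      refine Ideal.map_le_iff_le_comap.mpr fun r hr => ?_
      exact (eval_of_eq_zero_iff a I r).mpr ⟨0, by simpa using hn hr⟩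
    exact h3 h2

instance : AdmissibleRing (LocRing a) := by
  refine admissibleRing_of_basis (fun I => RingHom.ker (eval a I)) (isOpen_ker_eval a)
    (fun V hV => exists_ker_eval_subset a hV) ?_ (fun s hs => eq_of_eval a s 0 fun I => ?_) fun s hs => ?_
  · obtain ⟨J, hJ⟩ := AdmissibleRing.exists_isIdealOfDefinition (A := A)
    exact ⟨_, isIdealOfDefinition_ker_eval a hJ⟩
  · rw [map_zero]; exact hs I
  · have hker {I J : OpenIdeal A} (hIJ : I.1 ≤ J.1) :
        RingHom.ker (eval a I) ≤ RingHom.ker (eval a J) := fun t ht => by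
      rw [RingHom.mem_ker, ← trans_eval a hIJ, RingHom.mem_ker.mp ht, map_zero]
    let t : LocRing a := ⟨fun I => eval a I (s I), fun I J hIJ => by
      rw [trans_eval, ← sub_eq_zero, ← map_sub]
      exact hs I J (hker hIJ)⟩
    refine ⟨t, fun I => ?_⟩
    rw [RingHom.mem_ker, map_sub, sub_eq_zero]
    rfl

lemma isTopLocalization : IsTopLocalization a (of a) where
  continuous := continuous_toSec (spfBasicOpen A a)
  isUnit := isUnit_of a
  exists_approx K s := by
    obtain ⟨I, hI⟩ := exists_ker_eval_subset a (K.2.mem_nhds K.1.zero_mem)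
    obtain ⟨n, r, hr⟩ := exists_eval_eq a I s
    exact ⟨n, r, hI hr⟩
  exists_openIdeal I := ⟨⟨RingHom.ker (eval a I), isOpen_ker_eval a I⟩, eval_of_eq_zero_iff a I⟩

end LocRing

end LocRing

/-! ### Gluing topologically ringed spaces -/

namespace TopLocallyRingedSpace

/-- Data for gluing topologically ringed spaces `P i`: open subsets `W i j` of `P i`, and morphisms from
`W i j` to `P j`. -/
structure Gluing where
  ι : Type u
  P : ι → TopLocallyRingedSpace.{u}
  W (i j : ι) : Opens (P i).toTopCat
  τ (i j : ι) : (P i).restrict (W i j) ⟶ P j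
  W_self (i : ι) : W i i = ⊤
  τ_self (i : ι) : τ i i = (P i).restrictι (W i i)
  mem_W {i j k : ι} (x : ((P i).restrict (W i j)).toTopCat)
    (hx : ((P i).restrictι (W i j)).toLRS.base x ∈ W i k) : (τ i j).toLRS.base x ∈ W j k
  cocycle {i j k : ι} {T : TopLocallyRingedSpace.{u}} (a : T ⟶ (P i).restrict (W i j))
    (b : T ⟶ (P i).restrict (W i k)) (c : T ⟶ (P j).restrict (W j k))
    (h : IsOpenImm (a ≫ (P i).restrictι (W i j)))
    (hab : a ≫ (P i).restrictι (W i j) = b ≫ (P i).restrictι (W i k))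
    (hac : a ≫ τ i j = c ≫ (P j).restrictι (W j k)) : c ≫ τ j k = b ≫ τ i k

namespace Gluing

variable (D : Gluing.{u})

/-- The overlaps, as locally ringed spaces. -/
abbrev V (i j : D.ι) : LocallyRingedSpace.{u} := ((D.P i).restrict (D.W i j)).toLocallyRingedSpace

/-- The inclusions of the overlaps, as morphisms of locally ringed spaces. -/
abbrev f (i j : D.ι) : D.V i j ⟶ (D.P i).toLocallyRingedSpace := ((D.P i).restrictι (D.W i j)).toLRS

lemma mem_opensRange_f (i j : D.ι) (x : (D.P i).toTopCat) : x ∈ opensRange (D.f i j) ↔ x ∈ D.W i j :=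
  mem_range_restrictι (D.P i) (D.W i j)

lemma base_f_mem (i j : D.ι) (x : D.V i j) : (D.f i j).base x ∈ D.W i j :=
  (D.mem_opensRange_f i j _).mp ⟨x, rfl⟩

lemma exists_lift_f {i j : D.ι} {T : LocallyRingedSpace.{u}} (g : T ⟶ (D.P i).toLocallyRingedSpace)
    (h : ∀ t, g.base t ∈ D.W i j) : ∃ l : T ⟶ D.V i j, l ≫ D.f i j = g :=
  exists_lrsLift (D.f i j) g fun t => (D.mem_opensRange_f i j _).mpr (h t)

lemma lrs_cocycle {i j k : D.ι} {T : LocallyRingedSpace.{u}} (a : T ⟶ D.V i j) (b : T ⟶ D.V i k)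
    (c : T ⟶ D.V j k) (hab : a ≫ D.f i j = b ≫ D.f i k)
    (hac : a ≫ (D.τ i j).toLRS = c ≫ D.f j k) : c ≫ (D.τ j k).toLRS = b ≫ (D.τ i k).toLRS := by
  let N := (D.P i).restrict (D.W i j ⊓ D.W i k)
  let n : N ⟶ D.P i := (D.P i).restrictι (D.W i j ⊓ D.W i k)
  have hn (x : N.toTopCat) : n.toLRS.base x ∈ D.W i j ⊓ D.W i k :=
    (mem_range_restrictι (D.P i) _).mp ⟨x, rfl⟩
  obtain ⟨a', ha'⟩ := exists_lift ((D.P i).restrictι (D.W i j)) n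
    fun x => (mem_range_restrictι _ _).mpr (hn x).1
  obtain ⟨b', hb'⟩ := exists_lift ((D.P i).restrictι (D.W i k)) n
    fun x => (mem_range_restrictι _ _).mpr (hn x).2
  obtain ⟨c', hc'⟩ := exists_lift ((D.P j).restrictι (D.W j k)) (a' ≫ D.τ i j)
    fun x => (mem_range_restrictι _ _).mpr (D.mem_W (a'.toLRS.base x) (by
      have := (hn x).2
      rw [← ha'] at this
      exact this))
  have h := D.cocycle a' b' c' (by rw [ha']; infer_instance) (ha'.trans hb'.symm) hc'.symm
  obtain ⟨m, hm⟩ := exists_lrsLift n.toLRS (a ≫ D.f i j) fun t =>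
    (mem_range_restrictι (D.P i) _).mpr ⟨D.base_f_mem i j (a.base t), by
      rw [hab]; exact D.base_f_mem i k (b.base t)⟩
  have h1 : a = m ≫ a'.toLRS := by
    rw [← cancel_mono (D.f i j), Category.assoc, ← hm, ← ha', comp_toLRS]
  have h2 : b = m ≫ b'.toLRS := by
    rw [← cancel_mono (D.f i k), Category.assoc, ← hab, ← hm, ← hb', comp_toLRS]
  have h3 : c = m ≫ c'.toLRS := by
    rw [← cancel_mono (D.f j k), Category.assoc, ← hac, h1, Category.assoc]
    exact congrArg (fun z => m ≫ Hom.toLRS z) hc'.symm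
  rw [h2, h3, Category.assoc, Category.assoc]
  exact congrArg (fun z => m ≫ Hom.toLRS z) h

lemma exists_t (i j : D.ι) : ∃ t : D.V i j ⟶ D.V j i, t ≫ D.f j i = (D.τ i j).toLRS :=
  D.exists_lift_f _ fun x => D.mem_W x (by rw [D.W_self]; trivial)

/-- The transition maps between the overlaps. -/
def t (i j : D.ι) : D.V i j ⟶ D.V j i := (D.exists_t i j).choose

lemma t_f (i j : D.ι) : D.t i j ≫ D.f j i = (D.τ i j).toLRS := (D.exists_t i j).choose_spec

lemma t_τ (i j : D.ι) : D.t i j ≫ (D.τ j i).toLRS = D.f i j := by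
  obtain ⟨b, hb⟩ := D.exists_lift_f (i := i) (j := i) (D.f i j) fun x => by rw [D.W_self]; trivial
  have := D.lrs_cocycle (𝟙 _) b (D.t i j) (by rw [Category.id_comp, hb])
    (by rw [Category.id_comp, t_f])
  rw [this, D.τ_self, hb]

lemma exists_t' (i j k : D.ι) : ∃ t' : Limits.pullback (D.f i j) (D.f i k) ⟶
    Limits.pullback (D.f j k) (D.f j i),
      t' ≫ Limits.pullback.fst _ _ ≫ D.f j k = Limits.pullback.fst _ _ ≫ (D.τ i j).toLRS ∧
      t' ≫ Limits.pullback.snd _ _ = Limits.pullback.fst _ _ ≫ D.t i j := by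
  obtain ⟨l, hl⟩ := D.exists_lift_f (i := j) (j := k)
    (Limits.pullback.fst (D.f i j) (D.f i k) ≫ (D.τ i j).toLRS) fun x =>
      D.mem_W ((Limits.pullback.fst (D.f i j) (D.f i k)).base x) (by
        have h1 := D.base_f_mem i k ((Limits.pullback.snd (D.f i j) (D.f i k)).base x)
        have h2 : (D.f i j).base ((Limits.pullback.fst (D.f i j) (D.f i k)).base x) =
            (D.f i k).base ((Limits.pullback.snd (D.f i j) (D.f i k)).base x) :=
          congrArg (fun z : _ ⟶ (D.P i).toLocallyRingedSpace => z.base x) Limits.pullback.condition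
        exact h2 ▸ h1)
  refine ⟨Limits.pullback.lift l (Limits.pullback.fst _ _ ≫ D.t i j) ?_, ?_, ?_⟩
  · rw [hl, Category.assoc, t_f]
  · rw [Limits.pullback.lift_fst_assoc, hl]
  · rw [Limits.pullback.lift_snd]

/-- The transition maps between the triple overlaps. -/
def t' (i j k : D.ι) : Limits.pullback (D.f i j) (D.f i k) ⟶ Limits.pullback (D.f j k) (D.f j i) :=
  (D.exists_t' i j k).choose

lemma t'_fst (i j k : D.ι) : D.t' i j k ≫ Limits.pullback.fst _ _ ≫ D.f j k =
    Limits.pullback.fst _ _ ≫ (D.τ i j).toLRS := (D.exists_t' i j k).choose_spec.1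

lemma t'_snd (i j k : D.ι) : D.t' i j k ≫ Limits.pullback.snd _ _ = Limits.pullback.fst _ _ ≫ D.t i j :=
  (D.exists_t' i j k).choose_spec.2

lemma t'_cocycle (i j k : D.ι) : D.t' i j k ≫ D.t' j k i ≫ D.t' k i j = 𝟙 _ := by
  rw [← cancel_mono (Limits.pullback.fst _ _), ← cancel_mono (D.f i j)]
  simp only [Category.assoc, Category.id_comp]
  have h1 : (D.t' i j k ≫ Limits.pullback.fst _ _) ≫ (D.τ j k).toLRS =
      Limits.pullback.snd _ _ ≫ (D.τ i k).toLRS :=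
    D.lrs_cocycle (Limits.pullback.fst _ _) (Limits.pullback.snd _ _) _ Limits.pullback.condition
      (by rw [Category.assoc, t'_fst])
  have h2 : D.t' i j k ≫ D.t' j k i ≫ Limits.pullback.fst _ _ = Limits.pullback.snd _ _ ≫ D.t i k := by
    rw [← cancel_mono (D.f k i)]
    simp only [Category.assoc]
    rw [t'_fst, t_f, ← h1, Category.assoc]
  calc D.t' i j k ≫ D.t' j k i ≫ D.t' k i j ≫ Limits.pullback.fst _ _ ≫ D.f i j
      = (D.t' i j k ≫ D.t' j k i ≫ Limits.pullback.fst _ _) ≫ (D.τ k i).toLRS := by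
        rw [t'_fst]; simp only [Category.assoc]
    _ = Limits.pullback.fst _ _ ≫ D.f i j := by
        rw [h2, Category.assoc, t_τ, Limits.pullback.condition]

lemma isIso_f_self (i : D.ι) : IsIso (D.f i i) := by
  have : Epi (D.f i i).base := by
    rw [TopCat.epi_iff_surjective]
    intro x
    exact (D.mem_opensRange_f i i x).mpr (by rw [D.W_self]; trivial)
  exact LocallyRingedSpace.IsOpenImmersion.to_iso (D.f i i)

/-- The associated gluing data for locally ringed spaces. -/
def lrsGlueData : LocallyRingedSpace.GlueData.{u} where
  J := D.ι
  U i := (D.P i).toLocallyRingedSpace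
  V p := D.V p.1 p.2
  f := D.f
  f_mono i j := inferInstanceAs (Mono (D.f i j))
  f_hasPullback i j k := inferInstanceAs (Limits.HasPullback (D.f i j) (D.f i k))
  f_id := D.isIso_f_self
  t := D.t
  t_id i := by rw [← cancel_mono (D.f i i), t_f, D.τ_self, Category.id_comp]
  t' := D.t'
  t_fac := D.t'_snd
  cocycle := D.t'_cocycle
  f_open i j := inferInstanceAs (LocallyRingedSpace.IsOpenImmersion (D.f i j))

/-- The glued locally ringed space. -/
abbrev gluedLRS : LocallyRingedSpace.{u} := D.lrsGlueData.toGlueData.glued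

/-- The morphisms from the pieces to the glued locally ringed space. -/
def ιLRS (i : D.ι) : (D.P i).toLocallyRingedSpace ⟶ D.gluedLRS := D.lrsGlueData.toGlueData.ι i

instance (i : D.ι) : LocallyRingedSpace.IsOpenImmersion (D.ιLRS i) :=
  D.lrsGlueData.ι_isOpenImmersion i

lemma f_ιLRS (i j : D.ι) : D.f i j ≫ D.ιLRS i = (D.τ i j).toLRS ≫ D.ιLRS j := by
  rw [← D.t_f, Category.assoc]
  exact (D.lrsGlueData.toGlueData.glue_condition i j).symm

lemma exists_ιLRS_eq (x : D.gluedLRS) : ∃ i y, (D.ιLRS i).base y = x :=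
  D.lrsGlueData.ι_jointly_surjective x

/-- Points of the glued space with the same image come from the overlaps. -/
lemma mem_W_of_ιLRS_eq {i j : D.ι} (x : (D.P i).toTopCat) (y : (D.P j).toTopCat)
    (h : (D.ιLRS i).base x = (D.ιLRS j).base y) : x ∈ D.W i j := by
  let O : Opens (D.P i).toTopCat := (Opens.map (D.ιLRS i).base).obj (opensRange (D.ιLRS j))
  let o := (D.P i).toLocallyRingedSpace.ofRestrict O.isOpenEmbedding
  obtain ⟨l, hl⟩ := exists_lrsLift (D.ιLRS j) (o ≫ D.ιLRS i) fun z => z.2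
  have hlim := D.lrsGlueData.vPullbackConeIsLimit i j
  let m := Limits.PullbackCone.IsLimit.lift hlim o l hl.symm
  have hm : m ≫ D.f i j = o := Limits.PullbackCone.IsLimit.lift_fst hlim o l hl.symm
  have hx : o.base (⟨x, y, h.symm⟩ : O) = x := rfl
  rw [← hx, ← hm]
  exact D.base_f_mem i j _

/-- On open subsets of the `i`-th piece, the topology induced from this piece is finer than those induced
from the other pieces: an open set inside the `i`-th piece meets the `j`-th piece in `W j i`, and the transition map
is continuous. Hence the glued topology restricts to the given one on each piece. -/
lemma topology_le (V : Opens D.gluedLRS.toTopCat) (i : D.ι) (V' : Opens (D.P i).toTopCat)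
    (hV : V ≤ opensRange (D.ιLRS i)) (hV' : ∀ x, x ∈ V' ↔ (D.ιLRS i).base x ∈ V) (j : D.ι) :
    ((D.P i).topology V').induced (appLE (D.ιLRS i) V V' fun x => (hV' x).mp) ≤
      ((D.P j).topology ((Opens.map (D.ιLRS j).base).obj V)).induced (appLE (D.ιLRS j) V _ le_rfl) := by
  let N : Opens (D.P j).toTopCat := (Opens.map (D.ιLRS j).base).obj V
  let e := (D.P j).restrictι (D.W j i)
  let N' : Opens ((D.P j).restrict (D.W j i)).toTopCat := (Opens.map e.toLRS.base).obj N
  have hN : N ≤ range e := fun y hy => by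
    obtain ⟨x, hx⟩ := hV hy
    exact (mem_range_restrictι (D.P j) _).mpr (D.mem_W_of_ιLRS_eq y x hx.symm)
  have hτ : N' ≤ (Opens.map (D.τ j i).toLRS.base).obj V' := fun y hy => by
    refine (hV' _).mpr ?_
    have h1 : (D.f j i ≫ D.ιLRS j).base y ∈ V := hy
    rw [D.f_ιLRS] at h1
    exact h1
  let _ : TopologicalSpace (D.gluedLRS.presheaf.obj (op V)) :=
    ((D.P i).topology V').induced (appLE (D.ιLRS i) V V' fun x => (hV' x).mp)
  rw [← continuous_iff_le_induced, IsOpenImm.topology_eq (j := e) N N' hN fun _ => Iff.rfl]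
  refine continuous_induced_rng.mpr ?_
  have h1 := @Continuous.comp _ _ _ _ ((D.P i).topology V') (((D.P j).restrict (D.W j i)).topology N') _ _
    (continuous_appLE (D.τ j i) V' N' hτ)
    (@continuous_induced_dom _ _ (appLE (D.ιLRS i) V V' fun x => (hV' x).mp) ((D.P i).topology V'))
  convert! h1 using 1
  ext s
  refine (appLE_comp e.toLRS (D.ιLRS j) (V := N) le_rfl le_rfl s).trans ?_
  refine (appLE_congr (D.f_ιLRS j i) _ s).trans ?_
  exact (appLE_comp (D.τ j i).toLRS (D.ιLRS i) (fun x => (hV' x).mp) hτ s).symm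

/-- The glued topologically ringed space. The sections over an open set carry the coarsest topology for which
the restrictions to all pieces are continuous. -/
def glued : TopLocallyRingedSpace.{u} where
  toLocallyRingedSpace := D.gluedLRS
  topology V := ⨅ i, ((D.P i).topology ((Opens.map (D.ιLRS i).base).obj V)).induced
    (appLE (D.ιLRS i) V _ le_rfl)
  isTopologicalRing V := isTopologicalRing_iInf _ fun i =>
    isTopologicalRing_induced _ ((D.P i).isTopologicalRing _) _
  topology_eq {κ} U V hV hU := by
    simp only [induced_iInf, induced_compose]
    rw [iInf_comm]
    refine iInf_congr fun i => ?_
    rw [(D.P i).topology_eq ((Opens.map (D.ιLRS i).base).obj U)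
      (fun k => (Opens.map (D.ιLRS i).base).obj (V k)) (fun k => map_mono _ (hV k))
      (fun x hx => by
        obtain ⟨k, hk⟩ := Opens.mem_iSup.mp (hU hx)
        exact Opens.mem_iSup.mpr ⟨k, hk⟩), induced_iInf]
    refine iInf_congr fun k => ?_
    rw [induced_compose]
    congr 1
    ext s
    refine (secRes_appLE (D.ιLRS i) (U := U) le_rfl (map_mono (D.ιLRS i) (hV k)) s).trans ?_
    exact (appLE_secRes (D.ιLRS i) (hV k) le_rfl s).symm

/-- The morphisms from the pieces to the glued topologically ringed space. -/
def toGlued (i : D.ι) : D.P i ⟶ D.glued where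
  toLRS := D.ιLRS i
  continuous V := by
    rw [continuous_iff_le_induced]
    refine (iInf_le _ i).trans (le_of_eq ?_)
    congr 1
    ext s
    exact secRes_self _ _

instance (i : D.ι) : IsOpenImm (D.toGlued i) where
  lrs := inferInstanceAs (LocallyRingedSpace.IsOpenImmersion (D.ιLRS i))
  topology_eq V V' hV hV' := by
    refine le_antisymm ?_ (le_iInf fun j => D.topology_le V i V' hV hV' j)
    exact continuous_iff_le_induced.mp (continuous_appLE (D.toGlued i) V V' fun x => (hV' x).mp)

lemma restrictι_toGlued (i j : D.ι) :
    (D.P i).restrictι (D.W i j) ≫ D.toGlued i = D.τ i j ≫ D.toGlued j :=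
  hom_ext (D.f_ιLRS i j)

lemma exists_toGlued_eq (x : D.glued.toTopCat) : ∃ i, x ∈ range (D.toGlued i) :=
  D.exists_ιLRS_eq x

lemma mem_W_of_toGlued_eq {i j : D.ι} (x : (D.P i).toTopCat) (y : (D.P j).toTopCat)
    (h : (D.toGlued i).toLRS.base x = (D.toGlued j).toLRS.base y) : x ∈ D.W i j :=
  D.mem_W_of_ιLRS_eq x y h

/-- Morphisms from the pieces which are compatible with the transition maps can be glued. -/
theorem exists_desc {L : TopLocallyRingedSpace.{u}} (m : ∀ i, D.P i ⟶ L)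
    (hm : ∀ i j, (D.P i).restrictι (D.W i j) ≫ m i = D.τ i j ≫ m j) :
    ∃ h : D.glued ⟶ L, ∀ i, D.toGlued i ≫ h = m i := by
  refine exists_glue D.P D.toGlued D.exists_toGlued_eq m fun i j x hi hj => ?_
  obtain ⟨y, rfl⟩ := hi
  obtain ⟨z, hz⟩ := hj
  have hy := D.mem_W_of_toGlued_eq y z hz.symm
  exact ⟨_, (D.P i).restrictι (D.W i j), D.τ i j, inferInstance, ⟨⟨y, hy⟩, rfl⟩,
    D.restrictι_toGlued i j, hm i j⟩

end Gluing

end TopLocallyRingedSpace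

/-! ### Completed tensor products -/

section Completion

/-- The completion of a ring `R` with respect to a finitely generated ideal. -/
lemma exists_completion (R : Type u) [CommRing R] (𝔞 : Ideal R) (h𝔞 : 𝔞.FG) :
    ∃ (C : Type u) (_ : CommRing C) (_ : TopologicalSpace C) (_ : AdmissibleRing C) (κ : R →+* C),
      IsAdic (𝔞.map κ) ∧ (∀ n c, ∃ r, c - κ r ∈ (𝔞.map κ) ^ n) ∧
        ∀ n r, κ r ∈ (𝔞.map κ) ^ n ↔ r ∈ 𝔞 ^ n := by
  let C := AdicCompletion 𝔞 R
  let κ : R →+* C := algebraMap R C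
  let _ : TopologicalSpace C := (𝔞.map κ).adicTopology
  have hadic : IsAdic (𝔞.map κ) := rfl
  have : IsTopologicalRing C := ((𝔞.map κ).adic_basis.toRing_subgroups_basis.toRingFilterBasis).isTopologicalRing
  have : IsAdicComplete (𝔞.map κ) C := AdicCompletion.isAdicComplete_self 𝔞 h𝔞
  have hC : AdmissibleRing C := admissibleRing_of_isAdic hadic
  have hmem (n : ℕ) (c : C) : c ∈ (𝔞.map κ) ^ n ↔ AdicCompletion.evalₐ 𝔞 n c = 0 := by
    have h1 := AdicCompletion.pow_smul_top_eq_ker_eval (M := R) (n := n) h𝔞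
    rw [Ideal.smul_top_eq_map, Ideal.map_pow] at h1
    have h2 : c ∈ (𝔞.map κ) ^ n ↔ AdicCompletion.eval 𝔞 R n c = 0 := by
      rw [← LinearMap.mem_ker, ← h1]
      rfl
    have h3 : (𝔞 ^ n • ⊤ : Ideal R) = 𝔞 ^ n := by simp
    rw [h2]
    exact (map_eq_zero_iff (Ideal.quotientEquivAlgOfEq R h3) (Ideal.quotientEquivAlgOfEq R h3).injective).symm
  have hκ (n : ℕ) (r : R) : AdicCompletion.evalₐ 𝔞 n (κ r) = Ideal.Quotient.mk _ r :=
    AdicCompletion.evalₐ_of 𝔞 n r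
  refine ⟨C, inferInstance, inferInstance, hC, κ, hadic, fun n c => ?_, fun n r => ?_⟩
  · obtain ⟨r, hr⟩ := Ideal.Quotient.mk_surjective (AdicCompletion.evalₐ 𝔞 n c)
    refine ⟨r, (hmem n _).mpr ?_⟩
    rw [map_sub, hκ, hr, sub_self]
  · rw [hmem, hκ, Ideal.Quotient.eq_zero_iff_mem]

variable {R C D : Type u} [CommRing R] [CommRing C] [TopologicalSpace C] [AdmissibleRing C]
  [CommRing D] [TopologicalSpace D] [AdmissibleRing D]

/-- Homomorphisms to admissible rings can be extended to completions. -/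
lemma exists_extension (κ : R →+* C) (hκ : ∀ (K : OpenIdeal C) (c : C), ∃ r, c - κ r ∈ K.1)
    (φ : R →+* D) (h : ∀ L : OpenIdeal D, ∃ K : OpenIdeal C, ∀ r, κ r ∈ K.1 → φ r ∈ L.1) :
    ∃ ψ : C →+* D, Continuous ψ ∧ ∀ r, ψ (κ r) = φ r := by
  choose K hK using h
  choose a ha using hκ
  -- the characterization of the value `x` at `c` of the extension
  let P (c : C) (x : D) : Prop := ∀ (L : OpenIdeal D) (r : R), c - κ r ∈ (K L).1 → x - φ r ∈ L.1
  have hP (c : C) : ∃ x, P c x := by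
    obtain ⟨x, hx⟩ := exists_of_compatible (fun L => φ (a (K L) c)) fun L L' hLL' => by
      let N : OpenIdeal C := ⟨(K L).1 ⊓ (K L').1, (K L).2.inter (K L').2⟩
      have h1 : φ (a (K L) c - a N c) ∈ L.1 := hK L _ (by
        have := (K L).1.sub_mem (ha N c).1 (ha (K L) c)
        rwa [sub_sub_sub_cancel_left, ← map_sub] at this)
      have h2 : φ (a (K L') c - a N c) ∈ L'.1 := hK L' _ (by
        have := (K L').1.sub_mem (ha N c).2 (ha (K L') c)
        rwa [sub_sub_sub_cancel_left, ← map_sub] at this)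
      have := L'.1.sub_mem (hLL' h1) h2
      rwa [← map_sub, sub_sub_sub_cancel_right, map_sub] at this
    refine ⟨x, fun L r hr => ?_⟩
    have h1 : φ (a (K L) c - r) ∈ L.1 := hK L _ (by
      have := (K L).1.sub_mem hr (ha (K L) c)
      rwa [sub_sub_sub_cancel_left, ← map_sub] at this)
    have := L.1.add_mem (hx L) h1
    rwa [map_sub, sub_add_sub_cancel] at this
  have huniq {c : C} {x y : D} (hx : P c x) (hy : P c y) : x = y := by
    refine sub_eq_zero.mp (eq_zero_of_forall_mem_openIdeal _ fun L => ?_)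
    have := L.1.sub_mem (hx L _ (ha _ _)) (hy L _ (ha (K L) c))
    rwa [sub_sub_sub_cancel_right] at this
  -- it suffices to check the characterization for approximations modulo small open ideals
  have hP' {c : C} {x : D} (h : ∀ L : OpenIdeal D, ∃ (N : OpenIdeal C), ∀ r, c - κ r ∈ N.1 → x - φ r ∈ L.1) :
      P c x := fun L r hr => by
    obtain ⟨N, hN⟩ := h L
    let N' : OpenIdeal C := ⟨N.1 ⊓ (K L).1, N.2.inter (K L).2⟩
    have h1 : φ (r - a N' c) ∈ L.1 := hK L _ (by
      have := (K L).1.sub_mem (ha N' c).2 hr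
      rwa [sub_sub_sub_cancel_left, ← map_sub] at this)
    have := L.1.sub_mem (hN _ (ha N' c).1) h1
    rwa [map_sub, sub_sub_sub_cancel_right] at this
  choose ψ hψ using hP
  have hψκ (r : R) : ψ (κ r) = φ r := huniq (hψ _) (hP' fun L => ⟨K L, fun s hs => by
    rw [← map_sub] at hs ⊢
    exact hK L _ hs⟩)
  have hmul (c d : C) : ψ (c * d) = ψ c * ψ d := by
    refine sub_eq_zero.mp (eq_zero_of_forall_mem_openIdeal _ fun L => ?_)
    obtain ⟨r, hr⟩ : ∃ r, c - κ r ∈ (K L).1 := ⟨_, ha _ _⟩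
    obtain ⟨s, hs⟩ : ∃ s, d - κ s ∈ (K L).1 := ⟨_, ha _ _⟩
    have h1 := hψ (c * d) L (r * s) (by
      have := (K L).1.add_mem ((K L).1.mul_mem_right d hr) ((K L).1.mul_mem_left (κ r) hs)
      rw [map_mul]
      convert! this using 1
      ring)
    have h2 := L.1.add_mem (L.1.mul_mem_right (ψ d) (hψ c L r hr)) (L.1.mul_mem_left (φ r) (hψ d L s hs))
    have := L.1.sub_mem h1 h2
    rw [map_mul] at this
    convert! this using 1
    ring
  have hadd (c d : C) : ψ (c + d) = ψ c + ψ d := by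
    refine sub_eq_zero.mp (eq_zero_of_forall_mem_openIdeal _ fun L => ?_)
    obtain ⟨r, hr⟩ : ∃ r, c - κ r ∈ (K L).1 := ⟨_, ha _ _⟩
    obtain ⟨s, hs⟩ : ∃ s, d - κ s ∈ (K L).1 := ⟨_, ha _ _⟩
    have h1 := hψ (c + d) L (r + s) (by
      rw [map_add, add_sub_add_comm]
      exact (K L).1.add_mem hr hs)
    have := L.1.sub_mem h1 (L.1.add_mem (hψ c L r hr) (hψ d L s hs))
    rw [map_add] at this
    convert! this using 1
    ring
  let Ψ : C →+* D :=
    { toFun := ψ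
      map_one' := by rw [← map_one κ, hψκ, map_one]
      map_mul' := hmul
      map_zero' := by rw [← map_zero κ, hψκ, map_zero]
      map_add' := hadd }
  refine ⟨Ψ, continuous_of_continuousAt_zero Ψ ?_, hψκ⟩
  rw [ContinuousAt, map_zero]
  intro N hN
  obtain ⟨L, hL⟩ := exists_openIdeal_subset hN
  refine Filter.mem_map.mpr (Filter.mem_of_superset ((K L).2.mem_nhds (K L).1.zero_mem) fun c hc => hL ?_)
  have := hψ c L 0 (by simpa using hc)
  rw [map_zero, sub_zero] at this
  exact this

lemma ringHom_ext_of_dense (κ : R →+* C) (hκ : ∀ (K : OpenIdeal C) (c : C), ∃ r, c - κ r ∈ K.1)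
    {φ ψ : C →+* D} (hφ : Continuous φ) (hψ : Continuous ψ) (h : ∀ r, φ (κ r) = ψ (κ r)) : φ = ψ := by
  ext c
  refine sub_eq_zero.mp (eq_zero_of_forall_mem_openIdeal _ fun L => ?_)
  obtain ⟨r, h1, h2⟩ := hκ ⟨L.1.comap φ ⊓ L.1.comap ψ, (L.2.preimage hφ).inter (L.2.preimage hψ)⟩ c
  have := L.1.sub_mem h1 h2
  rw [map_sub, map_sub, h r, sub_sub_sub_cancel_right] at this
  exact this

lemma continuous_of_le_comap (φ : C →+* D) {I : Ideal C} (hI : ∀ n, IsOpen ((I ^ n : Ideal C) : Set C))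
    {J : Ideal D} (hJ : IsIdealOfDefinition J) (h : I ≤ J.comap φ) : Continuous φ := by
  refine continuous_of_continuousAt_zero φ ?_
  rw [ContinuousAt, map_zero]
  intro N hN
  obtain ⟨n, hn⟩ := hJ.exists_pow_subset N hN
  refine Filter.mem_map.mpr (Filter.mem_of_superset ((hI n).mem_nhds (I ^ n).zero_mem) fun c hc => hn ?_)
  exact (Ideal.pow_right_mono h n).trans (Ideal.le_comap_pow φ n) hc

lemma map_mem_openNilradical (φ : C →+* D) (hφ : Continuous φ) {c : C} (hc : c ∈ openNilradical C) :
    φ c ∈ openNilradical D :=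
  mem_openNilradical.mpr fun x => mem_openNilradical.mp hc (spfBase φ hφ x)

end Completion

section Pushout

/-- Pushouts of commutative rings. -/
lemma exists_pushout {A B B' : Type u} [CommRing A] [CommRing B] [CommRing B'] (α : B →+* A)
    (β : B →+* B') : ∃ (R : Type u) (_ : CommRing R) (i : A →+* R) (j : B' →+* R),
      (∀ b, i (α b) = j (β b)) ∧
      (∀ S : Subring R, (∀ a, i a ∈ S) → (∀ b, j b ∈ S) → S = ⊤) ∧
      ∀ (D : Type u) [CommRing D] (x : A →+* D) (y : B' →+* D), (∀ b, x (α b) = y (β b)) →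
        ∃ w : R →+* D, (∀ a, w (i a) = x a) ∧ ∀ b, w (j b) = y b := by
  let _ := α.toAlgebra
  let _ := β.toAlgebra
  refine ⟨TensorProduct B A B', inferInstance, Algebra.TensorProduct.includeLeftRingHom,
    (Algebra.TensorProduct.includeRight : B' →ₐ[B] _).toRingHom, fun b => ?_, fun S hA hB => ?_,
    fun D _ x y h => ?_⟩
  · exact ((Algebra.TensorProduct.includeLeft : A →ₐ[B] TensorProduct B A B').commutes b).trans
      ((Algebra.TensorProduct.includeRight : B' →ₐ[B] TensorProduct B A B').commutes b).symm
  · refine (Subring.eq_top_iff' S).mpr fun z => ?_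
    induction z with
    | zero => exact S.zero_mem
    | tmul a b =>
      have := S.mul_mem (hA a) (hB b)
      simpa using this
    | add z w hz hw => exact S.add_mem hz hw
  · let _ := (x.comp α).toAlgebra
    let x' : A →ₐ[B] D := { x with commutes' := fun b => rfl }
    let y' : B' →ₐ[B] D := { y with commutes' := fun b => (h b).symm }
    refine ⟨(Algebra.TensorProduct.lift x' y' fun _ _ => Commute.all _ _).toRingHom, fun a => ?_,
      fun b => ?_⟩
    · change Algebra.TensorProduct.lift x' y' (fun _ _ => Commute.all _ _) (a ⊗ₜ[B] 1) = _
      rw [Algebra.TensorProduct.lift_tmul, map_one, mul_one]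
      rfl
    · change Algebra.TensorProduct.lift x' y' (fun _ _ => Commute.all _ _) (1 ⊗ₜ[B] b) = _
      rw [Algebra.TensorProduct.lift_tmul, map_one, one_mul]
      rfl

/-- Finiteness passes to rings generated by the images of `A` and `B'`. -/
lemma finiteType_of_generates {A B B' S : Type u} [CommRing A] [CommRing B] [CommRing B'] [CommRing S]
    (α : B →+* A) (hα : α.FiniteType) (β : B →+* B') (i : A →+* S) (j : B' →+* S)
    (h : ∀ b, i (α b) = j (β b))
    (hgen : ∀ T : Subring S, (∀ a, i a ∈ T) → (∀ b, j b ∈ T) → T = ⊤) : j.FiniteType := by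
  let _ := α.toAlgebra
  let _ := j.toAlgebra
  obtain ⟨s, hs⟩ := (show Algebra.FiniteType B A from hα).out
  classical
  refine (show Algebra.FiniteType B' S from ⟨⟨s.image i, ?_⟩⟩)
  let T := Algebra.adjoin B' ((s.image i : Finset S) : Set S)
  have hb (b : B') : j b ∈ T := T.algebraMap_mem b
  have ha (a : A) : i a ∈ T := by
    have : a ∈ Algebra.adjoin B (s : Set A) := by rw [hs]; trivial
    induction this using Algebra.adjoin_induction with
    | mem a ha => exact Algebra.subset_adjoin (Finset.mem_coe.mpr (Finset.mem_image_of_mem i ha))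
    | algebraMap b => exact (h b).symm ▸ hb (β b)
    | add x y _ _ hx hy => rw [map_add]; exact T.add_mem hx hy
    | mul x y _ _ hx hy => rw [map_mul]; exact T.mul_mem hx hy
  have := hgen T.toSubring ha hb
  refine eq_top_iff.mpr fun x _ => ?_
  have hx : x ∈ T.toSubring := by rw [this]; trivial
  exact hx

variable {A B B' : Type u} [CommRing A] [TopologicalSpace A] [AdmissibleRing A]
  [CommRing B] [TopologicalSpace B] [AdmissibleRing B]
  [CommRing B'] [TopologicalSpace B'] [AdmissibleRing B']

/-- Completed tensor products of noetherian adic rings, under a finiteness condition. The ring `C` is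
the completion of the tensor product `R` with respect to the ideal `𝔞` generated by the images of
ideals of definition `I` of `A` and `J` of `B'`. Now `R / 𝔞` is a finitely generated algebra over
`B' / J`, so that it is noetherian. -/
theorem exists_completedPushout (hA : IsNoetherianAdicRing A) (hB' : IsNoetherianAdicRing B')
    (α : B →+* A) (β : B →+* B')
    (hft : ((Ideal.Quotient.mk (openNilradical A)).comp α).FiniteType) :
    ∃ (C : Type u) (_ : CommRing C) (_ : TopologicalSpace C) (_ : AdmissibleRing C)
      (i : A →+* C) (j : B' →+* C), IsNoetherianAdicRing C ∧ Continuous i ∧ Continuous j ∧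
      i.comp α = j.comp β ∧ ((Ideal.Quotient.mk (openNilradical C)).comp j).FiniteType ∧
      ∀ (D : Type u) [CommRing D] [TopologicalSpace D] [AdmissibleRing D],
        (∀ (x : A →+* D) (y : B' →+* D), Continuous x → Continuous y → x.comp α = y.comp β →
          ∃ w : C →+* D, Continuous w ∧ w.comp i = x ∧ w.comp j = y) ∧
        ∀ w w' : C →+* D, Continuous w → Continuous w' → w.comp i = w'.comp i →
          w.comp j = w'.comp j → w = w' := by
  have hAn := hA.isNoetherianRing
  have hBn := hB'.isNoetherianRing
  have hI := hA.isIdealOfDefinition_openNilradical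
  have hJ := hB'.isIdealOfDefinition_openNilradical
  have hIa := isAdic_iff.mp (hA.isAdic hI)
  have hJa := isAdic_iff.mp (hB'.isAdic hJ)
  obtain ⟨R, _, i, j, hij, hgen, hlift⟩ := exists_pushout α β
  let 𝔞 : Ideal R := (openNilradical A).map i ⊔ (openNilradical B').map j
  have h𝔞 : 𝔞.FG := Submodule.FG.sup (Ideal.FG.map (IsNoetherian.noetherian _) i)
    (Ideal.FG.map (IsNoetherian.noetherian _) j)
  have hi𝔞 (a : A) (ha : a ∈ openNilradical A) : i a ∈ 𝔞 :=
    (le_sup_left : _ ≤ 𝔞) (Ideal.mem_map_of_mem i ha)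
  have hj𝔞 (b : B') (hb : b ∈ openNilradical B') : j b ∈ 𝔞 :=
    (le_sup_right : _ ≤ 𝔞) (Ideal.mem_map_of_mem j hb)
  have hft𝔞 : ((Ideal.Quotient.mk 𝔞).comp j).FiniteType := by
    refine finiteType_of_generates _ hft β
      (Ideal.Quotient.lift _ ((Ideal.Quotient.mk 𝔞).comp i) fun a ha =>
        Ideal.Quotient.eq_zero_iff_mem.mpr (hi𝔞 a ha)) _ (fun b => ?_) fun T h1 h2 => ?_
    · simp [hij]
    · have h3 := hgen (T.comap (Ideal.Quotient.mk 𝔞)) (fun a => h1 (Ideal.Quotient.mk _ a)) h2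
      refine (Subring.eq_top_iff' T).mpr fun z => ?_
      obtain ⟨r, rfl⟩ := Ideal.Quotient.mk_surjective z
      have hr : r ∈ T.comap (Ideal.Quotient.mk 𝔞) := by rw [h3]; trivial
      exact hr
  have hnoeth : IsNoetherianRing (R ⧸ 𝔞) := by
    let _ := ((Ideal.Quotient.mk 𝔞).comp j).toAlgebra
    have : Algebra.FiniteType B' (R ⧸ 𝔞) := hft𝔞
    exact Algebra.FiniteType.isNoetherianRing B' (R ⧸ 𝔞)
  obtain ⟨C, _, _, _, κ, hadic, happrox, hmem⟩ := exists_completion R 𝔞 h𝔞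
  have hdef := IsAdic.isIdealOfDefinition hadic
  have hopen := (isAdic_iff.mp hadic).1
  -- the image of `R` is dense in `C`
  have hdense (K : OpenIdeal C) (c : C) : ∃ r, c - κ r ∈ K.1 := by
    obtain ⟨n, hn⟩ := hdef.exists_pow_subset K.1 (K.2.mem_nhds K.1.zero_mem)
    obtain ⟨r, hr⟩ := happrox n c
    exact ⟨r, hn hr⟩
  have hC : IsNoetherianAdicRing C := by
    have : IsNoetherianRing (C ⧸ 𝔞.map κ) := by
      have h1 : 𝔞 ≤ (𝔞.map κ).comap κ := Ideal.le_comap_map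
      refine isNoetherianRing_of_surjective (R ⧸ 𝔞) _ (Ideal.quotientMap _ κ h1) fun z => ?_
      obtain ⟨c, rfl⟩ := Ideal.Quotient.mk_surjective z
      obtain ⟨r, hr⟩ := happrox 1 c
      rw [pow_one] at hr
      exact ⟨Ideal.Quotient.mk _ r, ((Ideal.Quotient.mk_eq_mk_iff_sub_mem _ _).mpr hr).symm⟩
    exact isNoetherianAdicRing_of_isAdic hadic (h𝔞.map κ)
  have hi : Continuous (κ.comp i) := continuous_of_le_comap _ hIa.1 hdef fun a ha =>
    Ideal.mem_map_of_mem κ (hi𝔞 a ha)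
  have hj : Continuous (κ.comp j) := continuous_of_le_comap _ hJa.1 hdef fun b hb =>
    Ideal.mem_map_of_mem κ (hj𝔞 b hb)
  have hle : 𝔞.map κ ≤ openNilradical C := fun c hc =>
    mem_openNilradical.mpr fun x => hdef.le_asIdeal x hc
  refine ⟨C, inferInstance, inferInstance, inferInstance, κ.comp i, κ.comp j, hC, hi, hj, ?_, ?_,
    fun D _ _ _ => ⟨fun x y hx hy hxy => ?_, fun w w' hw hw' h1 h2 => ?_⟩⟩
  · ext b
    simp [hij]
  · have h1 : 𝔞 ≤ (openNilradical C).comap κ := fun r hr => hle (Ideal.mem_map_of_mem κ hr)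
    have h2 : Function.Surjective (Ideal.quotientMap _ κ h1) := fun z => by
      obtain ⟨c, rfl⟩ := Ideal.Quotient.mk_surjective z
      obtain ⟨r, hr⟩ := happrox 1 c
      rw [pow_one] at hr
      exact ⟨Ideal.Quotient.mk _ r, ((Ideal.Quotient.mk_eq_mk_iff_sub_mem _ _).mpr (hle hr)).symm⟩
    exact hft𝔞.comp_surjective h2
  · obtain ⟨w₀, hwi, hwj⟩ := hlift D x y fun b => DFunLike.congr_fun hxy b
    obtain ⟨w, hw, hwκ⟩ := exists_extension κ hdense w₀ fun L => by
      obtain ⟨n, hn⟩ := hI.exists_pow_subset (L.1.comap x) ((L.2.preimage hx).mem_nhds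
        (L.1.comap x).zero_mem)
      obtain ⟨m, hm⟩ := hJ.exists_pow_subset (L.1.comap y) ((L.2.preimage hy).mem_nhds
        (L.1.comap y).zero_mem)
      -- the exponent `n + m` suffices for the sum of the two ideals
      refine ⟨⟨_, hopen (n + m)⟩, fun r hr => ?_⟩
      have h1 : 𝔞 ^ (n + m) ≤ L.1.comap w₀ := by
        refine Ideal.sup_pow_add_le_pow_sup_pow.trans (sup_le ?_ ?_)
        · rw [← Ideal.map_pow, Ideal.map_le_iff_le_comap]
          intro a ha
          simp only [Ideal.mem_comap, hwi]
          exact hn ha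
        · rw [← Ideal.map_pow, Ideal.map_le_iff_le_comap]
          intro b hb
          simp only [Ideal.mem_comap, hwj]
          exact hm hb
      exact h1 ((hmem _ r).mp hr)
    exact ⟨w, hw, RingHom.ext fun a => (hwκ _).trans (hwi a), RingHom.ext fun b => (hwκ _).trans (hwj b)⟩
  · refine ringHom_ext_of_dense κ hdense hw hw' fun r => ?_
    have h3 := hgen ((w.comp κ).eqLocus (w'.comp κ)) (fun a => DFunLike.congr_fun h1 a)
      fun b => DFunLike.congr_fun h2 b
    have hr : r ∈ (w.comp κ).eqLocus (w'.comp κ) := by rw [h3]; trivial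
    exact hr

end Pushout

/-! ### Affine charts -/

namespace TopLocallyRingedSpace

lemma hom_ext_of_cover {T L : TopLocallyRingedSpace.{u}} {κ : Type*} {S : κ → TopLocallyRingedSpace.{u}}
    (j : ∀ k, S k ⟶ T) [∀ k, IsOpenImm (j k)] (hcov : ∀ t, ∃ k, t ∈ range (j k))
    {f g : T ⟶ L} (h : ∀ k, j k ≫ f = j k ≫ g) : f = g := by
  have hb (x : T.toTopCat) : f.toLRS.base x = g.toLRS.base x := by
    obtain ⟨k, y, rfl⟩ := hcov x
    exact congrArg (fun z : S k ⟶ L => z.toLRS.base y) (h k)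
  refine hom_ext (lrsHom_ext _ _ hb fun U x hx s => ?_)
  obtain ⟨k, hk⟩ := hcov x
  let V : Opens T.toTopCat := (Opens.map f.toLRS.base).obj U ⊓ range (j k)
  have hV : V ≤ (Opens.map f.toLRS.base).obj U := inf_le_left
  have hV' : V ≤ (Opens.map g.toLRS.base).obj U := fun z hz => by
    have : f.toLRS.base z ∈ U := hz.1
    rwa [hb z] at this
  refine ⟨V, ⟨hx, hk⟩, hV, hV', ?_⟩
  refine (appLE_bijective (j k).toLRS V ((Opens.map (j k).toLRS.base).obj V) inf_le_right
    fun _ => Iff.rfl).1 ?_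
  refine (appLE_comp _ _ hV le_rfl s).trans (Eq.trans ?_ (appLE_comp _ _ hV' le_rfl s).symm)
  exact appLE_congr (congrArg Hom.toLRS (h k)) _ s

/-- If `l ≫ i` and `i` are open immersions, then so is `l`: it is an isomorphism onto the inverse image under `i`
of the image of `l ≫ i`. -/
lemma IsOpenImm.of_comp {X Y Z : TopLocallyRingedSpace.{u}} (l : X ⟶ Y) (i : Y ⟶ Z) [IsOpenImm i]
    [IsOpenImm (l ≫ i)] : IsOpenImm l := by
  let O : Opens Y.toTopCat := (Opens.map i.toLRS.base).obj (range (l ≫ i))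
  obtain ⟨a, ha⟩ := exists_lift (Y.restrictι O) l fun x =>
    (mem_range_restrictι Y O).mpr ⟨x, rfl⟩
  obtain ⟨b, hb⟩ := exists_lift (l ≫ i) (Y.restrictι O ≫ i) fun x =>
    (mem_range_restrictι Y O).mp ⟨x, rfl⟩
  have hab : a ≫ b = 𝟙 _ := IsOpenImm.mono (l ≫ i) (by
    rw [Category.assoc, hb, reassoc_of% ha, Category.id_comp])
  have hba : b ≫ a = 𝟙 _ := IsOpenImm.mono (Y.restrictι O) (IsOpenImm.mono i (by
    simp only [Category.assoc, Category.id_comp]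
    rw [reassoc_of% ha, hb]))
  have : IsIso a := ⟨b, hab, hba⟩
  rw [← ha]
  infer_instance

/-- An affine chart: an open immersion of a formal spectrum. -/
structure Chart (X : TopLocallyRingedSpace.{u}) : Type (u + 1) where
  A : Type u
  [commRing : CommRing A]
  [topologicalSpace : TopologicalSpace A]
  [admissibleRing : AdmissibleRing A]
  j : Spf A ⟶ X
  [isOpenImm : IsOpenImm j]

attribute [instance] Chart.commRing Chart.topologicalSpace Chart.admissibleRing Chart.isOpenImm

variable {X Y Z T P : TopLocallyRingedSpace.{u}}

/-- The open subset on which a chart is defined. -/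
def Chart.dom (c : Chart X) : Opens X.toTopCat := range c.j

/-- Charts can be composed with open immersions. -/
def Chart.comp (c : Chart X) (i : X ⟶ Y) [IsOpenImm i] : Chart Y where
  A := c.A
  j := c.j ≫ i

/-- Charts can be shrunk, by completed localization. -/
lemma Chart.exists_le (c : Chart X) (x : X.toTopCat) (hx : x ∈ c.dom) (O : Opens X.toTopCat)
    (hO : x ∈ O) : ∃ c' : Chart X, x ∈ c'.dom ∧ c'.dom ≤ O ∧
      (IsNoetherianAdicRing c.A → IsNoetherianAdicRing c'.A) := by
  obtain ⟨y, rfl⟩ := hx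
  obtain ⟨a, ha, haO⟩ := exists_spfBasicOpen (A := c.A) ((Opens.map c.j.toLRS.base).obj O) y hO
  have h := LocRing.isTopLocalization a
  have := h.isOpenImm
  refine ⟨{ A := LocRing a, j := Spf.map (LocRing.of a) h.continuous ≫ c.j }, ?_, ?_,
    fun hc => h.isNoetherianAdicRing hc⟩
  · obtain ⟨z, rfl⟩ := (h.mem_range_spfBase y).mpr ha
    exact ⟨z, rfl⟩
  · rintro _ ⟨z, rfl⟩
    exact haO ((h.mem_range_spfBase _).mp ⟨z, rfl⟩)

lemma isFormalScheme_of_chart (h : ∀ x : X.toTopCat, ∃ c : Chart X, x ∈ c.dom) : IsFormalScheme X :=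
  fun x => by
    obtain ⟨c, hc⟩ := h x
    exact ⟨c.dom, c.A, inferInstance, inferInstance, inferInstance, hc, nonempty_iso_restrict c.j⟩

lemma exists_chart (hX : IsFormalScheme X) (x : X.toTopCat) (O : Opens X.toTopCat) (hO : x ∈ O) :
    ∃ c : Chart X, x ∈ c.dom ∧ c.dom ≤ O := by
  obtain ⟨U, A, _, _, _, hx, ⟨e⟩⟩ := hX x
  let c : Chart X := { A := A, j := e.inv ≫ X.restrictι U }
  obtain ⟨c', h1, h2, -⟩ := c.exists_le x ((mem_range_iso_restrict e).mpr hx) O hO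
  exact ⟨c', h1, h2⟩

lemma isFormalScheme_spf (A : Type u) [CommRing A] [TopologicalSpace A] [AdmissibleRing A] :
    IsFormalScheme (Spf A) :=
  isFormalScheme_of_chart fun x => ⟨{ A := A, j := 𝟙 _ }, ⟨x, rfl⟩⟩

lemma isFormalScheme_of_isOpenImm (hX : IsFormalScheme X) (i : Y ⟶ X) [IsOpenImm i] :
    IsFormalScheme Y := isFormalScheme_of_chart fun y => by
  obtain ⟨c, ⟨z, hz⟩, hc⟩ := exists_chart hX (i.toLRS.base y) (range i) ⟨y, rfl⟩
  obtain ⟨l, hl⟩ := exists_lift i c.j fun z => hc ⟨z, rfl⟩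
  have hi := isOpenEmbedding_base i.toLRS
  have : IsOpenImm (l ≫ i) := by rw [hl]; infer_instance
  have := IsOpenImm.of_comp l i
  refine ⟨{ A := c.A, j := l }, z, hi.injective ?_⟩
  rw [← hz, ← hl]
  rfl

/-! ### Fibre products over open subsets -/

/-- The object `P` is the fibre product, in the category of formal schemes, of the open subsets `U` of `X`
and `V` of `Y` over `Z`. -/
structure IsPullbackOver (f : X ⟶ Z) (g : Y ⟶ Z) (U : Opens X.toTopCat) (V : Opens Y.toTopCat)
    (p : P ⟶ X) (q : P ⟶ Y) : Prop where
  isFormalScheme : IsFormalScheme P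
  w : p ≫ f = q ≫ g
  fst_mem (z : P.toTopCat) : p.toLRS.base z ∈ U
  snd_mem (z : P.toTopCat) : q.toLRS.base z ∈ V
  exists_lift {T : TopLocallyRingedSpace.{u}} (hT : IsFormalScheme T) (x : T ⟶ X) (y : T ⟶ Y)
    (h : x ≫ f = y ≫ g) (hx : ∀ t, x.toLRS.base t ∈ U) (hy : ∀ t, y.toLRS.base t ∈ V) :
    ∃ t : T ⟶ P, t ≫ p = x ∧ t ≫ q = y
  hom_ext {T : TopLocallyRingedSpace.{u}} (hT : IsFormalScheme T) {s t : T ⟶ P} (hp : s ≫ p = t ≫ p)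
    (hq : s ≫ q = t ≫ q) : s = t

/-- The universal property of a fibre product has to be checked for formal spectra only. -/
lemma isPullbackOver_of_spf {f : X ⟶ Z} {g : Y ⟶ Z} {U : Opens X.toTopCat} {V : Opens Y.toTopCat}
    {p : P ⟶ X} {q : P ⟶ Y} (hP : IsFormalScheme P) (w : p ≫ f = q ≫ g)
    (hU : ∀ z, p.toLRS.base z ∈ U) (hV : ∀ z, q.toLRS.base z ∈ V)
    (hlift : ∀ (D : Type u) [CommRing D] [TopologicalSpace D] [AdmissibleRing D] (x : Spf D ⟶ X)
      (y : Spf D ⟶ Y), x ≫ f = y ≫ g → (∀ t, x.toLRS.base t ∈ U) → (∀ t, y.toLRS.base t ∈ V) →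
      ∃ t : Spf D ⟶ P, t ≫ p = x ∧ t ≫ q = y)
    (hext : ∀ (D : Type u) [CommRing D] [TopologicalSpace D] [AdmissibleRing D] (s t : Spf D ⟶ P),
      s ≫ p = t ≫ p → s ≫ q = t ≫ q → s = t) : IsPullbackOver f g U V p q where
  isFormalScheme := hP
  w := w
  fst_mem := hU
  snd_mem := hV
  exists_lift {T} hT x y h hx hy := by
    choose c hc _ using fun t => exists_chart hT t ⊤ trivial
    choose m hmp hmq using fun k => hlift (c k).A ((c k).j ≫ x) ((c k).j ≫ y)
      (by rw [Category.assoc, Category.assoc, h]) (fun t => hx _) fun t => hy _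
    obtain ⟨t, ht⟩ := exists_glue (fun k => Spf (c k).A) (fun k => (c k).j) (fun t => ⟨t, hc t⟩) m
      fun k l t hk hl => by
        obtain ⟨d, hd, hdle⟩ := exists_chart hT t ((c k).dom ⊓ (c l).dom) ⟨hk, hl⟩
        obtain ⟨a, ha⟩ := TopLocallyRingedSpace.exists_lift (c k).j d.j fun z => (hdle ⟨z, rfl⟩).1
        obtain ⟨b, hb⟩ := TopLocallyRingedSpace.exists_lift (c l).j d.j fun z => (hdle ⟨z, rfl⟩).2
        refine ⟨Spf d.A, a, b, by rw [ha]; infer_instance, by rw [ha]; exact hd, ha.trans hb.symm,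
          hext _ _ _ ?_ ?_⟩
        · rw [Category.assoc, Category.assoc, hmp, hmp, reassoc_of% ha, reassoc_of% hb]
        · rw [Category.assoc, Category.assoc, hmq, hmq, reassoc_of% ha, reassoc_of% hb]
    refine ⟨t, hom_ext_of_cover (fun k => (c k).j) (fun t => ⟨t, hc t⟩) fun k => ?_,
      hom_ext_of_cover (fun k => (c k).j) (fun t => ⟨t, hc t⟩) fun k => ?_⟩
    · rw [reassoc_of% (ht k), hmp]
    · rw [reassoc_of% (ht k), hmq]
  hom_ext {T} hT s t hp hq := by
    choose c hc _ using fun t => exists_chart hT t ⊤ trivial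
    refine hom_ext_of_cover (fun k => (c k).j) (fun t => ⟨t, hc t⟩) fun k => hext _ _ _ ?_ ?_
    · rw [Category.assoc, Category.assoc, hp]
    · rw [Category.assoc, Category.assoc, hq]

/-- Fibre products of charts are given by completed tensor products. -/
theorem exists_isPullbackOver_chart {f : X ⟶ Z} {g : Y ⟶ Z} (c : Chart X) (c' : Chart Y) (d : Chart Z)
    (hc : IsNoetherianAdicRing c.A) (hc' : IsNoetherianAdicRing c'.A)
    (α : d.A →+* c.A) (hα : Continuous α) (hαf : Spf.map α hα ≫ d.j = c.j ≫ f)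
    (β : d.A →+* c'.A) (hβ : Continuous β) (hβg : Spf.map β hβ ≫ d.j = c'.j ≫ g)
    (hft : ((Ideal.Quotient.mk (openNilradical c.A)).comp α).FiniteType) :
    ∃ (P : TopLocallyRingedSpace.{u}) (p : P ⟶ X) (q : P ⟶ Y) (e : Chart P) (γ : c'.A →+* e.A)
      (hγ : Continuous γ), IsPullbackOver f g c.dom c'.dom p q ∧ (∀ z, z ∈ e.dom) ∧
      IsNoetherianAdicRing e.A ∧ Spf.map γ hγ ≫ c'.j = e.j ≫ q ∧
      ((Ideal.Quotient.mk (openNilradical e.A)).comp γ).FiniteType := by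
  obtain ⟨C, _, _, _, i, γ, hC, hi, hγ, hiγ, hγft, huniv⟩ := exists_completedPushout hc hc' α β hft
  refine ⟨Spf C, Spf.map i hi ≫ c.j, Spf.map γ hγ ≫ c'.j, { A := C, j := 𝟙 _ }, γ, hγ, ?_,
    fun z => ⟨z, rfl⟩, hC, (Category.id_comp _).symm, hγft⟩
  refine isPullbackOver_of_spf (isFormalScheme_spf C) ?_ (fun z => ⟨_, rfl⟩) (fun z => ⟨_, rfl⟩)
    (fun D _ _ _ x y h hx hy => ?_) fun D _ _ _ s t hp hq => ?_
  · rw [Category.assoc, Category.assoc, ← hαf, ← hβg, ← Category.assoc, ← Category.assoc, spfMap_comp,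
      spfMap_comp, spfMap_ext hiγ]
  · obtain ⟨x', rfl⟩ := TopLocallyRingedSpace.exists_lift c.j x hx
    obtain ⟨y', rfl⟩ := TopLocallyRingedSpace.exists_lift c'.j y hy
    obtain ⟨ξ, hξ, rfl⟩ := exists_spfMap_eq x'
    obtain ⟨η, hη, rfl⟩ := exists_spfMap_eq y'
    rw [Category.assoc, Category.assoc, ← hαf, ← hβg, ← Category.assoc, ← Category.assoc, spfMap_comp,
      spfMap_comp] at h
    obtain ⟨w, hw, hwi, hwγ⟩ := (huniv D).1 ξ η hξ hη (spfMap_injective _ _ (IsOpenImm.mono d.j h))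
    refine ⟨Spf.map w hw, ?_, ?_⟩
    · rw [← Category.assoc, spfMap_comp, spfMap_ext hwi]
    · rw [← Category.assoc, spfMap_comp, spfMap_ext hwγ]
  · obtain ⟨σ, hσ, rfl⟩ := exists_spfMap_eq s
    obtain ⟨τ, hτ, rfl⟩ := exists_spfMap_eq t
    refine spfMap_ext ((huniv D).2 σ τ hσ hτ ?_ ?_) _ _
    · rw [← Category.assoc, ← Category.assoc, spfMap_comp, spfMap_comp] at hp
      exact spfMap_injective _ _ (IsOpenImm.mono c.j hp)
    · rw [← Category.assoc, ← Category.assoc, spfMap_comp, spfMap_comp] at hq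
      exact spfMap_injective _ _ (IsOpenImm.mono c'.j hq)

end TopLocallyRingedSpace

/-! ### Gluing fibre products -/

namespace TopLocallyRingedSpace

variable {X Y Z : TopLocallyRingedSpace.{u}} {f : X ⟶ Z} {g : Y ⟶ Z} {ι : Type u}
  {P : ι → TopLocallyRingedSpace.{u}} {p : ∀ i, P i ⟶ X} {q : ∀ i, P i ⟶ Y}
  {U : ι → Opens X.toTopCat} {V : ι → Opens Y.toTopCat}

/-- Fibre products of open subsets `U i` of `X` and `V i` of `Y` can be glued. -/
theorem exists_isPullbackOver_glued (h : ∀ i, IsPullbackOver f g (U i) (V i) (p i) (q i))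
    (hcov : ∀ x y, f.toLRS.base x = g.toLRS.base y → ∃ i, x ∈ U i ∧ y ∈ V i) :
    ∃ (G : TopLocallyRingedSpace.{u}) (p' : G ⟶ X) (q' : G ⟶ Y) (j : ∀ i, P i ⟶ G),
      (∀ i, IsOpenImm (j i)) ∧ (∀ i, j i ≫ p' = p i) ∧ (∀ i, j i ≫ q' = q i) ∧
      (∀ z : G.toTopCat, ∃ i, z ∈ Set.range (j i).toLRS.base) ∧ IsPullbackOver f g ⊤ ⊤ p' q' := by
  -- `W i j` is the part of `P i` lying over `U j` and `V j`; the universal property of `P j` gives the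
  -- transition maps and the cocycle condition
  let W (i j : ι) : Opens (P i).toTopCat :=
    (Opens.map (p i).toLRS.base).obj (U j) ⊓ (Opens.map (q i).toLRS.base).obj (V j)
  have hW (i j : ι) (x : ((P i).restrict (W i j)).toTopCat) :
      ((P i).restrictι (W i j)).toLRS.base x ∈ W i j := (mem_range_restrictι _ _).mp ⟨x, rfl⟩
  have key (i j : ι) : ∃ t : (P i).restrict (W i j) ⟶ P j,
      t ≫ p j = (P i).restrictι _ ≫ p i ∧ t ≫ q j = (P i).restrictι _ ≫ q i :=
    (h j).exists_lift (isFormalScheme_of_isOpenImm (h i).isFormalScheme ((P i).restrictι (W i j))) _ _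
      (by rw [Category.assoc, Category.assoc, (h i).w]) (fun x => (hW i j x).1) fun x => (hW i j x).2
  choose τ hτp hτq using key
  let D : Gluing.{u} :=
    { ι := ι
      P := P
      W := W
      τ := τ
      W_self := fun i => eq_top_iff.mpr fun x _ => ⟨(h i).fst_mem x, (h i).snd_mem x⟩
      τ_self := fun i => (h i).hom_ext
        (isFormalScheme_of_isOpenImm (h i).isFormalScheme ((P i).restrictι (W i i))) (hτp i i) (hτq i i)
      mem_W := fun {i j k} x hx => by
        have h1 : (τ i j ≫ p j).toLRS.base x ∈ U k := by rw [hτp]; exact hx.1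
        have h2 : (τ i j ≫ q j).toLRS.base x ∈ V k := by rw [hτq]; exact hx.2
        exact ⟨h1, h2⟩
      cocycle := fun {i j k T} a b c ha hab hac => by
        refine (h k).hom_ext (isFormalScheme_of_isOpenImm (h i).isFormalScheme
          (a ≫ (P i).restrictι (W i j))) ?_ ?_
        · rw [Category.assoc, Category.assoc, hτp, hτp, ← reassoc_of% hac, hτp, reassoc_of% hab]
        · rw [Category.assoc, Category.assoc, hτq, hτq, ← reassoc_of% hac, hτq, reassoc_of% hab] }
  obtain ⟨p', hp'⟩ := D.exists_desc p fun i j => (hτp i j).symm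
  obtain ⟨q', hq'⟩ := D.exists_desc q fun i j => (hτq i j).symm
  have hbase (i : ι) (w : (P i).toTopCat) : p'.toLRS.base ((D.toGlued i).toLRS.base w) =
      (p i).toLRS.base w ∧ q'.toLRS.base ((D.toGlued i).toLRS.base w) = (q i).toLRS.base w :=
    ⟨congrArg (fun z : P i ⟶ X => z.toLRS.base w) (hp' i),
      congrArg (fun z : P i ⟶ Y => z.toLRS.base w) (hq' i)⟩
  -- the image of `P i` in the glued space consists of the points lying over `U i` and `V i`
  have hrange (i : ι) (z : D.glued.toTopCat) : z ∈ range (D.toGlued i) ↔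
      p'.toLRS.base z ∈ U i ∧ q'.toLRS.base z ∈ V i := by
    constructor
    · rintro ⟨w, rfl⟩
      rw [(hbase i w).1, (hbase i w).2]
      exact ⟨(h i).fst_mem w, (h i).snd_mem w⟩
    · rintro ⟨h1, h2⟩
      obtain ⟨k, w, rfl⟩ := D.exists_toGlued_eq z
      have hw : w ∈ W k i := by
        rw [(hbase k w).1] at h1
        rw [(hbase k w).2] at h2
        exact ⟨h1, h2⟩
      let v : ((P k).restrict (W k i)).toTopCat := ⟨w, hw⟩
      exact ⟨(τ k i).toLRS.base v, congrArg (fun z : (P k).restrict (W k i) ⟶ D.glued => z.toLRS.base v)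
        (D.restrictι_toGlued k i).symm⟩
  have hG : IsFormalScheme D.glued := isFormalScheme_of_chart fun z => by
    obtain ⟨i, w, rfl⟩ := D.exists_toGlued_eq z
    obtain ⟨c, hc, -⟩ := exists_chart (h i).isFormalScheme w ⊤ trivial
    obtain ⟨v, rfl⟩ := hc
    exact ⟨c.comp (D.toGlued i), v, rfl⟩
  refine ⟨D.glued, p', q', D.toGlued, inferInstance, hp', hq', D.exists_toGlued_eq, hG, ?_,
    fun _ => trivial, fun _ => trivial, fun {T} hT x y hxy _ _ => ?_, fun {T} hT s t hp hq => ?_⟩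
  · refine hom_ext_of_cover D.toGlued D.exists_toGlued_eq fun i => ?_
    rw [reassoc_of% (hp' i), reassoc_of% (hq' i)]
    exact (h i).w
  -- existence: `T` is covered by the open subsets `O i` on which the universal property of `P i` applies
  · let O (i : ι) : Opens T.toTopCat :=
      (Opens.map x.toLRS.base).obj (U i) ⊓ (Opens.map y.toLRS.base).obj (V i)
    have hO (i : ι) (z : (T.restrict (O i)).toTopCat) : (T.restrictι (O i)).toLRS.base z ∈ O i :=
      (mem_range_restrictι _ _).mp ⟨z, rfl⟩
    have hcovO (z : T.toTopCat) : ∃ i, z ∈ range (T.restrictι (O i)) := by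
      obtain ⟨i, hi⟩ := hcov (x.toLRS.base z) (y.toLRS.base z)
        (congrArg (fun w : T ⟶ Z => w.toLRS.base z) hxy)
      exact ⟨i, (mem_range_restrictι _ _).mpr hi⟩
    choose t htp htq using fun i => (h i).exists_lift
      (isFormalScheme_of_isOpenImm hT (T.restrictι (O i))) (T.restrictι (O i) ≫ x)
      (T.restrictι (O i) ≫ y) (by rw [Category.assoc, Category.assoc, hxy]) (fun z => (hO i z).1)
      fun z => (hO i z).2
    obtain ⟨r, hr⟩ := exists_glue _ (fun i => T.restrictι (O i)) hcovO
      (fun i => t i ≫ D.toGlued i) fun k l z hk hl => by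
        rw [mem_range_restrictι] at hk hl
        let N := O k ⊓ O l
        have hN (z : (T.restrict N).toTopCat) : (T.restrictι N).toLRS.base z ∈ N :=
          (mem_range_restrictι _ _).mp ⟨z, rfl⟩
        obtain ⟨a, ha⟩ := exists_lift (T.restrictι (O k)) (T.restrictι N) fun z =>
          (mem_range_restrictι _ _).mpr (hN z).1
        obtain ⟨b, hb⟩ := exists_lift (T.restrictι (O l)) (T.restrictι N) fun z =>
          (mem_range_restrictι _ _).mpr (hN z).2
        obtain ⟨e, he⟩ := exists_lift ((P k).restrictι (W k l)) (a ≫ t k) fun z => by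
          refine (mem_range_restrictι _ _).mpr ⟨?_, ?_⟩
          · have h1 : (a ≫ t k ≫ p k).toLRS.base z ∈ U l := by
              rw [htp, reassoc_of% ha]
              exact (hN z).2.1
            exact h1
          · have h1 : (a ≫ t k ≫ q k).toLRS.base z ∈ V l := by
              rw [htq, reassoc_of% ha]
              exact (hN z).2.2
            exact h1
        have hel : e ≫ τ k l = b ≫ t l := by
          refine (h l).hom_ext (isFormalScheme_of_isOpenImm hT (T.restrictι N)) ?_ ?_
          · rw [Category.assoc, Category.assoc, hτp, htp, reassoc_of% he, htp, reassoc_of% ha,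
              reassoc_of% hb]
          · rw [Category.assoc, Category.assoc, hτq, htq, reassoc_of% he, htq, reassoc_of% ha,
              reassoc_of% hb]
        refine ⟨T.restrict N, a, b, by rw [ha]; infer_instance, ?_, ha.trans hb.symm, ?_⟩
        · rw [ha]
          exact (mem_range_restrictι T N).mpr ⟨hk, hl⟩
        · have h1 := D.restrictι_toGlued k l
          rw [← Category.assoc, ← he, Category.assoc]
          exact (congrArg (e ≫ ·) h1).trans (by
            rw [← Category.assoc b, ← hel, Category.assoc])
    refine ⟨r, hom_ext_of_cover (fun i => T.restrictι (O i)) hcovO fun i => ?_,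
      hom_ext_of_cover (fun i => T.restrictι (O i)) hcovO fun i => ?_⟩
    · rw [reassoc_of% (hr i), hp' i, htp]
    · rw [reassoc_of% (hr i), hq' i, htq]
  -- uniqueness: over `O i`, both `s` and `t` factor through `P i`, by the description of its image
  · let O (i : ι) : Opens T.toTopCat := (Opens.map s.toLRS.base).obj (range (D.toGlued i))
    have hO (i : ι) (z : (T.restrict (O i)).toTopCat) : (T.restrictι (O i)).toLRS.base z ∈ O i :=
      (mem_range_restrictι _ _).mp ⟨z, rfl⟩
    have hcovO (z : T.toTopCat) : ∃ i, z ∈ range (T.restrictι (O i)) := by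
      obtain ⟨i, hi⟩ := D.exists_toGlued_eq (s.toLRS.base z)
      exact ⟨i, (mem_range_restrictι _ _).mpr hi⟩
    refine hom_ext_of_cover (fun i => T.restrictι (O i)) hcovO fun i => ?_
    obtain ⟨s', hs'⟩ := exists_lift (D.toGlued i) (T.restrictι (O i) ≫ s) (hO i)
    obtain ⟨t', ht'⟩ := exists_lift (D.toGlued i) (T.restrictι (O i) ≫ t) fun z => by
      have h1 := (hrange i _).mp (hO i z)
      refine (hrange i _).mpr ⟨?_, ?_⟩
      · have h2 : (T.restrictι (O i) ≫ s ≫ p').toLRS.base z ∈ U i := h1.1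
        rw [hp] at h2
        exact h2
      · have h2 : (T.restrictι (O i) ≫ s ≫ q').toLRS.base z ∈ V i := h1.2
        rw [hq] at h2
        exact h2
    rw [← hs', ← ht']
    congr 1
    refine (h i).hom_ext (isFormalScheme_of_isOpenImm hT (T.restrictι (O i))) ?_ ?_
    · rw [← hp' i, reassoc_of% hs', reassoc_of% ht', hp]
    · rw [← hq' i, reassoc_of% hs', reassoc_of% ht', hq]

end TopLocallyRingedSpace

/-! ### The reduced locally ringed space -/

section Reduction

variable {X Y Z : LocallyRingedSpace.{u}}

/-- The value of a section at a point, in the residue field. -/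
def value (X : LocallyRingedSpace.{u}) (U : Opens X.toTopCat) (x : X) (hx : x ∈ U) :
    X.presheaf.obj (op U) →+* X.residueField x :=
  (X.residue x).hom.comp (X.presheaf.germ U x hx).hom

lemma value_secRes {U V : Opens X.toTopCat} (h : V ≤ U) (x : X) (hx : x ∈ V)
    (s : X.presheaf.obj (op U)) : value X V x hx (secRes X h s) = value X U x (h hx) s :=
  congrArg (X.residue x).hom (germ_secRes h x hx s)

lemma value_eq_zero_iff (U : Opens X.toTopCat) (x : X) (hx : x ∈ U) (s : X.presheaf.obj (op U)) :
    value X U x hx s = 0 ↔ ¬ IsUnit ((X.presheaf.germ U x hx).hom s) :=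
  (IsLocalRing.residue_eq_zero_iff _).trans (IsLocalRing.mem_maximalIdeal _)

lemma residueFieldMap_value (f : X ⟶ Y) (U : Opens Y.toTopCat) (V : Opens X.toTopCat)
    (h : V ≤ (Opens.map f.base).obj U) (x : X) (hx : x ∈ V) (s : Y.presheaf.obj (op U)) :
    (LocallyRingedSpace.residueFieldMap f x).hom (value Y U (f.base x) (h hx) s) =
      value X V x hx (appLE f U V h s) := by
  have h1 := congrArg (fun φ => φ.hom ((Y.presheaf.germ U (f.base x) (h hx)).hom s))
    (LocallyRingedSpace.residue_comp_residueFieldMap_eq_stalkMap_comp_residue f x)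
  exact h1.trans (congrArg (X.residue x).hom (stalkMap_germ_appLE f U V h x hx s))

variable (X) in
/-- The ring of functions on `U` which assign to each point an element of its residue field, and which are
locally given by the values of a section of the structure sheaf. -/
def redSections (U : Opens X.toTopCat) : Subring (∀ x : U, X.residueField x.1) where
  carrier := { s | ∀ x : U, ∃ (V : Opens X.toTopCat) (h : V ≤ U) (t : X.presheaf.obj (op V)),
    x.1 ∈ V ∧ ∀ y (hy : y ∈ V), s ⟨y, h hy⟩ = value X V y hy t }
  mul_mem' {s s'} hs hs' x := by
    obtain ⟨V, h, t, hx, ht⟩ := hs x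
    obtain ⟨V', h', t', hx', ht'⟩ := hs' x
    refine ⟨V ⊓ V', inf_le_left.trans h, secRes X inf_le_left t * secRes X inf_le_right t', ⟨hx, hx'⟩,
      fun y hy => ?_⟩
    rw [map_mul, value_secRes, value_secRes, Pi.mul_apply, ht y hy.1, ht' y hy.2]
  one_mem' x := ⟨U, le_rfl, 1, x.2, fun y hy => by rw [map_one, Pi.one_apply]⟩
  add_mem' {s s'} hs hs' x := by
    obtain ⟨V, h, t, hx, ht⟩ := hs x
    obtain ⟨V', h', t', hx', ht'⟩ := hs' x
    refine ⟨V ⊓ V', inf_le_left.trans h, secRes X inf_le_left t + secRes X inf_le_right t', ⟨hx, hx'⟩,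
      fun y hy => ?_⟩
    rw [map_add, value_secRes, value_secRes, Pi.add_apply, ht y hy.1, ht' y hy.2]
  zero_mem' x := ⟨U, le_rfl, 0, x.2, fun y hy => by rw [map_zero, Pi.zero_apply]⟩
  neg_mem' {s} hs x := by
    obtain ⟨V, h, t, hx, ht⟩ := hs x
    exact ⟨V, h, -t, hx, fun y hy => by rw [map_neg, Pi.neg_apply, ht y hy]⟩

variable (X) in
/-- The restriction maps of the sheaf `redSections`. -/
def redRes {U V : Opens X.toTopCat} (h : V ≤ U) : redSections X U →+* redSections X V where
  toFun s := ⟨fun x => s.1 ⟨x.1, h x.2⟩, fun x => by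
    obtain ⟨W, hW, t, hx, ht⟩ := s.2 ⟨x.1, h x.2⟩
    exact ⟨V ⊓ W, inf_le_left, secRes X inf_le_right t, ⟨x.2, hx⟩, fun y hy => by
      rw [value_secRes]; exact ht y hy.2⟩⟩
  map_one' := rfl
  map_mul' _ _ := rfl
  map_zero' := rfl
  map_add' _ _ := rfl

variable (X) in
/-- The structure sheaf of the reduction of `X`, as a presheaf of rings. -/
def redPresheaf : TopCat.Presheaf CommRingCat.{u} X.toTopCat where
  obj U := CommRingCat.of (redSections X U.unop)
  map i := CommRingCat.ofHom (redRes X i.unop.le)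

variable (X) in
lemma redPresheaf_isSheaf : (redPresheaf X).IsSheaf := by
  rw [TopCat.Presheaf.isSheaf_iff_isSheafUniqueGluing]
  intro ι U sf hsf
  let s (i : ι) : redSections X (U i) := sf i
  have hs (i j : ι) (x : X) (hi : x ∈ U i) (hj : x ∈ U j) : (s i).1 ⟨x, hi⟩ = (s j).1 ⟨x, hj⟩ :=
    congrArg (fun t : redSections X (U i ⊓ U j) => t.1 ⟨x, hi, hj⟩) (hsf i j)
  choose i hi using fun x : (iSup U : Opens X.toTopCat) => Opens.mem_iSup.mp x.2
  let g : redSections X (iSup U) := ⟨fun x => (s (i x)).1 ⟨x.1, hi x⟩, fun x => by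
    obtain ⟨V, h, t, hx, ht⟩ := (s (i x)).2 ⟨x.1, hi x⟩
    exact ⟨V, h.trans (le_iSup U _), t, hx, fun y hy => (hs _ (i x) y (hi ⟨y, _⟩) (h hy)).trans (ht y hy)⟩⟩
  refine ⟨g, fun k => Subtype.ext (funext fun x => hs _ _ _ _ _), fun t ht => Subtype.ext (funext fun x => ?_)⟩
  exact congrArg (fun t : redSections X (U (i x)) => t.1 ⟨x.1, hi x⟩) (ht (i x))

variable (X) in
/-- The ringed space underlying the reduction of `X`. -/
def redSheafedSpace : SheafedSpace CommRingCat.{u} where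
  carrier := X.toTopCat
  presheaf := redPresheaf X
  IsSheaf := redPresheaf_isSheaf X

variable (X) in
/-- The function given by the values of a section. -/
def toRedSections (U : Opens X.toTopCat) : X.presheaf.obj (op U) →+* redSections X U where
  toFun s := ⟨fun x => value X U x.1 x.2 s, fun x => ⟨U, le_rfl, s, x.2, fun _ _ => rfl⟩⟩
  map_one' := Subtype.ext (funext fun _ => map_one _)
  map_mul' _ _ := Subtype.ext (funext fun _ => map_mul _ _ _)
  map_zero' := Subtype.ext (funext fun _ => map_zero _)
  map_add' _ _ := Subtype.ext (funext fun _ => map_add _ _ _)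

variable (X) in
/-- The canonical morphism of ringed spaces from the reduction of `X` to `X`. -/
def redHom : (redSheafedSpace X).toPresheafedSpace ⟶ X.toPresheafedSpace where
  base := TopCat.ofHom (ContinuousMap.id _)
  c :=
    { app := fun U => CommRingCat.ofHom (toRedSections X U.unop)
      naturality := fun U V i => by
        ext s
        exact Subtype.ext (funext fun x => value_secRes i.unop.le x.1 x.2 s) }

lemma stalkMap_redHom_surjective (x : X) : Function.Surjective ((redHom X).stalkMap x).hom := by
  intro z
  obtain ⟨U, hx, s, rfl⟩ := (redPresheaf X).exists_germ_eq z
  obtain ⟨V, h, t, hxV, ht⟩ := (show redSections X U from s).2 ⟨x, hx⟩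
  refine ⟨(X.presheaf.germ V x hxV).hom t, ?_⟩
  refine (PresheafedSpace.stalkMap_germ_apply (redHom X) V x hxV t).trans ?_
  have e : toRedSections X V t = redRes X h s := Subtype.ext (funext fun y => (ht y.1 y.2).symm)
  refine (congrArg ((redPresheaf X).germ V x hxV).hom e).trans ?_
  exact (redPresheaf X).germ_res_apply (homOfLE h) x hxV s

lemma nontrivial_stalk_redPresheaf (x : X) : Nontrivial ((redPresheaf X).stalk x) := by
  refine ⟨1, 0, fun h => ?_⟩
  have h1 : ((redPresheaf X).germ ⊤ x trivial).hom 1 = ((redPresheaf X).germ ⊤ x trivial).hom 0 := by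
    rw [map_one, map_zero, h]
  obtain ⟨W, hW, i, j, e⟩ := (redPresheaf X).germ_eq x (U := ⊤) (V := ⊤) trivial trivial _ _ h1
  have e' := congrArg (fun t : redSections X W => t.1 ⟨x, hW⟩) e
  exact one_ne_zero (α := X.residueField x) e'

variable (X) in
/-- The reduction of a locally ringed space. -/
def redLRS : LocallyRingedSpace.{u} where
  toSheafedSpace := redSheafedSpace X
  isLocalRing x := by
    have : Nontrivial ((redSheafedSpace X).presheaf.stalk x) :=
      nontrivial_stalk_redPresheaf (X := X) x
    have := X.isLocalRing x
    exact IsLocalRing.of_surjective' ((redHom X).stalkMap x).hom (stalkMap_redHom_surjective x)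

variable (X) in
/-- The canonical morphism from the reduction of `X` to `X`. -/
def redι : redLRS X ⟶ X where
  toHom := redHom X
  prop x := by
    have : Nontrivial ((redSheafedSpace X).presheaf.stalk x) :=
      nontrivial_stalk_redPresheaf (X := X) x
    exact Function.Surjective.isLocalHom ((redHom X).stalkMap x).hom (stalkMap_redHom_surjective (X := X) x)

lemma redι_stalkMap_surjective (x : redLRS X) : Function.Surjective ((redι X).stalkMap x).hom :=
  stalkMap_redHom_surjective (X := X) x

lemma redι_isHomeomorph : IsHomeomorph (redι X).base := IsHomeomorph.id

lemma redι_app_eq_zero_iff (U : Opens X.toTopCat) (s : X.presheaf.obj (op U)) :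
    ((redι X).c.app (op U)).hom s = 0 ↔
      ∀ x (hx : x ∈ U), ¬ IsUnit ((X.presheaf.germ U x hx).hom s) := by
  have : ((redι X).c.app (op U)).hom s = 0 ↔ toRedSections X U s = 0 := Iff.rfl
  rw [this]
  constructor
  · intro h x hx
    rw [← value_eq_zero_iff]
    exact congrArg (fun t : redSections X U => t.1 ⟨x, hx⟩) h
  · intro h
    exact Subtype.ext (funext fun x => (value_eq_zero_iff _ _ _ _).mpr (h x.1 x.2))

lemma exists_appLE_redι_eq (U : Opens (redLRS X).toTopCat) (s : (redLRS X).presheaf.obj (op U))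
    (x : X) (hx : x ∈ U) : ∃ (V : Opens X.toTopCat) (h : V ≤ U) (t : X.presheaf.obj (op V)), x ∈ V ∧
      secRes (redLRS X) h s = appLE (redι X) V V le_rfl t := by
  obtain ⟨V, h, t, hxV, ht⟩ := (show redSections X U from s).2 ⟨x, hx⟩
  exact ⟨V, h, t, hxV, Subtype.ext (funext fun y => ht y.1 y.2)⟩

lemma isUnit_germ_redLRS (U : Opens X.toTopCat) (x : X) (hx : x ∈ U) (s : redSections X U) :
    IsUnit (((redLRS X).presheaf.germ U x hx).hom s) ↔ s.1 ⟨x, hx⟩ ≠ 0 := by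
  obtain ⟨V, h, t, hxV, ht⟩ := exists_appLE_redι_eq U s x hx
  have h1 : s.1 ⟨x, hx⟩ = value X V x hxV t :=
    congrArg (fun t : redSections X V => t.1 ⟨x, hxV⟩) ht
  rw [← germ_secRes (X := redLRS X) h x hxV s, ht, h1, ne_eq, value_eq_zero_iff, not_not]
  exact isUnit_germ_appLE (redι X) V V le_rfl x hxV t

instance : Mono (redι X) := ⟨fun {S} k k' e => by
  have hb (z : S) : k.base z = k'.base z := congrArg (fun w : S ⟶ X => w.base z) e
  refine lrsHom_ext _ _ hb fun U z hz s => ?_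
  obtain ⟨V, h, t, hxV, ht⟩ := exists_appLE_redι_eq U s (k.base z) hz
  let V' : Opens (redLRS X).toTopCat := V
  have h1 : (Opens.map k.base).obj V' ≤ (Opens.map k'.base).obj V' := fun y hy => by
    have : k.base y ∈ V' := hy
    rwa [hb] at this
  refine ⟨(Opens.map k.base).obj V', hxV, fun y hy => h hy, fun y hy => h (h1 hy), ?_⟩
  refine (appLE_secRes k (U' := V') h le_rfl s).symm.trans (Eq.trans ?_ (appLE_secRes k' (U' := V') h h1 s))
  rw [ht]
  refine (appLE_comp k (redι X) (V := V') le_rfl le_rfl t).trans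
    (Eq.trans ?_ (appLE_comp k' (redι X) (V := V') le_rfl h1 t).symm)
  exact appLE_congr e _ t⟩

/-- The morphism of reductions induced by a morphism. -/
def redMap (f : X ⟶ Y) : redLRS X ⟶ redLRS Y :=
  lrsHomMk (X := redLRS X) (Y := redLRS Y) f.base.hom
    (fun U =>
      { toFun := fun s => (⟨fun x => (LocallyRingedSpace.residueFieldMap f x.1).hom
            ((show redSections Y U from s).1 ⟨f.base x.1, x.2⟩), fun x => by
          obtain ⟨V, h, t, hxV, ht⟩ := (show redSections Y U from s).2 ⟨f.base x.1, x.2⟩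
          refine ⟨(Opens.map f.base).obj V, fun y hy => h hy, appLE f V _ le_rfl t, hxV, fun y hy => ?_⟩
          exact (congrArg _ (ht (f.base y) hy)).trans (residueFieldMap_value f V _ le_rfl y hy t)⟩ :
            redSections X (Opens.comap f.base.hom U))
        map_one' := Subtype.ext (funext fun _ => map_one _)
        map_mul' := fun _ _ => Subtype.ext (funext fun _ => map_mul _ _ _)
        map_zero' := Subtype.ext (funext fun _ => map_zero _)
        map_add' := fun _ _ => Subtype.ext (funext fun _ => map_add _ _ _) })
    (fun U V h s => rfl)
    fun U x hx s hs => by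
      refine (isUnit_germ_redLRS (X := Y) U _ hx (show redSections Y U from s)).mpr fun h0 => ?_
      refine (isUnit_germ_redLRS (X := X) _ x _ _).mp hs ?_
      exact (congrArg _ h0).trans (map_zero _)

lemma redMap_redι (f : X ⟶ Y) : redMap f ≫ redι Y = redι X ≫ f := by
  refine lrsHom_ext _ _ (fun _ => rfl) fun U x hx s => ?_
  let V : Opens X.toTopCat := (Opens.map f.base).obj U
  refine ⟨V, hx, le_rfl, le_rfl, ?_⟩
  refine (appLE_comp (redMap f) (redι Y) (V := U) (W := V) le_rfl le_rfl s).symm.trans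
    (Eq.trans ?_ (appLE_comp (redι X) f (V := V) (W := V) le_rfl le_rfl s))
  exact Subtype.ext (funext fun y => residueFieldMap_value f U V le_rfl y.1 y.2 s)

lemma redMap_comp (f : X ⟶ Y) (g : Y ⟶ Z) : redMap (f ≫ g) = redMap f ≫ redMap g := by
  rw [← cancel_mono (redι Z), redMap_redι, Category.assoc, redMap_redι, ← Category.assoc, ← Category.assoc,
    redMap_redι]

/-- Morphisms which are open embeddings on spaces and surjective on stalks induce open immersions of
reductions, as they induce isomorphisms of residue fields. -/
lemma isOpenImmersion_redMap (f : X ⟶ Y) (hf : IsOpenEmbedding f.base)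
    (hs : ∀ x, Function.Surjective (f.stalkMap x).hom) :
    LocallyRingedSpace.IsOpenImmersion (redMap f) := by
  have (x : redLRS X) : IsIso ((redMap f).stalkMap x) := by
    rw [ConcreteCategory.isIso_iff_bijective]
    constructor
    · refine (injective_iff_map_eq_zero ((redMap f).stalkMap x).hom).mpr fun z hz => ?_
      obtain ⟨U, hx, s, rfl⟩ := (redLRS Y).presheaf.exists_germ_eq z
      let V : Opens (redLRS X).toTopCat := (Opens.map (redMap f).base).obj U
      have h1 := (stalkMap_germ_appLE (redMap f) U V le_rfl x hx s).symm.trans hz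
      obtain ⟨W, hW, i, j, e⟩ := (redLRS X).presheaf.germ_eq x hx (U := V) (V := V) hx _ 0
        (h1.trans (map_zero _).symm)
      let N : Opens (redLRS Y).toTopCat := ⟨f.base '' W.1, hf.isOpenMap _ W.2⟩
      have hNU : N ≤ U := by
        rintro _ ⟨y, hy, rfl⟩
        exact i.le hy
      have h2 : secRes (redLRS Y) hNU s = 0 := by
        refine Subtype.ext (funext ?_)
        rintro ⟨_, y, hy, rfl⟩
        have h3 := congrArg (fun t : redSections X W => t.1 ⟨y, hy⟩) e
        exact (map_eq_zero (LocallyRingedSpace.residueFieldMap f y).hom).mp h3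
      refine (germ_secRes (X := redLRS Y) hNU ((redMap f).base x) ⟨x, hW, rfl⟩ s).symm.trans ?_
      rw [h2, map_zero]
    · intro z
      obtain ⟨w, rfl⟩ := redι_stalkMap_surjective x z
      obtain ⟨v, rfl⟩ := hs x w
      obtain ⟨U, hx, s, rfl⟩ := Y.presheaf.exists_germ_eq v
      let V : Opens X.toTopCat := (Opens.map f.base).obj U
      let U' : Opens (redLRS Y).toTopCat := U
      let V' : Opens (redLRS X).toTopCat := V
      refine ⟨((redLRS Y).presheaf.germ U' ((redMap f).base x) hx).hom (appLE (redι Y) U U' le_rfl s), ?_⟩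
      refine (stalkMap_germ_appLE (redMap f) U' V' le_rfl x hx _).trans ?_
      refine Eq.trans ?_ (congrArg ((redι X).stalkMap x).hom (stalkMap_germ_appLE f U V le_rfl x hx s).symm)
      refine Eq.trans ?_ (stalkMap_germ_appLE (redι X) V V' le_rfl x hx _).symm
      refine congrArg ((redLRS X).presheaf.germ V' x hx).hom ?_
      refine (appLE_comp (redMap f) (redι Y) (U := U) (V := U') (W := V') le_rfl le_rfl s).trans ?_
      refine (appLE_congr (redMap_redι f) _ s).trans ?_
      exact (appLE_comp (redι X) f (U := U) (V := V) (W := V') le_rfl le_rfl s).symm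
  exact LocallyRingedSpace.IsOpenImmersion.of_stalk_iso (redMap f) hf

/-- If sections are determined by their values, then a locally ringed space agrees with its reduction. -/
lemma isIso_redι (h : ∀ (U : Opens X.toTopCat) (s : X.presheaf.obj (op U)),
    (∀ x (hx : x ∈ U), ¬ IsUnit ((X.presheaf.germ U x hx).hom s)) → s = 0) : IsIso (redι X) := by
  have (x : redLRS X) : IsIso ((redι X).stalkMap x) := by
    rw [ConcreteCategory.isIso_iff_bijective]
    refine ⟨(injective_iff_map_eq_zero ((redι X).stalkMap x).hom).mpr fun z hz => ?_,
      redι_stalkMap_surjective x⟩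
    obtain ⟨U, hx, s, rfl⟩ := X.presheaf.exists_germ_eq z
    let V : Opens (redLRS X).toTopCat := U
    have h1 := (stalkMap_germ_appLE (redι X) U V le_rfl x hx s).symm.trans hz
    obtain ⟨W, hW, i, j, e⟩ := (redLRS X).presheaf.germ_eq x hx (U := V) (V := V) hx _ 0
      (h1.trans (map_zero _).symm)
    let N : Opens X.toTopCat := W
    have hNU : N ≤ U := i.le
    have h2 : secRes X hNU s = 0 := h _ _ fun y hy => by
      rw [← value_eq_zero_iff, value_secRes]
      exact congrArg (fun t : redSections X W => t.1 ⟨y, hy⟩) e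
    refine (germ_secRes (X := X) hNU x hW s).symm.trans ?_
    exact (congrArg (X.presheaf.germ N x hW).hom h2).trans (map_zero _)
  have := LocallyRingedSpace.IsOpenImmersion.of_stalk_iso (redι X) redι_isHomeomorph.isOpenEmbedding
  have : Epi (redι X).base := by
    rw [TopCat.epi_iff_surjective]
    exact redι_isHomeomorph.surjective
  exact LocallyRingedSpace.IsOpenImmersion.to_iso (redι X)

end Reduction

/-! ### Reductions of formal schemes -/

section SpecToSpf

variable {A B : Type u} [CommRing A] [TopologicalSpace A] [AdmissibleRing A]
  [CommRing B] [TopologicalSpace B] [AdmissibleRing B]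

lemma specToSpf_stalkMap_surjective (J : OpenIdeal A) (q : SpecL (A ⧸ J.1)) :
    Function.Surjective ((specToSpf J).stalkMap q).hom := by
  intro z
  obtain ⟨U, hq, s, rfl⟩ := (SpecL (A ⧸ J.1)).presheaf.exists_germ_eq z
  obtain ⟨_, ⟨_, ⟨f, rfl⟩, rfl⟩, hqf, hfU⟩ :=
    PrimeSpectrum.isBasis_basic_opens.exists_subset_of_mem_open hq U.2
  obtain ⟨a, rfl⟩ := Ideal.Quotient.mk_surjective f
  let V : Opens (OpenPrime A) := spfBasicOpen A a
  have hV : preim J V ≤ U := hfU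
  obtain ⟨n, r, hr⟩ := exists_toSSec_eq (Ideal.Quotient.mk J.1 a) (preim J V) (fun _ => Iff.rfl)
    (secRes (SpecL (A ⧸ J.1)) hV s)
  obtain ⟨r, rfl⟩ := Ideal.Quotient.mk_surjective r
  obtain ⟨b, hb⟩ := ((isUnit_toSec a V le_rfl).pow n).exists_left_inv
  have hbJ : b.1 J * toSSec (preim J V) (Ideal.Quotient.mk J.1 a ^ n) = 1 := by
    rw [map_pow]
    exact congrArg (fun t : spfSections A V => t.1 J) hb
  let s' : SSec (A ⧸ J.1) (preim J V) := secRes (SpecL (A ⧸ J.1)) hV s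
  have hr : toSSec (preim J V) (Ideal.Quotient.mk J.1 a ^ n) * s' =
    toSSec (preim J V) (Ideal.Quotient.mk J.1 r) := hr
  have e : (b * toSec V r : spfSections A V).1 J = s' := by
    change b.1 J * toSSec (preim J V) (Ideal.Quotient.mk J.1 r) = s'
    rw [← hr, ← mul_assoc, hbJ, one_mul]
  refine ⟨((Spf A).presheaf.germ V (specToOpenPrime J q) hqf).hom (b * toSec V r), ?_⟩
  refine (stalkMap_germ_appLE (specToSpf J) V (preim J V) le_rfl q hqf _).trans ?_
  refine (congrArg ((SpecL (A ⧸ J.1)).presheaf.germ (preim J V) q hqf).hom e).trans ?_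
  exact germ_secRes (X := SpecL (A ⧸ J.1)) hV q hqf s

variable (A) in
/-- The radical of the ideals of definition of `A`, as an open ideal. -/
def nilIdeal : OpenIdeal A := ⟨openNilradical A, by
  obtain ⟨J, hJ⟩ := AdmissibleRing.exists_isIdealOfDefinition (A := A)
  exact isOpen_of_le hJ.isOpen (openNilradical_eq_radical hJ ▸ Ideal.le_radical)⟩

lemma isHomeomorph_specToOpenPrime : IsHomeomorph (specToOpenPrime (nilIdeal A)) := by
  rw [isHomeomorph_iff_isEmbedding_surjective]
  refine ⟨⟨?_, specToOpenPrime_injective _⟩, fun x => exists_specToOpenPrime_eq _ x fun a ha =>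
    mem_openNilradical.mp ha x⟩
  refine Topology.IsInducing.of_comp (g := Subtype.val) (specToOpenPrime (nilIdeal A)).continuous
    continuous_subtype_val ?_
  exact (PrimeSpectrum.isClosedEmbedding_comap_of_surjective _ _
    Ideal.Quotient.mk_surjective).isInducing

instance : IsReduced (A ⧸ (nilIdeal A).1) :=
  (Ideal.isRadical_iff_quotient_reduced _).mp openNilradical_isRadical

lemma sec_eq_zero_of_isReduced (R : Type u) [CommRing R] [IsReduced R] (U : Opens (PrimeSpectrum.Top R))
    (s : SSec R U) (h : ∀ x (hx : x ∈ U), ¬ IsUnit (((SpecL R).presheaf.germ U x hx).hom s)) : s = 0 := by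
  let X := Spec (.of R)
  have : IsReduced X := inferInstance
  refine (basicOpen_eq_bot_iff (X := X) (U := U) s).mp ?_
  refine eq_bot_iff.mpr fun x hx => ?_
  have hxU := X.basicOpen_le s hx
  exact absurd ((X.mem_basicOpen s x hxU).mp hx) (h x hxU)

/-- A continuous homomorphism induces a homomorphism between the quotients by the radicals of the ideals
of definition. -/
def nilMap (φ : A →+* B) (hφ : Continuous φ) : A ⧸ (nilIdeal A).1 →+* B ⧸ (nilIdeal B).1 :=
  Ideal.quotientMap _ φ fun _ ha => map_mem_openNilradical φ hφ ha

lemma specToSpf_spfMap (φ : A →+* B) (hφ : Continuous φ) :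
    specToSpf (nilIdeal B) ≫ (Spf.map φ hφ).toLRS = SpecL.map (nilMap φ hφ) ≫ specToSpf (nilIdeal A) := by
  refine lrsHom_ext _ _ (fun x => rfl) fun U x hx s => ?_
  let V : Opens (OpenPrime B) := Opens.comap (spfBase φ hφ) U
  refine ⟨preim (nilIdeal B) V, hx, le_rfl, le_rfl, ?_⟩
  refine (appLE_comp (specToSpf (nilIdeal B)) (Spf.map φ hφ).toLRS (V := V) le_rfl le_rfl s).symm.trans
    (Eq.trans ?_ (appLE_comp (SpecL.map (nilMap φ hφ)) (specToSpf (nilIdeal A))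
      (V := preim (nilIdeal A) U) (W := preim (nilIdeal B) V) le_rfl le_rfl s))
  have hle : (nilIdeal A).1 ≤ (comapIdeal φ hφ (nilIdeal B)).1 := fun _ ha => map_mem_openNilradical φ hφ ha
  have e : nilMap φ hφ = (quotMap φ hφ (nilIdeal B)).comp (Ideal.Quotient.factor hle) := by
    ext; rfl
  have hs := (show spfSections A U from s).2 _ _ hle
  refine (congrArg (quotSec φ hφ (nilIdeal B) U V le_rfl) hs.symm).trans ?_
  refine (comap_comap _ _ _ _ _ _ _ (fun _ hq => hq) _).trans ?_
  exact comap_congr e.symm _ _ _ (fun _ hq => hq) _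

end SpecToSpf

section Reduction

lemma isIso_redMap {X Y : LocallyRingedSpace.{u}} (f : X ⟶ Y) (hf : IsHomeomorph f.base)
    (hs : ∀ x, Function.Surjective (f.stalkMap x).hom) : IsIso (redMap f) := by
  have := isOpenImmersion_redMap f hf.isOpenEmbedding hs
  have : Epi (redMap f).base := by
    rw [TopCat.epi_iff_surjective]
    exact hf.surjective
  exact LocallyRingedSpace.IsOpenImmersion.to_iso (redMap f)

namespace TopLocallyRingedSpace

variable {X Y : TopLocallyRingedSpace.{u}}

/-- The ring `A / J` for a chart `Spf A`, where `J` is the radical of the ideals of definition of `A`. -/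
abbrev Chart.redRing (c : Chart X) : Type u := c.A ⧸ (nilIdeal c.A).1

instance (R : Type u) [CommRing R] [IsReduced R] : IsIso (redι (SpecL R)) :=
  isIso_redι fun U s h => sec_eq_zero_of_isReduced R U s h

/-- The canonical morphism from `Spec (A / J)` to `X` for a chart `Spf A`. -/
def Chart.specι (c : Chart X) : SpecL c.redRing ⟶ X.toLocallyRingedSpace :=
  specToSpf (nilIdeal c.A) ≫ c.j.toLRS

/-- The chart `Spec (A / J)` of the reduction of `X` given by a chart `Spf A` of `X`. -/
def Chart.red (c : Chart X) : SpecL c.redRing ⟶ redLRS X.toLocallyRingedSpace :=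
  inv (redι _) ≫ redMap c.specι

lemma Chart.red_redι (c : Chart X) : c.red ≫ redι _ = c.specι := by
  rw [Chart.red, Category.assoc, redMap_redι, IsIso.inv_hom_id_assoc]

lemma Chart.isOpenEmbedding_specι (c : Chart X) : IsOpenEmbedding c.specι.base :=
  (isOpenEmbedding_base c.j.toLRS).comp isHomeomorph_specToOpenPrime.isOpenEmbedding

lemma Chart.specι_stalkMap_surjective (c : Chart X) (q : SpecL c.redRing) :
    Function.Surjective (c.specι.stalkMap q).hom := by
  intro z
  obtain ⟨w, rfl⟩ := specToSpf_stalkMap_surjective _ _ z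
  obtain ⟨v, rfl⟩ := (ConcreteCategory.bijective_of_isIso
    (c.j.toLRS.stalkMap ((specToSpf (nilIdeal c.A)).base q))).2 w
  refine ⟨v, ?_⟩
  exact congrArg (fun φ => φ.hom v) (LocallyRingedSpace.stalkMap_comp (specToSpf (nilIdeal c.A)) c.j.toLRS q)

instance (c : Chart X) : LocallyRingedSpace.IsOpenImmersion c.red := by
  have := isOpenImmersion_redMap c.specι c.isOpenEmbedding_specι c.specι_stalkMap_surjective
  rw [Chart.red]
  infer_instance

lemma Chart.exists_red_base_eq (c : Chart X) (x : X.toTopCat) (hx : x ∈ c.dom) :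
    ∃ q, c.red.base q = (show (redLRS X.toLocallyRingedSpace).toTopCat from x) := by
  obtain ⟨y, rfl⟩ := hx
  obtain ⟨q, rfl⟩ := isHomeomorph_specToOpenPrime.surjective y
  exact ⟨q, congrArg (fun f : SpecL c.redRing ⟶ X.toLocallyRingedSpace => f.base q) c.red_redι⟩

lemma Chart.red_redMap (c : Chart X) (d : Chart Y) (f : X ⟶ Y) (α : d.A →+* c.A) (hα : Continuous α)
    (h : Spf.map α hα ≫ d.j = c.j ≫ f) : c.red ≫ redMap f.toLRS = SpecL.map (nilMap α hα) ≫ d.red := by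
  rw [← cancel_mono (redι _), Category.assoc, Category.assoc, redMap_redι, Chart.red_redι,
    ← Category.assoc, Chart.red_redι, Chart.specι, Chart.specι, Category.assoc, ← comp_toLRS, ← h,
    comp_toLRS, ← Category.assoc, ← Category.assoc, specToSpf_spfMap]

/-- The reduction of a formal scheme. -/
def redScheme (X : TopLocallyRingedSpace.{u}) (hX : IsFormalScheme X) : Scheme.{u} :=
  LocallyRingedSpace.IsOpenImmersion.scheme (redLRS X.toLocallyRingedSpace) fun x => by
    obtain ⟨c, hc, -⟩ := exists_chart hX x ⊤ trivial
    exact ⟨.of c.redRing, c.red, c.exists_red_base_eq x hc,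
      inferInstanceAs (LocallyRingedSpace.IsOpenImmersion c.red)⟩

end TopLocallyRingedSpace

end Reduction

/-! ### Morphisms of formally finite type -/

namespace TopLocallyRingedSpace

variable {X Y : TopLocallyRingedSpace.{u}}

/-- The chart of the reduction given by a chart, as a morphism of schemes. -/
def Chart.redHom (c : Chart X) (hX : IsFormalScheme X) : Spec (.of c.redRing) ⟶ redScheme X hX :=
  ⟨c.red⟩

instance (c : Chart X) (hX : IsFormalScheme X) : IsOpenImmersion (c.redHom hX) :=
  inferInstanceAs (LocallyRingedSpace.IsOpenImmersion c.red)

/-- The morphism of reductions given by a morphism of formal schemes. -/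
def redSchemeMap (f : X ⟶ Y) (hX : IsFormalScheme X) (hY : IsFormalScheme Y) :
    redScheme X hX ⟶ redScheme Y hY := ⟨redMap f.toLRS⟩

/-- The canonical morphism from the reduction of a formal scheme. -/
def redSchemeι (X : TopLocallyRingedSpace.{u}) (hX : IsFormalScheme X) :
    (redScheme X hX).toLocallyRingedSpace ⟶ X.toLocallyRingedSpace := redι _

lemma Chart.redHom_redSchemeMap (c : Chart X) (d : Chart Y) (f : X ⟶ Y) (hX : IsFormalScheme X)
    (hY : IsFormalScheme Y) (α : d.A →+* c.A) (hα : Continuous α)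
    (h : Spf.map α hα ≫ d.j = c.j ≫ f) :
    c.redHom hX ≫ redSchemeMap f hX hY = Spec.map (CommRingCat.ofHom (nilMap α hα)) ≫ d.redHom hY :=
  congrArg Scheme.Hom.mk (c.red_redMap d f α hα h)

lemma exists_spfMap_comp_eq (c : Chart X) (d : Chart Y) (f : X ⟶ Y)
    (h : c.dom ≤ (Opens.map f.toLRS.base).obj d.dom) :
    ∃ (α : d.A →+* c.A) (hα : Continuous α), Spf.map α hα ≫ d.j = c.j ≫ f := by
  obtain ⟨l, hl⟩ := exists_lift d.j (c.j ≫ f) fun z => h ⟨z, rfl⟩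
  obtain ⟨α, hα, rfl⟩ := exists_spfMap_eq l
  exact ⟨α, hα, hl⟩

/-- Being locally of finite type can be checked on the charts of the reductions; there, finiteness over `B`
is the same as finiteness over the quotient of `B` by its open nilradical. -/
lemma locallyOfFiniteType_redSchemeMap (f : X ⟶ Y) (hX : IsFormalScheme X) (hY : IsFormalScheme Y)
    (h : ∀ x : X.toTopCat, ∃ (c : Chart X) (d : Chart Y) (α : d.A →+* c.A) (hα : Continuous α),
      x ∈ c.dom ∧ Spf.map α hα ≫ d.j = c.j ≫ f ∧
        ((Ideal.Quotient.mk (openNilradical c.A)).comp α).FiniteType) :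
    LocallyOfFiniteType (redSchemeMap f hX hY) := by
  choose c d α hα hx hf hft using h
  let 𝒰 : (redScheme X hX).OpenCover := Scheme.Cover.mkOfCovers X.toTopCat
    (fun x => Spec (.of (c x).redRing)) (fun x => (c x).redHom hX)
    fun x => ⟨x, (c x).exists_red_base_eq x (hx x)⟩
  have : IsZariskiLocalAtSource.{u} @LocallyOfFiniteType.{u} :=
    HasRingHomProperty.instIsZariskiLocalAtSource (Q := RingHom.FiniteType)
  refine IsZariskiLocalAtSource.of_openCover (P := @LocallyOfFiniteType) 𝒰 fun x => ?_
  have h1 : LocallyOfFiniteType (Spec.map (CommRingCat.ofHom (nilMap (α x) (hα x)))) := by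
    rw [HasRingHomProperty.Spec_iff (P := @LocallyOfFiniteType)]
    refine RingHom.FiniteType.of_comp_finiteType (f := Ideal.Quotient.mk (nilIdeal (d x).A).1) ?_
    exact hft x
  have h2 := Chart.redHom_redSchemeMap (c x) (d x) f hX hY (α x) (hα x) (hf x)
  change LocallyOfFiniteType ((c x).redHom hX ≫ redSchemeMap f hX hY)
  rw [h2]
  infer_instance

/-- The converse on a chart. The auxiliary morphism `n` plays the role of the closed immersion of the reduction
of `Y` into the quotient by some ideal of definition; it cancels on the right. -/
lemma finiteType_of_locallyOfFiniteType (c : Chart X) (d : Chart Y) (f : X ⟶ Y) (hX : IsFormalScheme X)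
    (hY : IsFormalScheme Y) (α : d.A →+* c.A) (hα : Continuous α)
    (h : Spf.map α hα ≫ d.j = c.j ≫ f) {S : Scheme.{u}} (n : redScheme Y hY ⟶ S)
    (hft : LocallyOfFiniteType (c.redHom hX ≫ redSchemeMap f hX hY ≫ n)) :
    ((Ideal.Quotient.mk (openNilradical c.A)).comp α).FiniteType := by
  rw [← Category.assoc, Chart.redHom_redSchemeMap c d f hX hY α hα h, Category.assoc] at hft
  have h1 := locallyOfFiniteType_of_comp (Spec.map (CommRingCat.ofHom (nilMap α hα))) (d.redHom hY ≫ n)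
  rw [HasRingHomProperty.Spec_iff (P := @LocallyOfFiniteType)] at h1
  exact RingHom.FiniteType.comp (g := nilMap α hα) h1 (RingHom.FiniteType.of_surjective (Ideal.Quotient.mk (nilIdeal d.A).1)
    Ideal.Quotient.mk_surjective)

lemma appLE_restrictι (U : Opens X.toTopCat) (W : Opens (X.restrict U).toTopCat)
    (h : W ≤ (Opens.map (X.restrictι U).toLRS.base).obj (U.isOpenEmbedding.functor.obj W))
    (t : X.presheaf.obj (op (U.isOpenEmbedding.functor.obj W))) :
    appLE (X.restrictι U).toLRS (U.isOpenEmbedding.functor.obj W) W h t = t :=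
  (secRes_secRes (X := X.toLocallyRingedSpace) (U := U.isOpenEmbedding.functor.obj W)
    (V := U.isOpenEmbedding.functor.obj ((Opens.map (X.restrictι U).toLRS.base).obj
      (U.isOpenEmbedding.functor.obj W))) (W := U.isOpenEmbedding.functor.obj W)
    (by rintro _ ⟨x, hx, rfl⟩; exact hx) (by rintro _ ⟨x, hx, rfl⟩; exact ⟨x, h hx, rfl⟩) t).trans
    (secRes_self (X := X.toLocallyRingedSpace) _ t)

end TopLocallyRingedSpace

open TopLocallyRingedSpace

/-- The reduction of `X` factors through each homeomorphism `i` onto `X` which is surjective on stalks, for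
example the quotient of `X` by an ideal of definition. -/
lemma exists_redι_factor {X S : LocallyRingedSpace.{u}} (i : S ⟶ X) (hi : IsHomeomorph i.base)
    (hs : ∀ x, Function.Surjective (i.stalkMap x).hom) : ∃ m : redLRS X ⟶ S, m ≫ i = redι X := by
  have := isIso_redMap i hi hs
  exact ⟨inv (redMap i) ≫ redι S, by rw [Category.assoc, ← redMap_redι, IsIso.inv_hom_id_assoc]⟩

/-- Since `i` induces an isomorphism of reductions, morphisms from a reduced `T` to `S` are determined by their
composition with `i`. -/
lemma eq_of_comp_eq {T X S : LocallyRingedSpace.{u}} [IsIso (redι T)] (i : S ⟶ X) (hi : IsHomeomorph i.base)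
    (hs : ∀ x, Function.Surjective (i.stalkMap x).hom) {k k' : T ⟶ S} (h : k ≫ i = k' ≫ i) : k = k' := by
  have := isIso_redMap i hi hs
  have h1 : redMap k = redMap k' := by
    rw [← cancel_mono (redMap i), ← redMap_comp, ← redMap_comp, h]
  rw [← cancel_epi (redι T), ← redMap_redι, ← redMap_redι, h1]

namespace FormalScheme

variable {X Y : FormalScheme.{u}}

/-- The reduction of `X` is a closed subscheme of the quotient of `X` by any ideal of definition. -/
lemma IsQuotientScheme.exists_closedImmersion {I : IdealOfDefinition X} {X₀ : Scheme.{u}}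
    {i : X₀.toLocallyRingedSpace ⟶ X.obj.toLocallyRingedSpace} (h : IsQuotientScheme I X₀ i) :
    ∃ m : redLRS X.obj.toLocallyRingedSpace ⟶ X₀.toLocallyRingedSpace,
      IsClosedImmersion (X := redScheme X.obj X.property) (Y := X₀) ⟨m⟩ ∧ m ≫ i = redι _ := by
  obtain ⟨m, hm⟩ := exists_redι_factor i h.isHomeomorph h.stalkMap_surjective
  have hs (x : redLRS X.obj.toLocallyRingedSpace) : Function.Surjective (m.stalkMap x).hom := fun z => by
    have h1 : Function.Surjective ((m ≫ i).stalkMap x).hom := by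
      rw [hm]
      exact redι_stalkMap_surjective x
    obtain ⟨w, hw⟩ := h1 z
    rw [LocallyRingedSpace.stalkMap_comp] at hw
    exact ⟨_, hw⟩
  refine ⟨m, { stalkMap_surjective := hs, isClosedEmbedding := ?_ }, hm⟩
  · have h1 : IsHomeomorph (i.base ∘ m.base) := by
      have : IsHomeomorph (m ≫ i).base := by rw [hm]; exact redι_isHomeomorph
      exact this
    have h2 := (h.isHomeomorph.homeomorph.symm.isHomeomorph).comp h1
    have h3 : (h.isHomeomorph.homeomorph.symm : X.obj.toTopCat → X₀) ∘ (i.base ∘ m.base) = m.base :=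
      funext fun x => h.isHomeomorph.homeomorph.symm_apply_apply _
    rw [h3] at h2
    exact h2.isClosedEmbedding

/-- On charts, morphisms of formally finite type are given by homomorphisms which are of finite type modulo
the radicals of the ideals of definition. -/
theorem IsFormallyFiniteType.finiteType {f : X ⟶ Y} (hf : IsFormallyFiniteType f) (c : Chart X.obj)
    (d : Chart Y.obj) (α : d.A →+* c.A) (hα : Continuous α) (h : Spf.map α hα ≫ d.j = c.j ≫ f.hom) :
    ((Ideal.Quotient.mk (openNilradical c.A)).comp α).FiniteType := by
  obtain ⟨I, J, X₀, Y₀, i, j, f₀, -, hi, hj, hcomm, hft, -⟩ := hf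
  obtain ⟨m, hm, hmi⟩ := hi.exists_closedImmersion
  obtain ⟨n, hn, hnj⟩ := hj.exists_closedImmersion
  refine finiteType_of_locallyOfFiniteType c d f.hom X.property Y.property α hα h (S := Y₀) ⟨n⟩ ?_
  -- the finite type morphism `f₀` between the quotients agrees with `f` on reductions
  have e : c.red ≫ redMap f.hom.toLRS ≫ n = c.red ≫ m ≫ f₀.toLRSHom := by
    refine eq_of_comp_eq (T := SpecL c.redRing) j hj.isHomeomorph hj.stalkMap_surjective ?_
    simp only [Category.assoc]
    rw [hnj, ← hcomm, reassoc_of% hmi, redMap_redι]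
  have e' : c.redHom X.property ≫ redSchemeMap f.hom X.property Y.property ≫
      (⟨n⟩ : redScheme Y.obj Y.property ⟶ Y₀) =
      c.redHom X.property ≫ (⟨m⟩ : redScheme X.obj X.property ⟶ X₀) ≫ f₀ := congrArg Scheme.Hom.mk e
  rw [e']
  infer_instance

lemma app_eq_appLE (f : X ⟶ Y) (U : Y.Opens) (s : Y.sections U) :
    app f U s = appLE f.hom.toLRS U (preimage f U) le_rfl s := (secRes_self _ _).symm

/-- The largest ideal of definition of a noetherian formal scheme: it consists of the sections which are
nowhere invertible. -/
def maxIdeal (X : FormalScheme.{u}) (hX : X.IsNoetherian) : IdealOfDefinition X where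
  ideal U := RingHom.ker ((redι X.obj.toLocallyRingedSpace).c.app (op U)).hom
  res_mem {U V} h s hs := by
    rw [RingHom.mem_ker, redι_app_eq_zero_iff] at hs ⊢
    intro x hx
    have := germ_secRes (X := X.obj.toLocallyRingedSpace) h x hx s
    exact fun hu => hs x (h hx) (this ▸ hu)
  mem_of_locally {U} s hs := by
    rw [RingHom.mem_ker, redι_app_eq_zero_iff]
    intro x hx hu
    obtain ⟨V, h, hxV, hV⟩ := hs x hx
    rw [RingHom.mem_ker, redι_app_eq_zero_iff] at hV
    have := germ_secRes (X := X.obj.toLocallyRingedSpace) h x hxV s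
    exact hV x hxV (this.symm ▸ hu)
  exists_eq x := by
    obtain ⟨U, A, _, _, _, hx, hA, ⟨e⟩⟩ := hX.exists_isNoetherianAdicRing x
    refine ⟨U, A, inferInstance, inferInstance, inferInstance, openNilradical A,
      hA.isIdealOfDefinition_openNilradical, e, hx, fun V s => ?_⟩
    let W : TopologicalSpace.Opens (X.obj.restrict U).toTopCat :=
      (TopologicalSpace.Opens.map e.hom.toLRS.base).obj V
    let N : X.Opens := U.isOpenEmbedding.functor.obj W
    let t : X.sections N := (e.hom.toLRS.c.app (op V)).hom s
    have ht : t = appLE e.hom.toLRS V W le_rfl s :=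
      (secRes_self (X := (X.obj.restrict U).toLocallyRingedSpace) (U := W) le_rfl t).symm
    have hWN : W ≤ (TopologicalSpace.Opens.map (X.obj.restrictι U).toLRS.base).obj N :=
      fun y hy => ⟨y, hy, rfl⟩
    have key (y : (X.obj.restrict U).toTopCat) (hy : y ∈ W) :
        IsUnit ((X.obj.presheaf.germ N ((X.obj.restrictι U).toLRS.base y) (hWN hy)).hom t) ↔
          IsUnit (((Spf A).presheaf.germ V (e.hom.toLRS.base y) hy).hom s) := by
      refine (isUnit_germ_appLE (X.obj.restrictι U).toLRS N W hWN y hy t).symm.trans ?_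
      rw [appLE_restrictι]
      refine Iff.trans ?_ (isUnit_germ_appLE e.hom.toLRS V W le_rfl y hy s)
      exact iff_of_eq (congrArg (fun t => IsUnit (((X.obj.restrict U).presheaf.germ W y hy).hom t)) ht)
    -- both directions compare a section of `Spf A` with its component on the reduced scheme
    -- `Spec (A / openNilradical A)`, where being zero means being nowhere invertible
    have hsurj : Function.Surjective e.hom.toLRS.base := fun z =>
      ⟨e.inv.toLRS.base z, congrArg (fun k : Spf A ⟶ Spf A => k.toLRS.base z) e.inv_hom_id⟩
    refine (redι_app_eq_zero_iff N t).trans ⟨?_, ?_⟩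
    · intro h
      refine sec_eq_zero_of_isReduced (A ⧸ (nilIdeal A).1) (preim (nilIdeal A) V) _ fun q hq hu => ?_
      have h1 := (isUnit_germ_spf_iff V s (nilIdeal A) q hq).mpr hu
      obtain ⟨y, hy⟩ := hsurj (specToOpenPrime (nilIdeal A) q)
      have hyW : y ∈ W := by
        change e.hom.toLRS.base y ∈ V
        rw [hy]
        exact hq
      exact h _ (hWN hyW) ((key y hyW).mpr ((isUnit_germ_congr_point (X := (Spf A).toLocallyRingedSpace)
        s hy hyW hq).mpr h1))
    · rintro h _ ⟨y, hy, rfl⟩ hu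
      have h1 := (key y hy).mp hu
      obtain ⟨q, hq⟩ := isHomeomorph_specToOpenPrime.surjective (e.hom.toLRS.base y)
      have hqV : specToOpenPrime (nilIdeal A) q ∈ V := by rw [hq]; exact hy
      have h2 := (isUnit_germ_spf_iff V s (nilIdeal A) q hqV).mp
        ((isUnit_germ_congr_point (X := (Spf A).toLocallyRingedSpace) s hq hqV hy).mpr h1)
      have h3 : (show spfSections A V from s).1 (nilIdeal A) = 0 := h
      rw [h3, map_zero] at h2
      have := (SpecL (A ⧸ (nilIdeal A).1)).isLocalRing q
      exact not_isUnit_zero (M₀ := (SpecL (A ⧸ (nilIdeal A).1)).presheaf.stalk q) h2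

lemma isQuotientScheme_maxIdeal (hX : X.IsNoetherian) :
    IsQuotientScheme (maxIdeal X hX) (redScheme X.obj X.property) (redSchemeι X.obj X.property) where
  isHomeomorph := redι_isHomeomorph
  stalkMap_surjective := redι_stalkMap_surjective
  app_eq_zero_iff _ _ := Iff.rfl

lemma IsNoetherian.exists_chart (hX : X.IsNoetherian) (x : X.obj.toTopCat) (O : X.Opens) (hO : x ∈ O) :
    ∃ c : Chart X.obj, IsNoetherianAdicRing c.A ∧ x ∈ c.dom ∧ c.dom ≤ O := by
  obtain ⟨U, A, _, _, _, hx, hA, ⟨e⟩⟩ := hX.exists_isNoetherianAdicRing x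
  let c : Chart X.obj := { A := A, j := e.inv ≫ X.obj.restrictι U }
  obtain ⟨c', h1, h2, h3⟩ := c.exists_le x ((mem_range_iso_restrict e).mpr hx) O hO
  exact ⟨c', h3 hA, h1, h2⟩

lemma noetherianSpace_dom (c : Chart X.obj) (hc : IsNoetherianAdicRing c.A) :
    NoetherianSpace (c.dom : Set X.obj.toTopCat) := by
  have := hc.isNoetherianRing
  have : NoetherianSpace (OpenPrime c.A) := Topology.IsInducing.subtypeVal.noetherianSpace
  exact NoetherianSpace.range (α := OpenPrime c.A) c.j.toLRS.base c.j.toLRS.base.hom.continuous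

lemma noetherianSpace_of_finite {κ : Type*} [Finite κ] (c : κ → Chart X.obj)
    (hc : ∀ k, IsNoetherianAdicRing (c k).A) (hcov : ∀ x, ∃ k, x ∈ (c k).dom) :
    NoetherianSpace X.obj.toTopCat := by
  have (k : κ) := noetherianSpace_dom (c k) (hc k)
  have h := NoetherianSpace.iUnion fun k => ((c k).dom : Set X.obj.toTopCat)
  have e : ⋃ k, ((c k).dom : Set X.obj.toTopCat) = Set.univ :=
    Set.eq_univ_of_forall fun x => Set.mem_iUnion.mpr (hcov x)
  rw [e] at h
  exact noetherian_univ_iff.mp h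

lemma isNoetherian_of_finite {κ : Type*} [Finite κ] (c : κ → Chart X.obj)
    (hc : ∀ k, IsNoetherianAdicRing (c k).A) (hcov : ∀ x, ∃ k, x ∈ (c k).dom) : X.IsNoetherian where
  exists_isNoetherianAdicRing x := by
    obtain ⟨k, hk⟩ := hcov x
    exact ⟨(c k).dom, (c k).A, inferInstance, inferInstance, inferInstance, hk, hc k,
      nonempty_iso_restrict (c k).j⟩
  compactSpace := by
    have := noetherianSpace_of_finite c hc hcov
    infer_instance

lemma IsNoetherian.noetherianSpace (hX : X.IsNoetherian) : NoetherianSpace X.obj.toTopCat := by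
  have := hX.compactSpace
  choose c hc hx _ using fun x => hX.exists_chart x ⊤ trivial
  obtain ⟨t, ht⟩ := isCompact_univ.elim_finite_subcover (fun x => ((c x).dom : Set X.obj.toTopCat))
    (fun x => (c x).dom.2) fun x _ => Set.mem_iUnion.mpr ⟨x, hx x⟩
  refine noetherianSpace_of_finite (fun x : t => c x.1) (fun x => hc x.1) fun x => ?_
  obtain ⟨y, hy, hxy⟩ := Set.mem_iUnion₂.mp (ht (Set.mem_univ x))
  exact ⟨⟨y, hy⟩, hxy⟩

/-- Open subsets of noetherian formal schemes are covered by finitely many charts. -/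
lemma IsNoetherian.exists_finite_charts (hX : X.IsNoetherian) (O : X.Opens) :
    ∃ (κ : Type u) (_ : Finite κ) (c : κ → Chart X.obj), (∀ k, IsNoetherianAdicRing (c k).A) ∧
      (∀ k, (c k).dom ≤ O) ∧ ∀ x ∈ O, ∃ k, x ∈ (c k).dom := by
  have := hX.noetherianSpace
  choose c hc hx hO using fun x : O => hX.exists_chart x.1 O x.2
  obtain ⟨t, ht⟩ := (NoetherianSpace.isCompact (O : Set X.obj.toTopCat)).elim_finite_subcover
    (fun x : O => ((c x).dom : Set X.obj.toTopCat))
    (fun x => (c x).dom.2) fun x hxO => Set.mem_iUnion.mpr ⟨⟨x, hxO⟩, hx ⟨x, hxO⟩⟩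
  refine ⟨t, inferInstance, fun x => c x.1, fun x => hc x.1, fun x => hO x.1, fun x hxO => ?_⟩
  obtain ⟨y, hy, hxy⟩ := Set.mem_iUnion₂.mp (ht hxO)
  exact ⟨⟨y, hy⟩, hxy⟩

/-- A criterion for morphisms of formally finite type, in terms of charts. -/
theorem isFormallyFiniteType_of_chart (hX : X.IsNoetherian) (hY : Y.IsNoetherian) (f : X ⟶ Y)
    (h : ∀ x : X.obj.toTopCat, ∃ (c : Chart X.obj) (d : Chart Y.obj) (α : d.A →+* c.A)
      (hα : Continuous α), x ∈ c.dom ∧ Spf.map α hα ≫ d.j = c.j ≫ f.hom ∧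
        ((Ideal.Quotient.mk (openNilradical c.A)).comp α).FiniteType) : IsFormallyFiniteType f := by
  refine ⟨maxIdeal X hX, maxIdeal Y hY, _, _, _, _, redSchemeMap f.hom X.property Y.property,
    fun U => ?_, isQuotientScheme_maxIdeal hX, isQuotientScheme_maxIdeal hY,
    (redMap_redι f.hom.toLRS).symm, locallyOfFiniteType_redSchemeMap f.hom X.property Y.property h, ?_⟩
  · rw [Ideal.map_le_iff_le_comap]
    intro s hs
    have hs' := (redι_app_eq_zero_iff U s).mp hs
    refine (redι_app_eq_zero_iff (preimage f U) (app f U s)).mpr fun x hx => ?_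
    rw [app_eq_appLE]
    exact fun hu => hs' _ hx ((isUnit_germ_appLE f.hom.toLRS U _ le_rfl x hx s).mp hu)
  · have : NoetherianSpace (redScheme X.obj X.property) := hX.noetherianSpace
    infer_instance

end FormalScheme

/-! ### Fibre products of noetherian formal schemes -/

namespace FormalScheme

open TopLocallyRingedSpace

variable {X Y Y' : FormalScheme.{u}}

/-- The fibre product is glued from finitely many formal spectra of completed tensor products. -/
theorem exists_isPullbackOver (hX : X.IsNoetherian) (hY : Y.IsNoetherian) (hY' : Y'.IsNoetherian)
    (f : X ⟶ Y) (hf : IsFormallyFiniteType f) (g : Y' ⟶ Y) :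
    ∃ (G : TopLocallyRingedSpace.{u}) (p : G ⟶ X.obj) (q : G ⟶ Y'.obj),
      IsPullbackOver f.hom g.hom ⊤ ⊤ p q ∧
      ∃ (κ : Type u) (_ : Finite κ) (e : κ → Chart G), (∀ z, ∃ k, z ∈ (e k).dom) ∧
        ∀ k, IsNoetherianAdicRing (e k).A ∧
          ∃ (c : Chart Y'.obj) (γ : c.A →+* (e k).A) (hγ : Continuous γ),
            Spf.map γ hγ ≫ c.j = (e k).j ≫ q ∧
            ((Ideal.Quotient.mk (openNilradical (e k).A)).comp γ).FiniteType := by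
  obtain ⟨κ, _, d, -, -, hd⟩ := hY.exists_finite_charts ⊤
  choose μ hμ c hc hcd hcov using fun k => hX.exists_finite_charts (preimage f (d k).dom)
  choose ν hν c' hc' hcd' hcov' using fun k => hY'.exists_finite_charts (preimage g (d k).dom)
  let ι : Type u := Σ k, μ k × ν k
  have key (i : ι) : ∃ (P : TopLocallyRingedSpace.{u}) (p : P ⟶ X.obj) (q : P ⟶ Y'.obj) (e : Chart P)
      (γ : (c' i.1 i.2.2).A →+* e.A) (hγ : Continuous γ),
      IsPullbackOver f.hom g.hom (c i.1 i.2.1).dom (c' i.1 i.2.2).dom p q ∧ (∀ z, z ∈ e.dom) ∧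
      IsNoetherianAdicRing e.A ∧ Spf.map γ hγ ≫ (c' i.1 i.2.2).j = e.j ≫ q ∧
      ((Ideal.Quotient.mk (openNilradical e.A)).comp γ).FiniteType := by
    obtain ⟨α, hα, hαf⟩ := exists_spfMap_comp_eq (c i.1 i.2.1) (d i.1) f.hom (hcd _ _)
    obtain ⟨β, hβ, hβg⟩ := exists_spfMap_comp_eq (c' i.1 i.2.2) (d i.1) g.hom (hcd' _ _)
    exact exists_isPullbackOver_chart _ _ (d i.1) (hc _ _) (hc' _ _) α hα hαf β hβ hβg
      (hf.finiteType _ _ α hα hαf)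
  choose P p q e γ hγ hP hdom he hγq hft using key
  obtain ⟨G, p', q', j, hj, hp', hq', hcovG, hG⟩ := exists_isPullbackOver_glued hP fun x y hxy => by
    obtain ⟨k, hk⟩ := hd (f.hom.toLRS.base x) trivial
    obtain ⟨m, hm⟩ := hcov k x hk
    obtain ⟨n, hn⟩ := hcov' k y (by
      change g.hom.toLRS.base y ∈ (d k).dom
      rw [← hxy]
      exact hk)
    exact ⟨⟨k, m, n⟩, hm, hn⟩
  refine ⟨G, p', q', hG, ι, inferInstance, fun i => (e i).comp (j i), fun z => ?_, fun i =>
    ⟨he i, c' i.1 i.2.2, γ i, hγ i, ?_, hft i⟩⟩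
  · obtain ⟨i, w, rfl⟩ := hcovG z
    obtain ⟨v, rfl⟩ := hdom i w
    exact ⟨i, v, rfl⟩
  · refine (hγq i).trans ?_
    rw [← hq']
    exact (Category.assoc _ _ _).symm

lemma isPullback_of_isPullbackOver {f : X ⟶ Y} {g : Y' ⟶ Y} {G : FormalScheme.{u}} {p : G ⟶ X}
    {q : G ⟶ Y'} (h : IsPullbackOver f.hom g.hom ⊤ ⊤ p.hom q.hom) : IsPullback p q f g := by
  have w : p ≫ f = q ≫ g := ObjectProperty.hom_ext _ h.w
  have hl (s : Limits.PullbackCone f g) : ∃ t : s.pt ⟶ G, t ≫ p = s.fst ∧ t ≫ q = s.snd := by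
    obtain ⟨t, h1, h2⟩ := h.exists_lift s.pt.property s.fst.hom s.snd.hom
      (congrArg (fun z => z.hom) s.condition) (fun _ => trivial) fun _ => trivial
    exact ⟨ObjectProperty.homMk t, ObjectProperty.hom_ext _ h1, ObjectProperty.hom_ext _ h2⟩
  choose l hlp hlq using hl
  exact ⟨⟨w⟩, ⟨Limits.PullbackCone.IsLimit.mk w l hlp hlq fun s m h1 h2 =>
    ObjectProperty.hom_ext _ (h.hom_ext s.pt.property
      (congrArg (fun z => z.hom) (h1.trans (hlp s).symm))
      (congrArg (fun z => z.hom) (h2.trans (hlq s).symm)))⟩⟩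

end FormalScheme

end
end FormalGeometry

open FormalGeometry FormalGeometry.TopLocallyRingedSpace FormalGeometry.FormalScheme in
theorem theorem1p10 {X Y Y' : FormalGeometry.FormalScheme.{u}}
    (hX : X.IsNoetherian) (hY : Y.IsNoetherian) (hY' : Y'.IsNoetherian)
    (f : X ⟶ Y) (hf : FormalGeometry.FormalScheme.IsFormallyFiniteType f) (g : Y' ⟶ Y) :
    Limits.HasPullback f g ∧
      ∀ (X' : FormalGeometry.FormalScheme.{u}) (p : X' ⟶ X) (q : X' ⟶ Y'), IsPullback p q f g →
        X'.IsNoetherian ∧ FormalGeometry.FormalScheme.IsFormallyFiniteType q := by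
  obtain ⟨G, p₀, q₀, hG, κ, _, e, hcov, he⟩ := exists_isPullbackOver hX hY hY' f hf g
  have h₀ : IsPullback (P := ⟨G, hG.isFormalScheme⟩) (ObjectProperty.homMk p₀) (ObjectProperty.homMk q₀)
      f g := isPullback_of_isPullbackOver hG
  refine ⟨h₀.hasPullback, fun X' p q h => ?_⟩
  let φ := h₀.isoIsPullback _ _ h
  have hφ : φ.hom.hom ≫ q.hom = q₀ := congrArg (fun z => z.hom) (h₀.isoIsPullback_hom_snd _ _ h)
  let e' (k : κ) : Chart X'.obj := (e k).comp φ.hom.hom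
  have hcov' (x : X'.obj.toTopCat) : ∃ k, x ∈ (e' k).dom := by
    obtain ⟨k, w, hw⟩ := hcov (φ.inv.hom.toLRS.base x)
    have h1 : φ.hom.hom.toLRS.base (φ.inv.hom.toLRS.base x) = x :=
      congrArg (fun z : X' ⟶ X' => z.hom.toLRS.base x) φ.inv_hom_id
    exact ⟨k, w, (congrArg φ.hom.hom.toLRS.base hw).trans h1⟩
  have hX' : X'.IsNoetherian := isNoetherian_of_finite e' (fun k => (he k).1) hcov'
  refine ⟨hX', isFormallyFiniteType_of_chart hX' hY' q fun x => ?_⟩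
  obtain ⟨k, hk⟩ := hcov' x
  obtain ⟨-, c, γ, hγ, hγq, hft⟩ := he k
  refine ⟨e' k, c, γ, hγ, hk, hγq.trans ?_, hft⟩
  rw [← hφ]
  exact (Category.assoc _ _ _).symm
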